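/- **Setting.** $M$ is a Hausdorff space with a continuous semiflow $(t,\omega)\mapsto t\omega$, $t\ge 0$. For $g:M\to\mathbb R$ write $g\in\mathcal E_1(t)$ if $g(t\omega)\le g(\omega)$ for all $t\ge0$, $\omega\in M$; call $g$ *invariant* if $\pm g\in\mathcal E_1(t)$. $Z$ is a Banach space. (MR) $A:D(A)\subset Z\to Z$ is a closed linear operator with $\rho(A)\ne\emptyset$; the part of $A$ in $E:=\overline{D(A)}$ generates a $C_0$ semigroup $T_0(t)$ with $|T_0(t)|\le e^{\mu t}$; $A$ generates the once integrated semigroup $S$, and with $(S\Diamond f)(t)=\frac{d}{dt}\int_0^tS(t-s)f(s)\,ds$ one has $\sup_{[0,t]}|S\Diamond f|\le\delta(t)\sup_{[0,t]}|f|$ for all $t>0$, $f\in C^1([0,t],Z)$, where $\delta$ is increasing and $\delta(t)\to0$ as $t\to0^+$. (D1) $L:M\to L(E,Z)$, $(\omega,z)\mapsto L(\omega)z$ is continuous, $\tau(\omega)=\sup_{t\ge0}|L(t\omega)|<\infty$ and $\tau$ is locally bounded. (D2) $f:M\times E\to Z$ is continuous, $\varepsilon(\omega)=\sup_{t\ge0}\operatorname{Lip}f(t\omega)(\cdot)<\infty$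 and $\varepsilon$ is locally bounded. Put $\delta_1(t,\omega)=\delta(t)/(1-\tau(\omega)\delta(t))$ if $\tau(\omega)\delta(t)<1$ and $\delta_1(t,\omega)=\infty$ otherwise. Let $T_0(t,\omega)$ be the $C_0$ linear cocycle on $E$ generated by $\dot z=Az+L(t\omega)z$, i.e. the strongly continuous solution of $T_0(t,\omega)=T_0(t)+[S\Diamond(L(\cdot\,\omega)T_0(\cdot,\omega))](t)$. (UD) $E=X_\omega\oplus Y_\omega$ with projections $P_\omega$ ($R(P_\omega)=X_\omega$, $\ker P_\omega=Y_\omega$), strongly continuous in $\omega$, $P^c_\omega=I-P_\omega$, $|P_\omega|,|P^c_\omega|\le C_1$ with $C_1>0$; $T_0(t,\omega)X_\omega\subset X_{t\omega}$ and $T_0(t,\omega):Y_\omega\to Y_{t\omega}$ is invertible, with inverse $\widehat S(-t,t\omega)$; and there are $\mu_s,\mu_u:M\to\mathbb R$ with $\|T_0(t,r\omega)|_{X_{r\omega}}\|\le e^{\mu_s(\omega)t}$, $|\widehat S(-t,t(r\omega))|\le e^{-\mu_u(\omega)t}$ for all $t,r\ge0$, $\omega\in M$. For continuous $g:[0,b]\to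 Z$ let $v=(S_0\Diamond g)(\omega)$ be the continuous solution $v:[0,b]\to E$ of $v=S\Diamond(L(\cdot\,\omega)v+g)$. $H(b,\omega):X_\omega\times Y_\omega\to X_{b\omega}\times Y_{b\omega}$ is the correspondence with $(x_2,y_2)\in H(b,\omega)(x_1,y_1)$ iff there is a continuous $z:[0,b]\to E$ with $z(0)=x_1+y_1$, $z(b)=x_2+y_2$ such that for all $0\le t\le b$ $$P_{t\omega}z(t)=T_0(t,\omega)P_\omega z(0)+P_{t\omega}(S_0\Diamond f(\cdot\,\omega)z)(\omega)(t),$$ $$P^c_{t\omega}z(t)=\widehat S(t-b,b\omega)\big[P^c_{b\omega}z(b)-P^c_{b\omega}(S_0\Diamond f_t(\cdot\,\omega)z_t)(t\omega)(b-t)\big],$$ where $f_t(s\omega)=f((t+s)\omega)$, $z_t(s)=z(t+s)$. $U(b,\omega)$ is the correspondence between $z(0)$ and $z(b)$ for mild solutions $z$ of $\dot z=Az+L(t\omega)z+f(t\omega)z$ on $[0,b]$, i.e. $z\in C([0,b],E)$ with $\int_0^tz\in D(A)$ and $z(t)=z(0)+A\int_0^tz+\int_0^t(L(s\omega)z(s)+f(s\omega)z(s))\,ds$.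 A correspondence satisfies (A)$(\alpha;\alpha',\lambda_u)$ if for any two points $((x_1,y_1),(x_2,y_2))$, $((x_1',y_1'),(x_2',y_2'))$ of its graph, $|x_1-x_1'|\le\alpha|y_1-y_1'|$ implies $|x_2-x_2'|\le\alpha'|y_2-y_2'|$ and $|y_1-y_1'|\le\lambda_u|y_2-y_2'|$; it satisfies (B)$(\beta;\beta',\lambda_s)$ if $|y_2-y_2'|\le\beta|x_2-x_2'|$ implies $|y_1-y_1'|\le\beta'|x_1-x_1'|$ and $|x_2-x_2'|\le\lambda_s|x_1-x_1'|$. (A)$(\alpha,\lambda_u)$ and (B)$(\beta,\lambda_s)$ stand for $\alpha'=\alpha$, $\beta'=\beta$. **Theorem.** Let (MR), (D1), (D2), (UD) hold. **(1)** Assume $\delta(t)/t\to1$ as $t\to0^+$ and $\mu_u(\omega)-\mu_s(\omega)-2\varepsilon'(\omega)>0$ for all $\omega$, where $\varepsilon'=2C_1\varepsilon$. Put $\sigma=\mu_u-\mu_s-\varepsilon'$, $\lambda_u=e^{-\mu_u+\varepsilon'}$, $\lambda_s=e^{\mu_s+\varepsilon'}$. - If $\varepsilon'/\sigma\le\alpha,\beta<1$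 pointwise, then $H(t,s\omega)$ satisfies (A)$(\alpha(\omega),\lambda_u^t(\omega))$ (B)$(\beta(\omega),\lambda_s^t(\omega))$ for all $t,s\ge0$, $\omega\in M$. - If $\varepsilon'/\sigma<\alpha,\beta<1$ pointwise, there are $k_\alpha(\omega,\epsilon_1),k_\beta(\omega,\epsilon_1)\in(0,1)$ such that for $t\ge\epsilon_1>0$, $s\ge0$, $H(t,s\omega)$ satisfies (A)$(\alpha(\omega);k_\alpha(\omega,\epsilon_1)\alpha(\omega),\lambda_u^t(\omega))$ (B)$(\beta(\omega);k_\beta(\omega,\epsilon_1)\beta(\omega),\lambda_s^t(\omega))$. - If $\inf_\omega\{\mu_u-\mu_s-(1+c)\varepsilon'\}>0$ for some constant $c>1$, then $\alpha,\beta$ and (for each $\epsilon_1$) $k_\alpha,k_\beta$ can be taken to be constants less than $1$, and $\sup_\omega\lambda_s\lambda_u<1$. Moreover (the rest of the data being fixed and $f$ varying subject to this condition with fixed $c$) these constants $\alpha,\beta$ can be taken arbitrarily small when $\sup_\omega\varepsilon'$ is small enough. **(2)** In general, let $\eta:M\to(0,\infty)$, $\eta\in\mathcal E_1(t)$, $\mu_u-\mu_s-2\eta>0$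 pointwise, and let $\varepsilon_1:M\to(0,\infty)$ be any function. Call functions $\vartheta,\alpha,\alpha_1,\beta,\beta_1,k:M\to(0,\infty)$, $\tilde\lambda_s,\tilde\lambda_u:M\to[0,\infty)$ *admissible* if $\alpha<\alpha_1$, $\beta<\beta_1$ pointwise, $\sup_\omega\{\alpha_1,\beta_1\}<1$, $\tilde\lambda_s\le e^{\mu_s+\eta}$, $\tilde\lambda_u\le e^{-\mu_u+\eta}$, $\tilde\lambda_s\tilde\lambda_u<1$, and, for every system $(Z,A,L,f)$ as above with the given $\delta_1,\mu_s,\mu_u,C_1$, at each $\omega$ with $\varepsilon(\omega)<\vartheta(\omega)$: (a) $H(t,s\omega)$ and $U(t,s\omega)$ satisfy (A)$(\alpha;\alpha_1,k\tilde\lambda_u^t)$ (B)$(\beta;\beta_1,k\tilde\lambda_s^t)$ (functions evaluated at $\omega$) for all $t,s\ge0$; (b) $H(t,s\omega)$ and $U(t,s\omega)$ satisfy (A)$(\alpha_1;\alpha,k\tilde\lambda_u^t)$ (B)$(\beta_1;\beta,k\tilde\lambda_s^t)$ for all $t\ge\varepsilon_1(\omega)$, $s\ge0$; and moreover (e) $\inf_\omega\{\mu_u-\mu_s\}>0$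 implies $\sup_\omega\tilde\lambda_s\tilde\lambda_u<1$; $\sup_\omega\mu_s<0$ implies $\sup_\omega\tilde\lambda_s<1$; $\inf_\omega\mu_u>0$ implies $\sup_\omega\tilde\lambda_u<1$. Then, given $\delta_1,\mu_s,\mu_u,C_1,\varepsilon_1,\eta$, there are admissible functions with $\tilde\lambda_s,\tilde\lambda_u\in\mathcal E_1(t)$, and also $\vartheta\in\mathcal E_1(t)$ provided that for each $\omega$ there is $t_0>0$ such that on $\{\omega_0:s\omega_0=\omega\text{ for some }s\ge0\}$ the function $\varepsilon_1$ is bounded away from $0$ and $\mu_s,\mu_u,\delta_1(t_0,\cdot)$ are bounded. Furthermore: (c) If $\inf_\omega\varepsilon_1(\mu_u-\mu_s)>0$, there are $\vartheta:M\to(0,\infty)$, $\tilde\lambda_s,\tilde\lambda_u\in\mathcal E_1(t)$ and a constant $k$ such that for each $\rho>0$ there are $\varepsilon_0>0$ and constants $\alpha,\alpha_1,\beta,\beta_1<1$ with $\alpha_1,\beta_1\le\rho$ for which $\min\{\vartheta,\varepsilon_0\},\alpha,\alpha_1,\beta,\beta_1,k,\tilde\lambda_s,\tilde\lambda_u$ are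 admissible. So the cone functions can be chosen constant, with $\sup\{\alpha_1,\beta_1\}\to0$ as $\sup_\omega\varepsilon(\omega)\to0$. (d) Let $M$ be locally metrizable: each $m\in M$ has an open neighbourhood $U_m$ with a metric $d_m$ inducing its topology. For $M_1\subset M$, call $g:M\to\mathbb R$ *$\xi$-almost uniformly continuous around $M_1$* if $\limsup_{\sigma\to0^+}\sup\{|g(m)-g(m_0)|:m_0\in M_1,\ m\in U_{m_0},\ d_{m_0}(m,m_0)<\sigma\}\le\xi$. If $\mu_s,\mu_u,\eta$ are bounded, there are a constant $C>0$ and admissible functions with $\tilde\lambda_s,\tilde\lambda_u$ bounded, such that for all $M_1$ and $\xi\ge0$: if $\mu_s,\mu_u,\eta$ are $\xi$-almost uniformly continuous around $M_1$, then $\tilde\lambda_s,\tilde\lambda_u$ are $C\xi$-almost uniformly continuous around $M_1$. Here $\tilde\lambda_s\in\mathcal E_1(t)$ if $\mu_s\in\mathcal E_1(t)$, and $\tilde\lambda_u\in\mathcal E_1(t)$ if $-\mu_u\in\mathcal E_1(t)$. (f) If $\tau$ (equivalently, each $\delta_1(t,\cdot)$) and $\mu_s,\mu_u,\eta,\varepsilon_1$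 are invariant, there are admissible functions $\vartheta,\alpha,\alpha_1,\beta,\beta_1,k,\tilde\lambda_s,\tilde\lambda_u$ that are all invariant. -/

import Mathlib

open Set Filter Topology MeasureTheory
open scoped NNReal ENNReal

universe u v

noncomputable section

/-! ### Correspondences and the (A)(B) condition -/

/-- The (A)`(α; α', lamU)` (B)`(β; β', lamS)` condition for a correspondence
`H : X₁ × Y₁ → X₂ × Y₂` between metric spaces, given by its graph. -/
structure SatisfiesAB {X₁ Y₁ X₂ Y₂ : Type*} [MetricSpace X₁] [MetricSpace Y₁] [MetricSpace X₂]
    [MetricSpace Y₂] (H : Set ((X₁ × Y₁) × (X₂ × Y₂))) (α α' lamU β β' lamS : ℝ) : Prop where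
  A1 : ∀ p ∈ H, ∀ q ∈ H, dist p.1.1 q.1.1 ≤ α * dist p.1.2 q.1.2 →
    dist p.2.1 q.2.1 ≤ α' * dist p.2.2 q.2.2
  A2 : ∀ p ∈ H, ∀ q ∈ H, dist p.1.1 q.1.1 ≤ α * dist p.1.2 q.1.2 →
    dist p.1.2 q.1.2 ≤ lamU * dist p.2.2 q.2.2
  B1 : ∀ p ∈ H, ∀ q ∈ H, dist p.2.2 q.2.2 ≤ β * dist p.2.1 q.2.1 →
    dist p.1.2 q.1.2 ≤ β' * dist p.1.1 q.1.1
  B2 : ∀ p ∈ H, ∀ q ∈ H, dist p.2.2 q.2.2 ≤ β * dist p.2.1 q.2.1 →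
    dist p.2.1 q.2.1 ≤ lamS * dist p.1.1 q.1.1

/-! ### The base semiflow -/

section Base

variable {M : Type v} [TopologicalSpace M]

/-- The point `tω` of the semiflow, for a real time `t` (used for `0 ≤ t` only). -/
def orb (φ : Flow ℝ≥0 M) (t : ℝ) (ω : M) : M := φ t.toNNReal ω

/-- The class `𝓔₁(t)`: `g (tω) ≤ g ω` for all `t ≥ 0` and all `ω`. -/
def DecreasingAlong (φ : Flow ℝ≥0 M) (g : M → ℝ) : Prop :=
  ∀ (t : ℝ≥0) (ω : M), g (φ t ω) ≤ g ω

/-- `g` and `-g` both belong to `𝓔₁(t)`, that is, `g (tω) = g ω`. -/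
def InvariantAlong (φ : Flow ℝ≥0 M) (g : M → ℝ) : Prop :=
  DecreasingAlong φ g ∧ DecreasingAlong φ (fun ω => -g ω)

end Base

/-- A locally metrizable space: every point `m` has an open neighbourhood `U m` with a metric
`d m` on it that induces the subspace topology. -/
structure LocallyMetrizable (M : Type v) [TopologicalSpace M] where
  U : M → Set M
  isOpen_U : ∀ m, IsOpen (U m)
  mem_U : ∀ m, m ∈ U m
  d : ∀ m, MetricSpace (U m)
  compat : ∀ m, (d m).toPseudoMetricSpace.toUniformSpace.toTopologicalSpace =
    instTopologicalSpaceSubtype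

namespace LocallyMetrizable

variable {M : Type v} [TopologicalSpace M]

/-- `U_m(σ) = {m' ∈ U_m : d_m(m', m) < σ}`. -/
def smallBall (loc : LocallyMetrizable M) (m : M) (σ : ℝ) : Set M :=
  {m' | ∃ h : m' ∈ loc.U m, (loc.d m).dist ⟨m', h⟩ ⟨m, loc.mem_U m⟩ < σ}

/-- The amplitude of `g` around `M₁` at scale `σ`. -/
def amplitude (loc : LocallyMetrizable M) (M₁ : Set M) (g : M → ℝ) (σ : ℝ) : ℝ≥0∞ :=
  ⨆ m₀ ∈ M₁, ⨆ m ∈ loc.smallBall m₀ σ, ENNReal.ofReal |g m - g m₀|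

/-- `g` is `ξ`-almost uniformly continuous around `M₁`: its amplitude is at most `ξ` in the limit
`σ → 0⁺`. -/
def AlmostUniformlyContinuous (loc : LocallyMetrizable M) (M₁ : Set M) (ξ : ℝ) (g : M → ℝ) :
    Prop :=
  limsup (loc.amplitude M₁ g) (𝓝[>] (0 : ℝ)) ≤ ENNReal.ofReal ξ

end LocallyMetrizable

/-! ### Operators, semigroups, integrated semigroups -/

section Operators

variable {E : Type*} [NormedAddCommGroup E] [NormedSpace ℝ E]

/-- `R` is the (bounded) resolvent `(lam - B)⁻¹`; in particular `lam ∈ ρ(B)`. -/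
def IsResolventAt (B : E →ₗ.[ℝ] E) (lam : ℝ) (R : E →L[ℝ] E) : Prop :=
  (∀ z : E, ∃ h : R z ∈ B.domain, lam • R z - B ⟨R z, h⟩ = z) ∧
  ∀ x : B.domain, R (lam • (x : E) - B x) = x

/-- `B` generates the `C₀` semigroup `T` (the values of `T` at negative times play no role). -/
def GeneratesC0Semigroup (B : E →ₗ.[ℝ] E) (T : ℝ → E →L[ℝ] E) : Prop :=
  (∀ x, ContinuousOn (fun t => T t x) (Ici 0)) ∧
  ∃ w : ℝ, ∀ lam > w, ∃ R : E →L[ℝ] E, IsResolventAt B lam R ∧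
    ∀ x, IntegrableOn (fun t => Real.exp (-lam * t) • T t x) (Ioi 0) ∧
      R x = ∫ t in Ioi (0 : ℝ), Real.exp (-lam * t) • T t x

/-- `B` generates the once (exponentially bounded) integrated semigroup `S`. -/
def GeneratesIntegratedSemigroup (B : E →ₗ.[ℝ] E) (S : ℝ → E →L[ℝ] E) : Prop :=
  (∀ x, ContinuousOn (fun t => S t x) (Ici 0)) ∧
  (∃ K w : ℝ, ∀ t ≥ 0, ‖S t‖ ≤ K * Real.exp (w * t)) ∧
  ∃ w : ℝ, ∀ lam > w, ∃ R : E →L[ℝ] E, IsResolventAt B lam R ∧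
    ∀ x, IntegrableOn (fun t => Real.exp (-lam * t) • S t x) (Ioi 0) ∧
      R x = lam • ∫ t in Ioi (0 : ℝ), Real.exp (-lam * t) • S t x

/-- `(S ◇ f)(t) = d/dt ∫₀ᵗ S(t-s) f(s) ds`, for a function `f` on `[0, b]` and `t ∈ [0, b]`. -/
def diamond (b : ℝ) (S : ℝ → E →L[ℝ] E) (f : ℝ → E) (t : ℝ) : E :=
  derivWithin (fun r => ∫ s in (0 : ℝ)..r, S (r - s) (f s)) (Icc 0 b) t

/-- `|f|_{[0, b]} = sup_{s ∈ [0, b]} |f(s)|`. -/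
def supNormOn (b : ℝ) (f : ℝ → E) : ℝ := sSup ((fun s => ‖f s‖) '' Icc 0 b)

/-- The closure of the domain of `A`, as a Banach space. -/
abbrev DomClosure (A : E →ₗ.[ℝ] E) : Type _ := A.domain.topologicalClosure

/-- The part of `A` in the closure of its domain. -/
def partInClosure (A : E →ₗ.[ℝ] E) : DomClosure A →ₗ.[ℝ] DomClosure A where
  domain :=
    { carrier := {x | ∃ h : (x : E) ∈ A.domain, A ⟨x, h⟩ ∈ A.domain.topologicalClosure}
      zero_mem' := ⟨A.domain.zero_mem, by
        have h : A ⟨((0 : DomClosure A) : E), A.domain.zero_mem⟩ = 0 := A.map_zero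
        rw [h]; exact Submodule.zero_mem _⟩
      add_mem' := by
        rintro x y ⟨hx, hx'⟩ ⟨hy, hy'⟩
        refine ⟨A.domain.add_mem hx hy, ?_⟩
        have h : A ⟨((x + y : DomClosure A) : E), A.domain.add_mem hx hy⟩ =
            A ⟨x, hx⟩ + A ⟨y, hy⟩ := A.map_add ⟨x, hx⟩ ⟨y, hy⟩
        rw [h]; exact Submodule.add_mem _ hx' hy'
      smul_mem' := by
        rintro c x ⟨hx, hx'⟩
        refine ⟨A.domain.smul_mem c hx, ?_⟩
        have h : A ⟨((c • x : DomClosure A) : E), A.domain.smul_mem c hx⟩ = c • A ⟨x, hx⟩ :=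
          A.map_smul c ⟨x, hx⟩
        rw [h]; exact Submodule.smul_mem _ c hx' }
  toFun :=
    { toFun := fun x => ⟨A ⟨(x : DomClosure A), x.2.1⟩, x.2.2⟩
      map_add' := fun x y => Subtype.ext
        (A.map_add ⟨((x : DomClosure A) : E), x.2.1⟩ ⟨((y : DomClosure A) : E), y.2.1⟩)
      map_smul' := fun c x => Subtype.ext
        (A.map_smul c ⟨((x : DomClosure A) : E), x.2.1⟩) }

/-- `A` is an MR operator: `A` is closed with non-empty resolvent set, its part in the closure of
`D(A)` generates the `C₀` semigroup `T₀` with `|T₀(t)| ≤ e^{μt}`, `A` generates the integrated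
semigroup `S`, and `|S ◇ f|_{[0,t]} ≤ δ(t) |f|_{[0,t]}` for all `C¹` functions `f`, where `δ` is
increasing and `δ(t) → 0` as `t → 0⁺`. -/
structure IsMROperator (A : E →ₗ.[ℝ] E) (T₀ : ℝ → DomClosure A →L[ℝ] DomClosure A) (μ : ℝ)
    (S : ℝ → E →L[ℝ] E) (δ : ℝ → ℝ) : Prop where
  closed : A.IsClosed
  resolvent : ∃ (lam : ℝ) (R : E →L[ℝ] E), IsResolventAt A lam R
  semigroup : GeneratesC0Semigroup (partInClosure A) T₀
  semigroup_le : ∀ t ≥ 0, ‖T₀ t‖ ≤ Real.exp (μ * t)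
  integrated : GeneratesIntegratedSemigroup A S
  mono : MonotoneOn δ (Ioi 0)
  tendsto : Tendsto δ (𝓝[>] 0) (𝓝 0)
  diamond_le : ∀ b > 0, ∀ f : ℝ → E, ContDiffOn ℝ 1 f (Icc 0 b) →
    supNormOn b (diamond b S f) ≤ δ b * supNormOn b f

end Operators

/-! ### Lipschitz constants along orbits -/

/-- The Lipschitz constant of a map (`⊤` if the map is not Lipschitz). -/
def lipConst {X Y : Type*} [PseudoEMetricSpace X] [PseudoEMetricSpace Y] (g : X → Y) : ℝ≥0∞ :=
  ⨅ (K : ℝ≥0) (_ : LipschitzWith K g), (K : ℝ≥0∞)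

/-- An extended real valued function is finite and locally bounded. -/
def FiniteLocallyBounded {M : Type*} [TopologicalSpace M] (g : M → ℝ≥0∞) : Prop :=
  (∀ ω, g ω < ⊤) ∧ ∀ ω, ∃ C : ℝ≥0, ∀ᶠ ω' in 𝓝 ω, g ω' ≤ C

/-! ### The linear equation `ż = A z + L(tω) z` -/

section Linear

variable {M : Type v} [TopologicalSpace M] {Z : Type u} [NormedAddCommGroup Z] [NormedSpace ℝ Z]

/-- `sup_{t ≥ 0} |L(tω)|`. -/
def supOpNorm (φ : Flow ℝ≥0 M) {A : Z →ₗ.[ℝ] Z} (L : M → DomClosure A →L[ℝ] Z) (ω : M) : ℝ≥0∞ :=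
  ⨆ t : ℝ≥0, ‖L (φ t ω)‖ₑ

/-- `L` is strongly continuous, `τ(ω) = sup_{t ≥ 0} |L(tω)| < ∞`, and `τ` is locally bounded. -/
structure IsLinearPerturbation (φ : Flow ℝ≥0 M) {A : Z →ₗ.[ℝ] Z} (L : M → DomClosure A →L[ℝ] Z) :
    Prop where
  continuous : Continuous fun p : M × DomClosure A => L p.1 p.2
  bounded : FiniteLocallyBounded (supOpNorm φ L)

/-- `T` is the `C₀` linear cocycle on the closure of `D(A)` generated by `ż = A z + L(tω) z`:
the strongly continuous solution of
`T(t, ω) = T₀(t) + [S ◇ (L(·ω) T(·, ω))](t)`. -/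
structure IsGeneratedCocycle (φ : Flow ℝ≥0 M) {A : Z →ₗ.[ℝ] Z}
    (T₀ : ℝ → DomClosure A →L[ℝ] DomClosure A) (S : ℝ → Z →L[ℝ] Z) (L : M → DomClosure A →L[ℝ] Z)
    (T : ℝ → M → DomClosure A →L[ℝ] DomClosure A) : Prop where
  continuous : ∀ x, ContinuousOn (fun p : ℝ × M => T p.1 p.2 x) (Ici 0 ×ˢ univ)
  variation : ∀ ω x, ∀ t ≥ 0, (T t ω x : Z) =
    T₀ t x + diamond t S (fun s => L (orb φ s ω) (T s ω x)) t

/-- Uniform dichotomy on `ℝ₊` of a cocycle `T` on a Banach space `E`, with spectral projections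
`P ω`, spectral spaces `X_ω = R(P ω)` and `Y_ω = ker (P ω)`, angle constant `C₁` and spectral
functions `μs`, `μu`. -/
structure UniformDichotomy {E : Type*} [NormedAddCommGroup E] [NormedSpace ℝ E] (φ : Flow ℝ≥0 M)
    (T : ℝ → M → E →L[ℝ] E) (P : M → E →L[ℝ] E) (C₁ : ℝ) (μs μu : M → ℝ) : Prop where
  proj : ∀ ω x, P ω (P ω x) = P ω x
  continuous : ∀ x, Continuous fun ω => P ω x
  mapsTo_X : ∀ ω, ∀ t ≥ 0, MapsTo (T t ω) (P ω).range (P (orb φ t ω)).range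
  bijOn_Y : ∀ ω, ∀ t ≥ 0, BijOn (T t ω) (P ω).ker (P (orb φ t ω)).ker
  angle_pos : 0 < C₁
  angle : ∀ ω, ‖P ω‖ ≤ C₁
  angle_compl : ∀ ω, ‖ContinuousLinearMap.id ℝ E - P ω‖ ≤ C₁
  stable : ∀ ω, ∀ t ≥ 0, ∀ r ≥ 0, ∀ x ∈ (P (orb φ r ω)).range,
    ‖T t (orb φ r ω) x‖ ≤ Real.exp (μs ω * t) * ‖x‖
  unstable : ∀ ω, ∀ t ≥ 0, ∀ r ≥ 0, ∀ y ∈ (P (orb φ r ω)).ker,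
    ‖y‖ ≤ Real.exp (-μu ω * t) * ‖T t (orb φ r ω) y‖

end Linear

/-- An MR operator `A` on the Banach space `Z`, together with a perturbation `L`, the linear
cocycle `T` that `ż = A z + L(tω) z` generates on the closure of `D(A)`, and a uniform
dichotomy of this cocycle with constants `C₁`, `μs`, `μu`. -/
structure DichotomySystem {M : Type v} [TopologicalSpace M] (φ : Flow ℝ≥0 M)
    (Z : Type u) [NormedAddCommGroup Z] [NormedSpace ℝ Z] (C₁ : ℝ) (μs μu : M → ℝ) where
  A : Z →ₗ.[ℝ] Z
  T₀ : ℝ → DomClosure A →L[ℝ] DomClosure A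
  μ : ℝ
  S : ℝ → Z →L[ℝ] Z
  δ : ℝ → ℝ
  isMR : IsMROperator A T₀ μ S δ
  L : M → DomClosure A →L[ℝ] Z
  isPert : IsLinearPerturbation φ L
  T : ℝ → M → DomClosure A →L[ℝ] DomClosure A
  isCocycle : IsGeneratedCocycle φ T₀ S L T
  P : M → DomClosure A →L[ℝ] DomClosure A
  dichotomy : UniformDichotomy φ T P C₁ μs μu

namespace DichotomySystem

variable {M : Type v} [TopologicalSpace M] {φ : Flow ℝ≥0 M} {Z : Type u} [NormedAddCommGroup Z]
  [NormedSpace ℝ Z] {C₁ : ℝ} {μs μu : M → ℝ} (𝒮 : DichotomySystem φ Z C₁ μs μu)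

/-- The state space, the closure of `D(A)`. -/
abbrev E : Type u := DomClosure 𝒮.A

/-- The stable spectral space `X_ω`. -/
abbrev X (ω : M) : Submodule ℝ 𝒮.E := (𝒮.P ω).range

/-- The unstable spectral space `Y_ω`. -/
abbrev Y (ω : M) : Submodule ℝ 𝒮.E := (𝒮.P ω).ker

/-- The complementary projection `I - P_ω`. -/
def Pc (ω : M) : 𝒮.E →L[ℝ] 𝒮.E := ContinuousLinearMap.id ℝ 𝒮.E - 𝒮.P ω

/-- The inverse of `T(t, ω) : Y_ω → Y_{tω}`. -/
def Shat (t : ℝ) (ω : M) : 𝒮.E → 𝒮.E := Function.invFunOn (𝒮.T t ω) (𝒮.Y ω : Set 𝒮.E)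

/-- `τ(ω) = sup_{t ≥ 0} |L(tω)|`. -/
def tau (ω : M) : ℝ := (supOpNorm φ 𝒮.L ω).toReal

open Classical in
/-- `δ₁(t, ω) = δ(t) / (1 - τ(ω) δ(t))` if `τ(ω) δ(t) < 1`, and `∞` otherwise. -/
def delta₁ (t : ℝ) (ω : M) : ℝ≥0∞ :=
  if 𝒮.tau ω * 𝒮.δ t < 1 then ENNReal.ofReal (𝒮.δ t / (1 - 𝒮.tau ω * 𝒮.δ t)) else ⊤

/-- `sup_{t ≥ 0} Lip f(tω)(·)`. -/
def supLip (f : M → 𝒮.E → Z) (ω : M) : ℝ≥0∞ := ⨆ t : ℝ≥0, lipConst (f (φ t ω))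

/-- `f` is continuous, `ε(ω) = sup_{t ≥ 0} Lip f(tω)(·) < ∞`, and `ε` is locally bounded. -/
structure IsNonlinearity (f : M → 𝒮.E → Z) : Prop where
  continuous : Continuous fun p : M × 𝒮.E => f p.1 p.2
  lipschitz : FiniteLocallyBounded (𝒮.supLip f)

/-- `ε(ω) = sup_{t ≥ 0} Lip f(tω)(·)`. -/
def eps (f : M → 𝒮.E → Z) (ω : M) : ℝ := (𝒮.supLip f ω).toReal

/-- `ε'(ω) = 2 C₁ ε(ω)`. -/
def eps' (f : M → 𝒮.E → Z) (ω : M) : ℝ := 2 * C₁ * 𝒮.eps f ω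

/-- `v = (S₀ ◇ g)(ω)` on `[0, b]`: the solution of `v̇ = A v + L(tω) v + g(t)`, `v(0) = 0`,
that is, of the equation `v = S ◇ (L(·ω) v + g)`. -/
def IsForcedResponse (b : ℝ) (ω : M) (g : ℝ → Z) (v : ℝ → 𝒮.E) : Prop :=
  ContinuousOn v (Icc 0 b) ∧ ∀ t ∈ Icc 0 b,
    (v t : Z) = diamond b 𝒮.S (fun s => 𝒮.L (orb φ s ω) (v s) + g s) t

/-- `z`, a continuous function on `[0, b]`, with `x(t) = P_{tω} z(t)`, `y(t) = P^c_{tω} z(t)`,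
satisfies for all `0 ≤ t ≤ b`
`x(t) = T(t, ω) x(0) + P_{tω} (S₀ ◇ f(·ω)z)(ω)(t)`,
`y(t) = Ŝ(t-b, bω) y(b) - Ŝ(t-b, bω) P^c_{bω} (S₀ ◇ f_t(·ω)z_t)(tω)(b-t)`,
where `f_t(sω) = f((t+s)ω)`, `z_t(s) = z(t+s)`. -/
def SolvesDichotomyEq (f : M → 𝒮.E → Z) (b : ℝ) (ω : M) (z : ℝ → 𝒮.E) : Prop :=
  ContinuousOn z (Icc 0 b) ∧
  ∃ v : ℝ → ℝ → 𝒮.E,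
    (∀ r ∈ Icc 0 b, 𝒮.IsForcedResponse (b - r) (orb φ r ω)
      (fun s => f (orb φ s (orb φ r ω)) (z (r + s))) (v r)) ∧
    ∀ t ∈ Icc 0 b,
      𝒮.P (orb φ t ω) (z t) = 𝒮.T t ω (𝒮.P ω (z 0)) + 𝒮.P (orb φ t ω) (v 0 t) ∧
      𝒮.Pc (orb φ t ω) (z t) =
        𝒮.Shat (b - t) (orb φ t ω) (𝒮.Pc (orb φ b ω) (z b)) -
          𝒮.Shat (b - t) (orb φ t ω) (𝒮.Pc (orb φ b ω) (v t (b - t)))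

/-- `z` is a mild solution on `[0, b]` of `ż = A z + L(tω) z + f(tω) z`. -/
def IsMildSolution (f : M → 𝒮.E → Z) (b : ℝ) (ω : M) (z : ℝ → 𝒮.E) : Prop :=
  ContinuousOn z (Icc 0 b) ∧ ∀ t ∈ Icc 0 b,
    ∃ h : (∫ s in (0 : ℝ)..t, (z s : Z)) ∈ 𝒮.A.domain,
      (z t : Z) = z 0 + 𝒮.A ⟨_, h⟩ +
        ∫ s in (0 : ℝ)..t, (𝒮.L (orb φ s ω) (z s) + f (orb φ s ω) (z s))

/-- The correspondence `H(t, ω) : X_ω × Y_ω → X_{tω} × Y_{tω}` induced by the dichotomy form of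
the equation. -/
def H (f : M → 𝒮.E → Z) (t : ℝ) (ω : M) :
    Set ((𝒮.X ω × 𝒮.Y ω) × (𝒮.X (orb φ t ω) × 𝒮.Y (orb φ t ω))) :=
  {p | ∃ z : ℝ → 𝒮.E, 𝒮.SolvesDichotomyEq f t ω z ∧
    z 0 = (p.1.1 : 𝒮.E) + (p.1.2 : 𝒮.E) ∧ z t = (p.2.1 : 𝒮.E) + (p.2.2 : 𝒮.E)}

/-- The nonlinear cocycle `U(t, ω)` of the mild solutions, as a correspondence
`X_ω × Y_ω → X_{tω} × Y_{tω}`. -/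
def U (f : M → 𝒮.E → Z) (t : ℝ) (ω : M) :
    Set ((𝒮.X ω × 𝒮.Y ω) × (𝒮.X (orb φ t ω) × 𝒮.Y (orb φ t ω))) :=
  {p | ∃ z : ℝ → 𝒮.E, 𝒮.IsMildSolution f t ω z ∧
    z 0 = (p.1.1 : 𝒮.E) + (p.1.2 : 𝒮.E) ∧ z t = (p.2.1 : 𝒮.E) + (p.2.2 : 𝒮.E)}

/-- `λ_u(ω) = e^{-μ_u(ω) + ε'(ω)}`. -/
def lamU (f : M → 𝒮.E → Z) (ω : M) : ℝ := Real.exp (-μu ω + 𝒮.eps' f ω)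

/-- `λ_s(ω) = e^{μ_s(ω) + ε'(ω)}`. -/
def lamS (f : M → 𝒮.E → Z) (ω : M) : ℝ := Real.exp (μs ω + 𝒮.eps' f ω)

/-- `ε'(ω) / (μ_u(ω) - μ_s(ω) - ε'(ω))`. -/
def coneBound (f : M → 𝒮.E → Z) (ω : M) : ℝ := 𝒮.eps' f ω / (μu ω - μs ω - 𝒮.eps' f ω)

/-- In the (A)(B) conditions with the rates `λ_s`, `λ_u`, the quantities `α`, `β`, `k_α`, `k_β`
can be taken to be constants (in `ω`) less than `1`, with `α, β < ρ`. -/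
def HasUniformCones (f : M → 𝒮.E → Z) (ρ : ℝ) : Prop :=
  ∃ α β : ℝ, 0 < α ∧ α < 1 ∧ α < ρ ∧ 0 < β ∧ β < 1 ∧ β < ρ ∧
    (∀ ω, 𝒮.coneBound f ω < α ∧ 𝒮.coneBound f ω < β) ∧
    (∀ ω, ∀ t ≥ 0, ∀ s ≥ 0, SatisfiesAB (𝒮.H f t (orb φ s ω))
      α α (𝒮.lamU f ω ^ t) β β (𝒮.lamS f ω ^ t)) ∧
    ∀ ε₁ > 0, ∃ kα kβ : ℝ, 0 < kα ∧ kα < 1 ∧ 0 < kβ ∧ kβ < 1 ∧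
      ∀ ω, ∀ t ≥ ε₁, ∀ s ≥ 0, SatisfiesAB (𝒮.H f t (orb φ s ω))
        α (kα * α) (𝒮.lamU f ω ^ t) β (kβ * β) (𝒮.lamS f ω ^ t)

end DichotomySystem

/-! ### The functions of the general case -/

/-- The threshold `ϑ`, cone functions `α, α₁, β, β₁`, prefactor `k`, rates `λ̃_s`, `λ̃_u`. -/
structure ConeFunctions (M : Type v) where
  ϑ : M → ℝ
  α : M → ℝ
  α₁ : M → ℝ
  β : M → ℝ
  β₁ : M → ℝ
  k : M → ℝ
  lamS : M → ℝ
  lamU : M → ℝ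

/-- For every system with the given `δ₁`, `μs`, `μu`, `C₁` and every nonlinearity `f`: at every `ω`
with `ε(ω) < ϑ(ω)`, both `H(t, sω)` and `U(t, sω)` satisfy
(A)`(α; α₁, k λ̃_u^t)` (B)`(β; β₁, k λ̃_s^t)` for all `t, s ≥ 0`, and
(A)`(α₁; α, k λ̃_u^t)` (B)`(β₁; β, k λ̃_s^t)` for all `t ≥ ε₁(ω)`, `s ≥ 0`. -/
def ConeFunctions.ConesHold {M : Type v} [TopologicalSpace M] (c : ConeFunctions M)
    (φ : Flow ℝ≥0 M) (C₁ : ℝ) (μs μu ε₁ : M → ℝ) (δ₁ : ℝ → M → ℝ≥0∞) : Prop :=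
  ∀ (Z : Type u) [NormedAddCommGroup Z] [NormedSpace ℝ Z] [CompleteSpace Z]
    (𝒮 : DichotomySystem φ Z C₁ μs μu), (∀ t > 0, ∀ ω, 𝒮.delta₁ t ω = δ₁ t ω) →
  ∀ f : M → 𝒮.E → Z, 𝒮.IsNonlinearity f →
  ∀ ω, 𝒮.eps f ω < c.ϑ ω → ∀ s ≥ 0,
    (∀ t ≥ 0,
      SatisfiesAB (𝒮.H f t (orb φ s ω)) (c.α ω) (c.α₁ ω) (c.k ω * c.lamU ω ^ t)
        (c.β ω) (c.β₁ ω) (c.k ω * c.lamS ω ^ t) ∧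
      SatisfiesAB (𝒮.U f t (orb φ s ω)) (c.α ω) (c.α₁ ω) (c.k ω * c.lamU ω ^ t)
        (c.β ω) (c.β₁ ω) (c.k ω * c.lamS ω ^ t)) ∧
    (∀ t ≥ ε₁ ω,
      SatisfiesAB (𝒮.H f t (orb φ s ω)) (c.α₁ ω) (c.α ω) (c.k ω * c.lamU ω ^ t)
        (c.β₁ ω) (c.β ω) (c.k ω * c.lamS ω ^ t) ∧
      SatisfiesAB (𝒮.U f t (orb φ s ω)) (c.α₁ ω) (c.α ω) (c.k ω * c.lamU ω ^ t)
        (c.β₁ ω) (c.β ω) (c.k ω * c.lamS ω ^ t))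

/-- The properties that are required of every choice of the functions `ϑ, α, …, λ̃_u`. The
conditions on suprema and infima over `ω` are written with explicit bounds. -/
structure ConeFunctions.Admissible {M : Type v} [TopologicalSpace M] (c : ConeFunctions M)
    (φ : Flow ℝ≥0 M) (C₁ : ℝ) (μs μu η ε₁ : M → ℝ) (δ₁ : ℝ → M → ℝ≥0∞) : Prop where
  ϑ_pos : ∀ ω, 0 < c.ϑ ω
  α_pos : ∀ ω, 0 < c.α ω
  α_lt : ∀ ω, c.α ω < c.α₁ ω
  β_pos : ∀ ω, 0 < c.β ω
  β_lt : ∀ ω, c.β ω < c.β₁ ω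
  sup_lt_one : ∃ q < 1, ∀ ω, c.α₁ ω ≤ q ∧ c.β₁ ω ≤ q
  k_pos : ∀ ω, 0 < c.k ω
  lamS_nonneg : ∀ ω, 0 ≤ c.lamS ω
  lamU_nonneg : ∀ ω, 0 ≤ c.lamU ω
  lamS_le : ∀ ω, c.lamS ω ≤ Real.exp (μs ω + η ω)
  lamU_le : ∀ ω, c.lamU ω ≤ Real.exp (-μu ω + η ω)
  mul_lt_one : ∀ ω, c.lamS ω * c.lamU ω < 1
  sup_mul_lt_one : (∃ γ > 0, ∀ ω, γ ≤ μu ω - μs ω) → ∃ q < 1, ∀ ω, c.lamS ω * c.lamU ω ≤ q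
  sup_lamS_lt_one : (∃ γ > 0, ∀ ω, μs ω ≤ -γ) → ∃ q < 1, ∀ ω, c.lamS ω ≤ q
  sup_lamU_lt_one : (∃ γ > 0, ∀ ω, γ ≤ μu ω) → ∃ q < 1, ∀ ω, c.lamU ω ≤ q
  cones : ConeFunctions.ConesHold.{u, v} c φ C₁ μs μu ε₁ δ₁

/-- Along the past of every point, `ε₁` is bounded away from `0`, and `μs`, `μu` and `δ₁(t₀, ·)`,
for some `t₀ > 0`, are bounded. -/
def BoundedAlongPast {M : Type v} [TopologicalSpace M] (φ : Flow ℝ≥0 M) (μs μu ε₁ : M → ℝ)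
    (δ₁ : ℝ → M → ℝ≥0∞) : Prop :=
  ∀ ω, ∃ c > 0, ∃ t₀ > 0, ∃ C : ℝ≥0, ∀ (s : ℝ≥0) (ω₀ : M), φ s ω₀ = ω →
    c ≤ ε₁ ω₀ ∧ |μs ω₀| ≤ C ∧ |μu ω₀| ≤ C ∧ δ₁ t₀ ω₀ ≤ C

end

/-! A point of `H` or of `U` consists of the end values of a solution, and in both cases that
solution obeys the variation of constants formula for ż = Az + L(tω)z + f(tω)z (`IsVar`). For `U`
this is `IsMROperator.variation_iff_mildOn`. For `H` the backward formula on the unstable part is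
turned into a forward one, because the cocycle is injective on Y_ω (`isVar_of_solvesDichotomyEq`).
So both correspondences are controlled by the differences w = z - z' of two solutions.

Put p = |P w| and q = |P^c w|. Over a time t, w is the cocycle applied to its initial value plus the
response to a forcing of size at most ε sup(p + q), and the response is at most δ(t)/(1 - τδ(t))
times the forcing. Together with the dichotomy this gives the scalar inequalities of `ConePair`
(`OrbitBounds.conePair`): p grows at most like e^{at} and q at least like e^{ut}, up to an error
κ(t) sup(p + q). Time reversal exchanges p with q and (a, u) with (-u, -a), so (B) is (A) for the
reversed pair.

In (1), κ(t)/t → ε'/2, so one gets differential inequalities with Dini derivatives. The ratio p/q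
stays below the solution of r' = -σr + ε', which relaxes to the critical aperture ε'/σ
(`ConePair.cone_of_tendsto`).

In (2), κ is only known to be small on steps of bounded length h. One step multiplies the aperture
by e^{-(u-a)h}, up to a loss e^{ηh}, and adds a small offset. Iteration sums a geometric series
(`ConePair.cone_iterate`), and a last shorter step reaches arbitrary times. The outcome is
`ConePair.cone_conditions`, with apertures ρ and ρe^{-G/2} and prefactor 2. The step length and the
threshold for ε are read off from δ₁, the rates, C₁, η and ε₁ alone, so they serve all systems at
once. The margin added to the rates is min(η, κ)/2 with a constant κ that takes care of (e).

Rates in 𝓔₁(t) come from infima over the past of a point: every growth bound at a past point also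
holds along the forward orbit. If the rates of the past are unbounded below, the spectral space is
trivial and its rate is irrelevant. For (d) and (f) the rates of the dichotomy are used directly,
which preserves continuity and invariance.

Generation is defined by Laplace transforms, so the identities for `S` and `T₀` come from resolvent
identities and the injectivity of the Laplace transform (`ExpBdd.eq_zero_of_laplace`). -/

/-! ### Laplace transforms of exponentially bounded functions -/

section Laplace

set_option linter.unusedSectionVars false

variable {F : Type*} [NormedAddCommGroup F] [NormedSpace ℝ F]

/-- A function which is continuous and exponentially bounded on `[0, ∞)`. -/
structure ExpBdd (G : ℝ → F) : Prop where
  cont : ContinuousOn G (Ici 0)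
  bound : ∃ K w : ℝ, ∀ t ≥ 0, ‖G t‖ ≤ K * Real.exp (w * t)

theorem ExpBdd.eventually_integrableOn {G : ℝ → F} (hG : ExpBdd G) :
    ∀ᶠ l : ℝ in atTop, IntegrableOn (fun t => Real.exp (-l * t) • G t) (Ioi 0) := by
  obtain ⟨K, w, hb⟩ := hG.bound
  filter_upwards [eventually_ge_atTop (w + 1)] with l hl
  refine Integrable.mono' (g := fun t => K * Real.exp (-1 * t))
    ((exp_neg_integrableOn_Ioi 0 one_pos).const_mul K) ?_ ?_
  · refine ContinuousOn.aestronglyMeasurable ?_ measurableSet_Ioi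
    exact (by fun_prop : Continuous fun t : ℝ => Real.exp (-l * t)).continuousOn.smul
      (hG.cont.mono Ioi_subset_Ici_self)
  · refine (ae_restrict_iff' measurableSet_Ioi).2 (Eventually.of_forall fun t ht => ?_)
    have ht' : (0 : ℝ) < t := ht
    have hK : 0 ≤ K := by
      have := (norm_nonneg _).trans (hb 0 le_rfl)
      simpa using this
    rw [norm_smul, Real.norm_eq_abs, abs_of_pos (Real.exp_pos _)]
    calc Real.exp (-l * t) * ‖G t‖ ≤ Real.exp (-l * t) * (K * Real.exp (w * t)) := by
          gcongr; exact hb t ht'.le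
      _ = K * Real.exp (-l * t + w * t) := by rw [Real.exp_add]; ring
      _ ≤ K * Real.exp (-1 * t) := by
          gcongr
          nlinarith

/-- In the variable x = e^{-t} the hypothesis says that all polynomial moments vanish, and
Weierstrass approximation on [0, 1] extends this to continuous weights. -/
theorem integral_continuous_exp_neg_smul_eq_zero {H : ℝ → F} (hH : IntegrableOn H (Ioi 0))
    (h : ∀ n : ℕ, ∫ t in Ioi (0 : ℝ), Real.exp (-t) ^ n • H t = 0) {ψ : ℝ → ℝ}
    (hψ : ContinuousOn ψ (Icc 0 1)) :
    ∫ t in Ioi (0 : ℝ), ψ (Real.exp (-t)) • H t = 0 := by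
  have hmem : ∀ t ∈ Ioi (0 : ℝ), Real.exp (-t) ∈ Icc (0 : ℝ) 1 := fun t ht =>
    ⟨(Real.exp_pos _).le, Real.exp_le_one_iff.2 (by have : (0 : ℝ) < t := ht; linarith)⟩
  have hint : ∀ χ : ℝ → ℝ, ContinuousOn χ (Icc 0 1) →
      IntegrableOn (fun t => χ (Real.exp (-t)) • H t) (Ioi 0) := by
    intro χ hχ
    obtain ⟨C, hC⟩ := isCompact_Icc.exists_bound_of_continuousOn hχ
    refine Integrable.bdd_smul (C := C) hH ?_ ?_
    · exact ContinuousOn.aestronglyMeasurable (hχ.comp (by fun_prop) hmem) measurableSet_Ioi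
    · exact (ae_restrict_iff' measurableSet_Ioi).2
        (Eventually.of_forall fun t ht => hC _ (hmem t ht))
  have hpoly : ∀ p : Polynomial ℝ, ∫ t in Ioi (0 : ℝ), p.eval (Real.exp (-t)) • H t = 0 := by
    intro p
    induction p using Polynomial.induction_on' with
    | add p q hp hq =>
      simp only [Polynomial.eval_add, add_smul]
      rw [integral_add (hint _ p.continuous.continuousOn) (hint _ q.continuous.continuousOn),
        hp, hq, add_zero]
    | monomial n a =>
      simp only [Polynomial.eval_monomial, mul_smul]
      rw [integral_smul, h n, smul_zero]
  rw [← norm_le_zero_iff]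
  refine le_of_forall_pos_le_add fun e he => ?_
  set J := ∫ t in Ioi (0 : ℝ), ‖H t‖ with hJ
  have hJ0 : 0 ≤ J := integral_nonneg fun _ => norm_nonneg _
  obtain ⟨p, hp⟩ := exists_polynomial_near_of_continuousOn 0 1 ψ hψ (e / (J + 1)) (by positivity)
  have h1 : ∫ t in Ioi (0 : ℝ), ψ (Real.exp (-t)) • H t =
      ∫ t in Ioi (0 : ℝ), (ψ (Real.exp (-t)) - p.eval (Real.exp (-t))) • H t := by
    simp only [sub_smul]
    rw [integral_sub (hint _ hψ) (hint _ p.continuous.continuousOn), hpoly p, sub_zero]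
  rw [h1]
  calc ‖∫ t in Ioi (0 : ℝ), (ψ (Real.exp (-t)) - p.eval (Real.exp (-t))) • H t‖
      ≤ ∫ t in Ioi (0 : ℝ), e / (J + 1) * ‖H t‖ := by
        refine norm_integral_le_of_norm_le (hH.norm.const_mul _) ?_
        refine (ae_restrict_iff' measurableSet_Ioi).2 (Eventually.of_forall fun t ht => ?_)
        rw [norm_smul]
        gcongr
        rw [Real.norm_eq_abs, abs_sub_comm]
        exact (hp _ (hmem t ht)).le
    _ = e / (J + 1) * J := by rw [integral_const_mul]
    _ ≤ 0 + e := by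
        rw [div_mul_eq_mul_div, div_le_iff₀ (by positivity)]
        nlinarith

theorem continuousOn_comp_neg_log {g : ℝ → ℝ} (hg : Continuous g) (hc : HasCompactSupport g)
    (hs : tsupport g ⊆ Ioi 0) : ContinuousOn (fun x => g (-Real.log x)) (Icc 0 1) := by
  intro x hx
  rcases hx.1.eq_or_lt with rfl | h0
  · obtain ⟨R, hR⟩ := hc.isCompact.bddAbove
    -- Since `Real.log 0 = 0` and 0 lies outside the support of `g`, the default value agrees with
    -- the limit at x = 0.
    have hz : g (-Real.log 0) = 0 := by
      refine image_eq_zero_of_notMem_tsupport fun h => ?_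
      have := hs h
      simp at this
    have hev : ∀ᶠ y in 𝓝[Icc (0 : ℝ) 1] 0, g (-Real.log y) = 0 := by
      have h1 : ∀ᶠ y in 𝓝 (0 : ℝ), y < Real.exp (-(R + 1)) :=
        eventually_lt_nhds (Real.exp_pos _)
      filter_upwards [nhdsWithin_le_nhds h1, self_mem_nhdsWithin] with y hy hy'
      rcases hy'.1.eq_or_lt with rfl | hy0
      · exact hz
      · refine image_eq_zero_of_notMem_tsupport fun h => ?_
        have h2 := hR h
        have h3 := (Real.log_lt_iff_lt_exp hy0).2 hy
        linarith
    refine (tendsto_const_nhds (x := g (-Real.log 0))).congr' ?_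
    filter_upwards [hev] with y hy
    rw [hy, hz]
  · exact (hg.continuousAt.comp (Real.continuousAt_log h0.ne').neg).continuousWithinAt

/-- Lerch's theorem. Sampling the transform at `l + n` gives the moments of e^{-lt}G(t) in e^{-t}.
Hence G vanishes when tested against smooth functions supported in (0, ∞), so almost everywhere, and
everywhere by continuity. -/
theorem ExpBdd.eq_zero_of_laplace [CompleteSpace F] {G : ℝ → F} (hG : ExpBdd G)
    (h : ∀ᶠ l : ℝ in atTop, ∫ t in Ioi (0 : ℝ), Real.exp (-l * t) • G t = 0) :
    ∀ t ≥ 0, G t = 0 := by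
  obtain ⟨l, hl⟩ := eventually_atTop.1 (h.and hG.eventually_integrableOn)
  set H : ℝ → F := fun t => Real.exp (-l * t) • G t with hH
  have hHint : IntegrableOn H (Ioi 0) := (hl l le_rfl).2
  have hn : ∀ n : ℕ, ∫ t in Ioi (0 : ℝ), Real.exp (-t) ^ n • H t = 0 := by
    intro n
    rw [← (hl (l + n) (by simp)).1]
    congr 1 with t
    rw [hH]
    simp only
    rw [smul_smul, ← Real.exp_nat_mul, ← Real.exp_add]
    ring_nf
  have hHc : ContinuousOn H (Ici 0) :=
    (by fun_prop : Continuous fun t : ℝ => Real.exp (-l * t)).continuousOn.smul hG.cont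
  have hae : ∀ᵐ x, x ∈ Ioi (0 : ℝ) → H x = 0 := by
    refine isOpen_Ioi.ae_eq_zero_of_integral_contDiff_smul_eq_zero hHint.locallyIntegrableOn ?_
    intro g hg hgc hgs
    have h1 := integral_continuous_exp_neg_smul_eq_zero hHint hn
      (continuousOn_comp_neg_log hg.continuous hgc hgs)
    simp only [Real.log_exp, neg_neg] at h1
    rw [← h1, setIntegral_eq_integral_of_forall_compl_eq_zero]
    intro x hx
    rw [image_eq_zero_of_notMem_tsupport fun hx' => hx (hgs hx'), zero_smul]
  have hpos : ∀ t ∈ Ioi (0 : ℝ), H t = 0 := by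
    have := Measure.eqOn_open_of_ae_eq (f := H) (g := fun _ => 0) (U := Ioi (0 : ℝ))
      ((ae_restrict_iff' measurableSet_Ioi).2 hae) isOpen_Ioi
      (hHc.mono Ioi_subset_Ici_self) continuousOn_const
    exact fun t ht => this ht
  have hall : ∀ t ∈ Ici (0 : ℝ), H t = 0 := by
    have : EqOn H (fun _ => 0) (closure (Ioi (0 : ℝ))) := by
      refine EqOn.of_subset_closure (s := Ioi 0) (t := closure (Ioi 0)) hpos ?_
        continuousOn_const subset_closure le_rfl
      rw [closure_Ioi]; exact hHc
    rw [closure_Ioi] at this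
    exact fun t ht => this ht
  intro t ht
  exact (smul_eq_zero.1 (hall t ht)).resolve_left (Real.exp_pos _).ne'

theorem ExpBdd.add {G G' : ℝ → F} (h : ExpBdd G) (h' : ExpBdd G') :
    ExpBdd fun t => G t + G' t := by
  refine ⟨h.cont.add h'.cont, ?_⟩
  obtain ⟨K, w, hb⟩ := h.bound
  obtain ⟨K', w', hb'⟩ := h'.bound
  refine ⟨|K| + |K'|, max w w', fun t ht => (norm_add_le _ _).trans ?_⟩
  rw [add_mul]
  refine add_le_add ((hb t ht).trans ?_) ((hb' t ht).trans ?_)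
  · gcongr
    · exact le_abs_self K
    · exact le_max_left _ _
  · gcongr
    · exact le_abs_self K'
    · exact le_max_right _ _

theorem ExpBdd.clm {F' : Type*} [NormedAddCommGroup F'] [NormedSpace ℝ F'] {G : ℝ → F}
    (h : ExpBdd G) (B : F →L[ℝ] F') : ExpBdd fun t => B (G t) := by
  refine ⟨B.continuous.comp_continuousOn h.cont, ?_⟩
  obtain ⟨K, w, hb⟩ := h.bound
  refine ⟨‖B‖ * K, w, fun t ht => (B.le_opNorm _).trans ?_⟩
  rw [mul_assoc]
  gcongr
  exact hb t ht

theorem ExpBdd.smul {G : ℝ → F} (h : ExpBdd G) (c : ℝ) : ExpBdd fun t => c • G t :=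
  h.clm (c • ContinuousLinearMap.id ℝ F)

theorem ExpBdd.sub {G G' : ℝ → F} (h : ExpBdd G) (h' : ExpBdd G') :
    ExpBdd fun t => G t - G' t := by
  simpa [sub_eq_add_neg] using h.add (h'.smul (-1))

theorem ExpBdd.const (x : F) : ExpBdd fun _ : ℝ => x :=
  ⟨continuousOn_const, ‖x‖, 0, fun t _ => by simp⟩

theorem ContinuousOn.intervalIntegrable_of_Ici {G : ℝ → F} (h : ContinuousOn G (Ici 0))
    {a b : ℝ} (ha : 0 ≤ a) (hb : 0 ≤ b) : IntervalIntegrable G volume a b :=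
  (h.mono fun _ hx => (le_min ha hb).trans hx.1).intervalIntegrable

theorem ContinuousOn.hasDerivAt_integral [CompleteSpace F] {G : ℝ → F}
    (h : ContinuousOn G (Ici 0)) {t : ℝ} (ht : 0 < t) :
    HasDerivAt (fun t => ∫ s in (0 : ℝ)..t, G s) (G t) t :=
  intervalIntegral.integral_hasDerivAt_right (h.intervalIntegrable_of_Ici le_rfl ht.le)
    (ContinuousOn.stronglyMeasurableAtFilter isOpen_Ioi (h.mono Ioi_subset_Ici_self) t ht)
    (h.continuousAt (Ici_mem_nhds ht))

theorem ExpBdd.integral_bound {G : ℝ → F} (h : ExpBdd G) :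
    ∃ K w : ℝ, 0 ≤ w ∧ ∀ t ≥ 0, ‖∫ s in (0 : ℝ)..t, G s‖ ≤ K * Real.exp (w * t) := by
  obtain ⟨K, w, hb⟩ := h.bound
  refine ⟨|K|, |w| + 1, by positivity, fun t ht => ?_⟩
  have h1 : ‖∫ s in (0 : ℝ)..t, G s‖ ≤ |K| * Real.exp (|w| * t) * |t - 0| := by
    refine intervalIntegral.norm_integral_le_of_norm_le_const fun s hs => ?_
    rw [uIoc_of_le ht] at hs
    refine (hb s hs.1.le).trans ?_
    gcongr
    · exact le_abs_self K
    · exact hs.1.le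
    · exact le_abs_self w
    · exact hs.2
  refine h1.trans ?_
  rw [sub_zero, abs_of_nonneg ht, mul_assoc, add_mul, Real.exp_add]
  gcongr
  have := Real.add_one_le_exp (1 * t)
  linarith

theorem ExpBdd.integral [CompleteSpace F] {G : ℝ → F} (h : ExpBdd G) :
    ExpBdd fun t => ∫ s in (0 : ℝ)..t, G s := by
  obtain ⟨K, w, -, hb⟩ := h.integral_bound
  refine ⟨?_, K, w, hb⟩
  have h1 : Continuous fun t => ∫ s in (0 : ℝ)..t, G (max s 0) := by
    refine intervalIntegral.continuous_primitive (fun a b => ?_) 0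
    refine Continuous.intervalIntegrable ?_ _ _
    exact h.cont.comp_continuous (by fun_prop) fun x => mem_Ici.2 (le_max_right x 0)
  refine h1.continuousOn.congr fun t ht => ?_
  refine intervalIntegral.integral_congr fun s hs => ?_
  rw [uIcc_of_le ht] at hs
  simp [max_eq_left hs.1]

/-- Integration by parts: e^{-lt} times the primitive vanishes at 0 and at infinity once l exceeds
the growth rate of the primitive. -/
theorem ExpBdd.laplace_integral [CompleteSpace F] {G : ℝ → F} (h : ExpBdd G) :
    ∀ᶠ l : ℝ in atTop, ∫ t in Ioi (0 : ℝ), Real.exp (-l * t) • G t =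
      l • ∫ t in Ioi (0 : ℝ), Real.exp (-l * t) • ∫ s in (0 : ℝ)..t, G s := by
  obtain ⟨K, w, hw, hb⟩ := h.integral_bound
  filter_upwards [h.eventually_integrableOn, h.integral.eventually_integrableOn,
    eventually_gt_atTop w] with l hl hl' hlw
  set W : ℝ → F := fun t => ∫ s in (0 : ℝ)..t, G s with hW
  have hd : ∀ t ∈ Ioi (0 : ℝ), HasDerivAt (fun t => Real.exp (-l * t) • W t)
      (Real.exp (-l * t) • G t - l • (Real.exp (-l * t) • W t)) t := by
    intro t ht
    have h1 : HasDerivAt (fun t : ℝ => Real.exp (-l * t)) (Real.exp (-l * t) * (-l)) t := by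
      have := ((hasDerivAt_id t).const_mul (-l)).exp
      simpa using this
    have h2 := h1.fun_smul (h.cont.hasDerivAt_integral ht)
    convert h2 using 1
    rw [smul_smul, mul_neg, neg_smul, mul_comm l, sub_eq_add_neg]
  have hc : ContinuousWithinAt (fun t => Real.exp (-l * t) • W t) (Ici 0) 0 :=
    ((by fun_prop : Continuous fun t : ℝ => Real.exp (-l * t)).continuousOn.smul
      h.integral.cont) 0 self_mem_Ici
  have ht : Tendsto (fun t => Real.exp (-l * t) • W t) atTop (𝓝 0) := by
    have h1 : Tendsto (fun t => K * Real.exp (-((l - w) * t))) atTop (𝓝 0) := by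
      have h3 : Tendsto (fun t : ℝ => (l - w) * t) atTop atTop :=
        tendsto_id.const_mul_atTop (sub_pos.2 hlw)
      simpa using (Real.tendsto_exp_neg_atTop_nhds_zero.comp h3).const_mul K
    refine squeeze_zero_norm' ?_ h1
    filter_upwards [eventually_ge_atTop 0] with t ht
    rw [norm_smul, Real.norm_eq_abs, abs_of_pos (Real.exp_pos _)]
    calc Real.exp (-l * t) * ‖W t‖ ≤ Real.exp (-l * t) * (K * Real.exp (w * t)) := by
          gcongr; exact hb t ht
      _ = K * Real.exp (-((l - w) * t)) := by
          rw [mul_left_comm, ← Real.exp_add]; ring_nf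
  have hI := integral_Ioi_of_hasDerivAt_of_tendsto hc hd (hl.sub (hl'.smul l)) ht
  have hl2 : IntegrableOn (fun t => l • (Real.exp (-l * t) • W t)) (Ioi 0) := hl'.smul l
  rw [integral_sub hl hl2, integral_smul] at hI
  simpa [hW, sub_eq_zero] using hI

end Laplace

/-! ### Convolution with a strongly continuous family of operators -/

section Convolution

set_option linter.unusedSectionVars false

variable {E F : Type*} [NormedAddCommGroup E] [NormedSpace ℝ E] [NormedAddCommGroup F]
  [NormedSpace ℝ F]

/-- The convolution `∫₀ᵗ B(t - s) g(s) ds`. -/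
noncomputable def opConv (B : ℝ → E → F) (g : ℝ → E) (t : ℝ) : F :=
  ∫ s in (0 : ℝ)..t, B (t - s) (g s)

/-- The strong primitive `∫₀ᵗ B(s) x ds`. -/
noncomputable def opPrim (B : ℝ → E → F) (t : ℝ) (x : E) : F := ∫ s in (0 : ℝ)..t, B s x

theorem integral_congr_Icc {G G' : ℝ → F} {t : ℝ} (ht : 0 ≤ t) (h : EqOn G G' (Icc 0 t)) :
    ∫ s in (0 : ℝ)..t, G s = ∫ s in (0 : ℝ)..t, G' s :=
  intervalIntegral.integral_congr (by rwa [uIcc_of_le ht])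

theorem opConv_congr {B B' : ℝ → E → F} {g g' : ℝ → E} {t : ℝ} (ht : 0 ≤ t)
    (hB : ∀ s ∈ Icc 0 t, ∀ x, B s x = B' s x) (h : EqOn g g' (Icc 0 t)) :
    opConv B g t = opConv B' g' t := by
  refine integral_congr_Icc ht fun s hs => ?_
  rw [h hs, hB _ ⟨by linarith [hs.2], by linarith [hs.1]⟩]

theorem continuous_opPrim {B : ℝ → E → F} (hB : Continuous fun p : ℝ × E => B p.1 p.2) :
    Continuous fun p : ℝ × E => opPrim B p.1 p.2 :=
  intervalIntegral.continuous_parametric_intervalIntegral_of_continuous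
    (f := fun (p : ℝ × E) s => B s p.2) (by
      exact hB.comp (continuous_snd.prodMk (continuous_snd.comp continuous_fst))) continuous_fst

theorem continuous_opConv {B : ℝ → E → F} (hB : Continuous fun p : ℝ × E => B p.1 p.2)
    {g : ℝ → E} (hg : Continuous g) : Continuous (opConv B g) :=
  intervalIntegral.continuous_parametric_intervalIntegral_of_continuous
    (f := fun (t : ℝ) s => B (t - s) (g s)) (by
      exact hB.comp ((continuous_fst.sub continuous_snd).prodMk (hg.comp continuous_snd)))
    continuous_id

variable [CompleteSpace F]

theorem hasDerivAt_opPrim {B : ℝ → E → F} (hB : Continuous fun p : ℝ × E => B p.1 p.2) (t : ℝ)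
    (x : E) : HasDerivAt (fun t => opPrim B t x) (B t x) t :=
  intervalIntegral.integral_hasDerivAt_right
    ((hB.comp (continuous_id.prodMk continuous_const)).intervalIntegrable _ _)
    ((hB.comp (continuous_id.prodMk continuous_const)).stronglyMeasurableAtFilter _ _)
    (hB.comp (continuous_id.prodMk continuous_const)).continuousAt

/-- The moving upper limit is removed by cutting the primitive off at `max (r - s) 0`, where it
vanishes for s > r. On the fixed interval [0, R + 1] the integrand is Lipschitz in r with a corner
only at r = s, so differentiation under the integral applies. -/
theorem hasDerivAt_opConv_opPrim {B : ℝ → E → F} (hB : Continuous fun p : ℝ × E => B p.1 p.2)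
    {g : ℝ → E} (hg : Continuous g) {R : ℝ} (hR : 0 < R) :
    HasDerivAt (opConv (opPrim B) g) (opConv B g R) R := by
  have hBg : Continuous fun p : ℝ × ℝ => B p.1 (g p.2) :=
    hB.comp (continuous_fst.prodMk (hg.comp continuous_snd))
  obtain ⟨C, hC⟩ := ((isCompact_Icc (a := (0 : ℝ)) (b := R + 1)).prod
    (isCompact_Icc (a := (0 : ℝ)) (b := R + 1))).exists_bound_of_continuousOn hBg.continuousOn
  have hC0 : 0 ≤ C := (norm_nonneg _).trans
    (hC (0, 0) ⟨⟨le_rfl, by positivity⟩, ⟨le_rfl, by positivity⟩⟩)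
  set Φ : ℝ → ℝ → F := fun r s => opPrim B (max (r - s) 0) (g s) with hΦ
  have hΦc : Continuous fun p : ℝ × ℝ => Φ p.1 p.2 :=
    (continuous_opPrim hB).comp (((continuous_fst.sub continuous_snd).max
      continuous_const).prodMk (hg.comp continuous_snd))
  have key := intervalIntegral.hasDerivAt_integral_of_dominated_loc_of_lip (μ := volume)
    (a := 0) (b := R + 1) (F := Φ) (x₀ := R) (s := Ioo 0 (R + 1)) (bound := fun _ => C)
    (F' := fun s => if s < R then B (R - s) (g s) else 0)
    (Ioo_mem_nhds hR (by linarith))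
    (Eventually.of_forall fun r =>
      (hΦc.comp (continuous_const.prodMk continuous_id)).aestronglyMeasurable)
    ((hΦc.comp (continuous_const.prodMk continuous_id)).intervalIntegrable _ _) ?_ ?_
    intervalIntegrable_const ?_
  · have h1 : ∀ᶠ r in 𝓝 R, opConv (opPrim B) g r = ∫ s in (0 : ℝ)..(R + 1), Φ r s := by
      filter_upwards [Ioo_mem_nhds hR (by linarith : R < R + 1)] with r hr
      have hΦr : Continuous (Φ r) := hΦc.comp (continuous_const.prodMk continuous_id)
      rw [← intervalIntegral.integral_add_adjacent_intervals (b := r)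
        (hΦr.intervalIntegrable _ _) (hΦr.intervalIntegrable _ _)]
      have h2 : ∫ s in r..(R + 1), Φ r s = 0 := by
        rw [intervalIntegral.integral_congr (g := fun _ => (0 : F)), intervalIntegral.integral_zero]
        intro s hs
        rw [uIcc_of_le hr.2.le] at hs
        simp [hΦ, max_eq_right (sub_nonpos.2 hs.1), opPrim]
      rw [h2, add_zero]
      refine integral_congr_Icc hr.1.le fun s hs => ?_
      simp [hΦ, max_eq_left (sub_nonneg.2 hs.2)]
    have h3 : opConv B g R = ∫ s in (0 : ℝ)..(R + 1), if s < R then B (R - s) (g s) else 0 := by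
      rw [← intervalIntegral.integral_add_adjacent_intervals (b := R)]
      · have h2 : ∫ s in R..(R + 1), (if s < R then B (R - s) (g s) else 0) = 0 := by
          rw [intervalIntegral.integral_congr (g := fun _ => (0 : F)),
            intervalIntegral.integral_zero]
          intro s hs
          rw [uIcc_of_le (by linarith)] at hs
          simp [not_lt.2 hs.1]
        rw [h2, add_zero]
        refine intervalIntegral.integral_congr_ae ?_
        have : ∀ᵐ s : ℝ, s ≠ R := by simp [ae_iff]
        filter_upwards [this] with s hs hs'
        rw [uIoc_of_le hR.le] at hs'
        simp [lt_of_le_of_ne hs'.2 hs]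
      · exact key.1.mono_set (uIcc_subset_uIcc_left (by
          rw [uIcc_of_le (by linarith)]; exact ⟨hR.le, by linarith⟩))
      · exact key.1.mono_set (uIcc_subset_uIcc_right (by
          rw [uIcc_of_le (by linarith)]; exact ⟨hR.le, by linarith⟩))
    rw [h3]
    exact key.2.congr_of_eventuallyEq h1
  · refine (StronglyMeasurable.ite measurableSet_Iio ?_ stronglyMeasurable_const
      ).aestronglyMeasurable
    exact (hB.comp ((continuous_const.sub continuous_id).prodMk hg)).stronglyMeasurable
  · refine Eventually.of_forall fun s hs => LipschitzOnWith.of_dist_le_mul fun r hr r' hr' => ?_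
    rw [uIoc_of_le (by linarith)] at hs
    have hint : ∀ a b, IntervalIntegrable (fun σ => B σ (g s)) volume a b := fun a b =>
      (hB.comp (continuous_id.prodMk continuous_const)).intervalIntegrable _ _
    rw [dist_eq_norm, Real.coe_nnabs, abs_of_nonneg hC0]
    simp only [hΦ, opPrim]
    rw [intervalIntegral.integral_interval_sub_left (hint _ _) (hint _ _)]
    refine (intervalIntegral.norm_integral_le_of_norm_le_const (C := C) fun σ hσ => ?_).trans ?_
    · have hσ' := uIoc_subset_uIcc hσ
      have hmem : ∀ r ∈ Ioo 0 (R + 1), max (r - s) 0 ∈ Icc 0 (R + 1) := fun r hr =>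
        ⟨le_max_right _ _, max_le (by linarith [hr.2, hs.1]) (by linarith)⟩
      exact hC (σ, s) ⟨(uIcc_subset_Icc (hmem r' hr') (hmem r hr)) hσ', ⟨hs.1.le, hs.2⟩⟩
    · gcongr
      rw [Real.dist_eq]
      refine (abs_max_sub_max_le_abs _ _ _).trans (le_of_eq ?_)
      congr 1; ring
  · have : ∀ᵐ s : ℝ, s ≠ R := by simp [ae_iff]
    filter_upwards [this] with s hs _
    rcases lt_or_gt_of_ne hs with h | h
    · rw [if_pos h]
      have h1 : HasDerivAt (fun r => opPrim B (r - s) (g s)) (B (R - s) (g s)) R :=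
        (hasDerivAt_opPrim hB (R - s) (g s)).comp_sub_const R s
      refine h1.congr_of_eventuallyEq ?_
      filter_upwards [eventually_gt_nhds h] with r hr
      simp [hΦ, max_eq_left (sub_nonneg.2 hr.le)]
    · rw [if_neg (not_lt.2 h.le)]
      refine (hasDerivAt_const R (0 : F)).congr_of_eventuallyEq ?_
      filter_upwards [eventually_lt_nhds h] with r hr
      simp [hΦ, max_eq_right (sub_nonpos.2 hr.le), opPrim]

/-- `∫₀ᵗ (B * g) = (∫₀ B) * g`. -/
theorem integral_opConv {B : ℝ → E → F} (hB : Continuous fun p : ℝ × E => B p.1 p.2)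
    {g : ℝ → E} (hg : Continuous g) {t : ℝ} (ht : 0 ≤ t) :
    ∫ s in (0 : ℝ)..t, opConv B g s = opConv (opPrim B) g t := by
  rw [intervalIntegral.integral_eq_sub_of_hasDerivAt_of_le ht
    (continuous_opConv (continuous_opPrim hB) hg).continuousOn
    (fun s hs => hasDerivAt_opConv_opPrim hB hg hs.1)
    ((continuous_opConv hB hg).intervalIntegrable _ _)]
  simp [opConv]

/-- A product rule that does not need norm differentiability of `K`: the difference quotient is `K
r` applied to the slope of `f`, plus the slope of `K · (f s)`, and joint continuity handles the
first term. -/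
theorem HasDerivAt.op_apply {K : ℝ → E →ₗ[ℝ] F} (hK : Continuous fun p : ℝ × E => K p.1 p.2)
    {f : ℝ → E} {f' : E} {c : F} {s : ℝ} (h : HasDerivAt (fun r => K r (f s)) c s)
    (hf : HasDerivAt f f' s) : HasDerivAt (fun r => K r (f r)) (c + K s f') s := by
  rw [hasDerivAt_iff_tendsto_slope] at h hf ⊢
  have h1 : Tendsto (fun r => K r (slope f s r)) (𝓝[≠] s) (𝓝 (K s f')) :=
    (hK.tendsto (s, f')).comp ((tendsto_nhdsWithin_of_tendsto_nhds tendsto_id).prodMk_nhds hf)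
  refine (h.add h1).congr fun r => ?_
  simp only [slope_def_module, map_smul, map_sub, ← smul_add]
  congr 1
  abel

/-- Integration by parts: `B * (x₀ + ∫₀ φ) = (∫₀ B) x₀ + (∫₀ B) * φ`. -/
theorem opConv_primitive [CompleteSpace E] {B : ℝ → E →L[ℝ] F}
    (hB : Continuous fun p : ℝ × E => B p.1 p.2)
    {φ : ℝ → E} (hφ : Continuous φ) (x₀ : E) (t : ℝ) (ht : 0 ≤ t) :
    opConv (fun s => B s) (fun s => x₀ + ∫ r in (0 : ℝ)..s, φ r) t =
      opPrim (fun s => B s) t x₀ + opConv (opPrim fun s => B s) φ t := by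
  have hBx : ∀ x, Continuous fun s => B s x := fun x =>
    hB.comp (continuous_id.prodMk continuous_const)
  set f : ℝ → E := fun s => x₀ + ∫ r in (0 : ℝ)..s, φ r with hf
  have hfd : ∀ s, HasDerivAt f (φ s) s := fun s => by
    have := (intervalIntegral.integral_hasDerivAt_right (hφ.intervalIntegrable 0 s)
      (hφ.stronglyMeasurableAtFilter _ _) hφ.continuousAt).const_add x₀
    exact this
  have hfc : Continuous f := continuous_iff_continuousAt.2 fun s => (hfd s).continuousAt
  -- `K s` is the primitive of `B` at time t - s, with derivative -B(t - s). The claim is the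
  -- integral over [0, t] of the derivative of `K s (f s)`.
  let K : ℝ → E →ₗ[ℝ] F := fun s =>
    { toFun := fun x => opPrim (fun s => B s) (t - s) x
      map_add' := fun x y => by
        simp only [opPrim, map_add]
        exact intervalIntegral.integral_add ((hBx x).intervalIntegrable _ _)
          ((hBx y).intervalIntegrable _ _)
      map_smul' := fun c x => by
        simp only [opPrim, map_smul, RingHom.id_apply]
        exact intervalIntegral.integral_smul _ _ }
  have hKc : Continuous fun p : ℝ × E => K p.1 p.2 :=
    (continuous_opPrim hB).comp ((continuous_const.sub continuous_fst).prodMk continuous_snd)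
  have hd : ∀ s ∈ Ioo 0 t, HasDerivAt (fun r => K r (f r))
      (-B (t - s) (f s) + K s (φ s)) s := fun s _ =>
    HasDerivAt.op_apply hKc ((hasDerivAt_opPrim hB (t - s) (f s)).comp_const_sub t s) (hfd s)
  have hc1 : Continuous fun s => B (t - s) (f s) :=
    hB.comp ((continuous_const.sub continuous_id).prodMk hfc)
  have hc1' : Continuous fun s => -B (t - s) (f s) := hc1.neg
  have hc2 : Continuous fun s => K s (φ s) := hKc.comp (continuous_id.prodMk hφ)
  have hI := intervalIntegral.integral_eq_sub_of_hasDerivAt_of_le ht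
    (hKc.comp (continuous_id.prodMk hfc)).continuousOn hd
    ((hc1'.add hc2).intervalIntegrable _ _)
  rw [intervalIntegral.integral_add (hc1'.intervalIntegrable _ _)
    (hc2.intervalIntegrable _ _), intervalIntegral.integral_neg] at hI
  have h0 : K t (f t) = 0 := by simp [K, opPrim]
  have h1 : K 0 (f 0) = opPrim (fun s => B s) t x₀ := by simp [K, hf]
  simp only [Function.comp_apply, h0, h1, id] at hI
  have h2 : opConv (fun s => B s) f t = ∫ s in (0 : ℝ)..t, B (t - s) (f s) := rfl
  have h3 : opConv (opPrim fun s => B s) φ t = ∫ s in (0 : ℝ)..t, K s (φ s) := rfl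
  rw [h2, h3]
  have h4 := eq_sub_of_add_eq' hI
  have := congrArg Neg.neg hI
  simp only [neg_add_rev, neg_neg, zero_sub] at this
  rw [← this]; abel

theorem hasDerivWithinAt_integral_Icc {G : ℝ → F} {b : ℝ} (hG : ContinuousOn G (Icc 0 b)) {t : ℝ}
    (ht : t ∈ Icc 0 b) :
    HasDerivWithinAt (fun t => ∫ s in (0 : ℝ)..t, G s) (G t) (Icc 0 b) t := by
  have : Fact (t ∈ Icc 0 b) := ⟨ht⟩
  refine intervalIntegral.integral_hasDerivWithinAt_right
    ((hG.mono ?_).intervalIntegrable) (s := Icc 0 b) (t := Icc 0 b) ?_ (hG t ht)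
  · rw [uIcc_of_le ht.1]; exact Icc_subset_Icc_right ht.2
  · exact hG.stronglyMeasurableAtFilter_nhdsWithin measurableSet_Icc t

/-- Undoes an integration: many identities below are first proved for primitives, where convolutions
can be manipulated freely. -/
theorem eqOn_of_integral_eq {G G' : ℝ → F} {b : ℝ} (hb : 0 < b) (hG : ContinuousOn G (Icc 0 b))
    (hG' : ContinuousOn G' (Icc 0 b))
    (h : ∀ t ∈ Icc 0 b, ∫ s in (0 : ℝ)..t, G s = ∫ s in (0 : ℝ)..t, G' s) :
    EqOn G G' (Icc 0 b) := by
  intro t ht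
  have h1 := (hasDerivWithinAt_integral_Icc hG ht).congr (fun s hs => (h s hs).symm) (h t ht).symm
  exact (uniqueDiffOn_Icc hb t ht).eq_deriv _ h1 (hasDerivWithinAt_integral_Icc hG' ht)

end Convolution

/-! ### Resolvents, semigroups and integrated semigroups -/

section Resolvent

variable {E : Type*} [NormedAddCommGroup E] [NormedSpace ℝ E] {B : E →ₗ.[ℝ] E} {l l₀ : ℝ}
  {R R₀ : E →L[ℝ] E}

theorem IsResolventAt.identity (h₀ : IsResolventAt B l₀ R₀) (h : IsResolventAt B l R) (x : E) :
    R₀ (x + (l₀ - l) • R x) = R x := by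
  obtain ⟨hd, he⟩ := h.1 x
  have h1 := h₀.2 ⟨R x, hd⟩
  have h2 : l₀ • R x - B ⟨R x, hd⟩ = x + (l₀ - l) • R x := by
    have h3 : l₀ • R x - B ⟨R x, hd⟩ = (l • R x - B ⟨R x, hd⟩) + (l₀ - l) • R x := by
      rw [sub_smul]; abel
    rw [h3, he]
  rwa [h2] at h1

/-- Turns "x lies in the domain and Bx = y" into an equation with a bounded operator, which commutes
with integrals and Laplace transforms. -/
theorem IsResolventAt.eq_apply_iff (h : IsResolventAt B l R) {x y : E} :
    x = R (l • x - y) ↔ ∃ hd : x ∈ B.domain, B ⟨x, hd⟩ = y := by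
  constructor
  · intro hx
    obtain ⟨hd, he⟩ := h.1 (l • x - y)
    have hd' : x ∈ B.domain := by rw [hx]; exact hd
    refine ⟨hd', ?_⟩
    have h1 : B ⟨R (l • x - y), hd⟩ = B ⟨x, hd'⟩ := by congr 1; exact Subtype.ext hx.symm
    rw [h1, ← hx] at he
    exact (sub_right_inj.1 he)
  · rintro ⟨hd, rfl⟩
    exact (h.2 ⟨x, hd⟩).symm

end Resolvent

/-! ### From strong continuity to joint continuity. -/

section StrongContinuity

variable {E F : Type*} [NormedAddCommGroup E] [NormedSpace ℝ E] [NormedAddCommGroup F]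
  [NormedSpace ℝ F]

/-- Strong continuity plus locally bounded norms. The cut-off `max t 0` replaces the arbitrary
values at negative times, so that convolutions have integrands continuous on the whole line. -/
theorem continuous_max_zero_apply {B : ℝ → E →L[ℝ] F}
    (hc : ∀ x, ContinuousOn (fun t => B t x) (Ici 0)) {K w : ℝ}
    (hb : ∀ t ≥ 0, ‖B t‖ ≤ K * Real.exp (w * t)) :
    Continuous fun p : ℝ × E => B (max p.1 0) p.2 := by
  refine continuous_iff_continuousAt.2 fun p₀ => ?_
  have h1 : Continuous fun p : ℝ × E => B (max p.1 0) p₀.2 :=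
    (hc p₀.2).comp_continuous (by fun_prop) fun p => mem_Ici.2 (le_max_right p.1 0)
  have h2 : Tendsto (fun p : ℝ × E => B (max p.1 0) (p.2 - p₀.2)) (𝓝 p₀) (𝓝 0) := by
    have h3 : Tendsto (fun p : ℝ × E => K * Real.exp (w * max p.1 0) * ‖p.2 - p₀.2‖) (𝓝 p₀)
        (𝓝 (K * Real.exp (w * max p₀.1 0) * ‖p₀.2 - p₀.2‖)) := by
      refine Continuous.tendsto ?_ p₀
      fun_prop
    rw [sub_self, norm_zero, mul_zero] at h3
    refine squeeze_zero_norm (fun p => ?_) h3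
    exact (B _).le_of_opNorm_le (hb _ (le_max_right _ _)) _
  have h4 := (h1.tendsto p₀).add h2
  rw [add_zero] at h4
  refine h4.congr fun p => ?_
  rw [← map_add, add_sub_cancel]

theorem expBdd_of_norm_le {B : ℝ → E →L[ℝ] F}
    (hc : ∀ x, ContinuousOn (fun t => B t x) (Ici 0)) {K w : ℝ}
    (hb : ∀ t ≥ 0, ‖B t‖ ≤ K * Real.exp (w * t)) (x : E) : ExpBdd fun t => B t x := by
  refine ⟨hc x, K * ‖x‖, w, fun t ht => ?_⟩
  refine ((B t).le_of_opNorm_le (hb t ht) x).trans (le_of_eq ?_)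
  ring

end StrongContinuity

/-! ### Identities for the integrated semigroup and the semigroup. -/

section MR

set_option linter.unusedSectionVars false

variable {Z : Type u} [NormedAddCommGroup Z] [NormedSpace ℝ Z] [CompleteSpace Z]
  {A : Z →ₗ.[ℝ] Z} {T₀ : ℝ → DomClosure A →L[ℝ] DomClosure A} {μ : ℝ} {S : ℝ → Z →L[ℝ] Z}
  {δ : ℝ → ℝ}

theorem laplace_const (x : Z) {l : ℝ} (hl : 0 < l) :
    l • ∫ t in Ioi (0 : ℝ), Real.exp (-l * t) • x = x := by
  rw [integral_smul_const, integral_exp_mul_Ioi (neg_lt_zero.2 hl)]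
  simp [smul_smul, hl.ne']

instance : CompleteSpace (DomClosure A) :=
  (Submodule.isClosed_topologicalClosure A.domain).completeSpace_coe

theorem GeneratesIntegratedSemigroup.expBdd (h : GeneratesIntegratedSemigroup A S) (x : Z) :
    ExpBdd fun t => S t x := by
  obtain ⟨K, w, hb⟩ := h.2.1
  exact expBdd_of_norm_le h.1 hb x

theorem GeneratesIntegratedSemigroup.continuous (h : GeneratesIntegratedSemigroup A S) :
    Continuous fun p : ℝ × Z => S (max p.1 0) p.2 := by
  obtain ⟨K, w, hb⟩ := h.2.1
  exact continuous_max_zero_apply h.1 hb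

theorem GeneratesIntegratedSemigroup.laplace (h : GeneratesIntegratedSemigroup A S) :
    ∀ᶠ l : ℝ in atTop, ∃ R : Z →L[ℝ] Z, IsResolventAt A l R ∧
      ∀ x, R x = l • ∫ t in Ioi (0 : ℝ), Real.exp (-l * t) • S t x := by
  obtain ⟨w, hw⟩ := h.2.2
  filter_upwards [eventually_gt_atTop w] with l hl
  obtain ⟨R, hR, hx⟩ := hw l hl
  exact ⟨R, hR, fun x => (hx x).2⟩

/-- `S(t) x = t x + ∫₀ᵗ S(s) A x ds` for `x ∈ D(A)`. -/
theorem GeneratesIntegratedSemigroup.apply_domain (h : GeneratesIntegratedSemigroup A S)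
    (x : A.domain) {t : ℝ} (ht : 0 ≤ t) :
    S t x = t • (x : Z) + ∫ s in (0 : ℝ)..t, S s (A x) := by
  have hS := h.expBdd
  have hsum : ExpBdd fun t => (x : Z) + S t (A x) := (ExpBdd.const _).add (hS _)
  -- After multiplication by l², the transformed claim is `R (l x - A x) = x`.
  have key := ((hS x).sub hsum.integral).eq_zero_of_laplace ?_ t ht
  · rw [sub_eq_zero] at key
    rw [key, intervalIntegral.integral_add intervalIntegrable_const
      ((hS (A x)).cont.intervalIntegrable_of_Ici le_rfl ht)]
    simp
  · filter_upwards [h.laplace, (hS x).eventually_integrableOn, (hS (A x)).eventually_integrableOn,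
      (ExpBdd.const (x : Z)).eventually_integrableOn, hsum.laplace_integral,
      hsum.integral.eventually_integrableOn, eventually_gt_atTop 0] with l hR h1 h2 h3 h4 h5 hl
    obtain ⟨R, hR, hRx⟩ := hR
    simp only [smul_sub, smul_add] at h4 ⊢
    rw [integral_add h3 h2] at h4
    rw [integral_sub h1 h5]
    have e1 := hR.2 x
    rw [map_sub, map_smul, hRx, hRx, sub_eq_iff_eq_add] at e1
    have e2 := laplace_const (x : Z) hl
    have hl2 : l * l ≠ 0 := (mul_pos hl hl).ne'
    refine (smul_eq_zero.1 ?_).resolve_left hl2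
    rw [mul_smul, smul_sub, ← h4, smul_sub, e1, smul_add, e2, sub_self]

/-- `S(t) x = ∫₀ᵗ T₀(s) x ds` on the closure of `D(A)`. -/
theorem IsMROperator.apply_closure (h : IsMROperator A T₀ μ S δ) (x : DomClosure A) {t : ℝ}
    (ht : 0 ≤ t) : S t x = ∫ s in (0 : ℝ)..t, (T₀ s x : Z) := by
  have hS := h.integrated.expBdd
  have hT' : ExpBdd fun t => T₀ t x := expBdd_of_norm_le (K := 1) h.semigroup.1
    (fun t ht => by simpa using h.semigroup_le t ht) x
  have hT : ExpBdd fun t => (T₀ t x : Z) := hT'.clm (A.domain.topologicalClosure.subtypeL)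
  refine sub_eq_zero.1 (((hS x).sub hT.integral).eq_zero_of_laplace ?_ t ht)
  obtain ⟨w, hw⟩ := h.semigroup.2
  filter_upwards [h.integrated.laplace, (hS x).eventually_integrableOn, hT.laplace_integral,
    hT.integral.eventually_integrableOn, hT'.eventually_integrableOn, eventually_gt_atTop 0,
    eventually_gt_atTop w] with l hR h1 h2 h3 h4 hl hlw
  obtain ⟨R, hR, hRx⟩ := hR
  obtain ⟨R', hR', hRx'⟩ := hw l hlw
  simp only [smul_sub]
  rw [integral_sub h1 h3]
  refine (smul_eq_zero.1 ?_).resolve_left hl.ne'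
  rw [smul_sub, ← hRx, ← h2, sub_eq_zero]
  obtain ⟨⟨hd, hd'⟩, he⟩ := hR'.1 x
  -- The resolvent of the part is the restriction of the resolvent of `A`, since `R' x` solves the
  -- equation (l - A)y = x.
  have e1 : R x = (R' x : Z) := by
    have := hR.2 ⟨R' x, hd⟩
    rw [← this]
    congr 1
    exact congrArg Subtype.val he.symm
  rw [e1, (hRx' x).2]
  exact ((A.domain.topologicalClosure.subtypeL).integral_comp_comm h4).symm

/-- `(l₀ - A) ∫₀ᵗ S(s) x ds = l₀ ∫₀ᵗ S(s) x ds - S(t) x + t x`, in resolvent form. -/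
theorem GeneratesIntegratedSemigroup.opPrim_eq (h : GeneratesIntegratedSemigroup A S) {l₀ : ℝ}
    {R₀ : Z →L[ℝ] Z} (h₀ : IsResolventAt A l₀ R₀) (x : Z) {t : ℝ} (ht : 0 ≤ t) :
    ∫ s in (0 : ℝ)..t, S s x =
      R₀ (l₀ • (∫ s in (0 : ℝ)..t, S s x) - (S t x - t • x)) := by
  have hS := h.expBdd x
  have hsum : ExpBdd fun t => l₀ • S t x + x := (hS.smul l₀).add (ExpBdd.const x)
  have hR0 : ExpBdd fun t => R₀ ((∫ s in (0 : ℝ)..t, (l₀ • S s x + x)) - S t x) :=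
    (hsum.integral.sub hS).clm R₀
  have key := (hS.integral.sub hR0).eq_zero_of_laplace ?_ t ht
  · rw [sub_eq_zero] at key
    rw [intervalIntegral.integral_add ((hS.smul l₀).cont.intervalIntegrable_of_Ici le_rfl ht)
      intervalIntegrable_const, intervalIntegral.integral_smul] at key
    nth_rw 1 [key]
    congr 1
    simp only [intervalIntegral.integral_const, sub_zero]
    abel
  · filter_upwards [h.laplace, hS.eventually_integrableOn, (hS.smul l₀).eventually_integrableOn,
      (ExpBdd.const x).eventually_integrableOn, hS.laplace_integral, hsum.laplace_integral,
      hS.integral.eventually_integrableOn, hsum.integral.eventually_integrableOn,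
      hR0.eventually_integrableOn, (hsum.integral.sub hS).eventually_integrableOn,
      eventually_gt_atTop 0] with l hR h1 h2 h3 h4 h5 h6 h7 h8 h9 hl
    obtain ⟨R, hR, hRx⟩ := hR
    simp only [smul_sub]
    rw [integral_sub h6 h8]
    have e1 : ∫ t in Ioi (0 : ℝ), Real.exp (-l * t) •
          R₀ ((∫ s in (0 : ℝ)..t, (l₀ • S s x + x)) - S t x) =
        R₀ ((∫ t in Ioi (0 : ℝ), Real.exp (-l * t) • ∫ s in (0 : ℝ)..t, (l₀ • S s x + x)) -
          ∫ t in Ioi (0 : ℝ), Real.exp (-l * t) • S t x) := by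
      rw [← integral_sub h7 h1]
      have e := R₀.integral_comp_comm h9
      simp only [smul_sub] at e
      rw [← e]
      simp only [map_sub, R₀.map_smul, smul_sub]
    rw [e1]
    set I₁ := ∫ t in Ioi (0 : ℝ), Real.exp (-l * t) • ∫ s in (0 : ℝ)..t, (l₀ • S s x + x)
    set I₂ := ∫ t in Ioi (0 : ℝ), Real.exp (-l * t) • S t x with hI₂
    simp only [smul_add] at h5
    rw [integral_add h2 h3] at h5
    have e2 : ∫ t in Ioi (0 : ℝ), Real.exp (-l * t) • l₀ • S t x = l₀ • I₂ := by
      simp only [smul_comm _ l₀]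
      exact integral_smul _ _
    rw [e2] at h5
    have e3 := laplace_const x hl
    have hl2 : l * l ≠ 0 := (mul_pos hl hl).ne'
    refine (smul_eq_zero.1 ?_).resolve_left hl2
    -- With the factor l², the argument of `R₀` becomes the left-hand argument of the resolvent
    -- identity, whose value is `R x`.
    have e4 : (l * l) • (I₁ - I₂) = x + (l₀ - l) • R x := by
      rw [hRx, ← hI₂, smul_sub, mul_smul, ← h5, smul_add, e3, mul_smul, sub_smul, smul_comm l l₀]
      abel
    rw [smul_sub, ← map_smul, e4, h₀.identity hR, mul_smul, ← h4, ← hRx, sub_self]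

/-- The initial value is not part of the definition. At t = 0 the primitive of S is 0, and A 0 = 0
forces S(0)x = 0. -/
theorem GeneratesIntegratedSemigroup.apply_zero (h : GeneratesIntegratedSemigroup A S)
    {l₀ : ℝ} {R₀ : Z →L[ℝ] Z} (h₀ : IsResolventAt A l₀ R₀) (x : Z) : S 0 x = 0 := by
  have h1 := h.opPrim_eq h₀ x le_rfl
  obtain ⟨hd, he⟩ := h₀.eq_apply_iff.1 h1
  have h2 : (⟨∫ s in (0 : ℝ)..0, S s x, hd⟩ : A.domain) = 0 := Subtype.ext (by simp)
  rw [h2, A.map_zero] at he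
  simpa using he.symm

/-- The definition of generation does not include T₀(0) = I. On D(A) both formulas for S(t)x give ∫
T₀(s)x = ∫ (x + S(s)Ax). Removing the integral at t = 0 gives T₀(0)x = x there, and D(A) is dense in
its closure. -/
theorem IsMROperator.semigroup_zero (h : IsMROperator A T₀ μ S δ) (x : DomClosure A) :
    T₀ 0 x = x := by
  obtain ⟨l₀, R₀, h₀⟩ := h.resolvent
  have hdom : ∀ y : A.domain, ∀ hy : (y : Z) ∈ A.domain.topologicalClosure,
      T₀ 0 ⟨y, hy⟩ = ⟨y, hy⟩ := by
    intro y hy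
    have hT : ContinuousOn (fun s => (T₀ s ⟨y, hy⟩ : Z)) (Ici 0) :=
      continuous_subtype_val.comp_continuousOn (h.semigroup.1 _)
    have hc : ContinuousOn (fun s => (y : Z) + S s (A y)) (Ici 0) :=
      continuousOn_const.add (h.integrated.1 _)
    have h1 := eqOn_of_integral_eq (G := fun s => (T₀ s ⟨y, hy⟩ : Z))
      (G' := fun s => (y : Z) + S s (A y)) one_pos (hT.mono Icc_subset_Ici_self)
      (hc.mono Icc_subset_Ici_self) ?_ (left_mem_Icc.2 zero_le_one)
    · refine Subtype.ext ?_
      simpa [h.integrated.apply_zero h₀] using h1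
    · intro t ht
      rw [← h.apply_closure _ ht.1, intervalIntegral.integral_add intervalIntegrable_const
        ((h.integrated.1 _).intervalIntegrable_of_Ici le_rfl ht.1)]
      simpa using h.integrated.apply_domain y ht.1
  have hcl : IsClosed {x : DomClosure A | T₀ 0 x = x} :=
    isClosed_eq (T₀ 0).continuous continuous_id
  have hx : x ∈ closure {x : DomClosure A | (x : Z) ∈ A.domain} := by
    rw [closure_subtype]
    have : ((fun x : DomClosure A => (x : Z)) '' {x : DomClosure A | (x : Z) ∈ A.domain}) =
        A.domain := by
      ext y
      constructor
      · rintro ⟨x, hx, rfl⟩; exact hx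
      · intro hy
        exact ⟨⟨y, A.domain.le_topologicalClosure hy⟩, hy, rfl⟩
    rw [this]
    exact x.2
  exact hcl.closure_subset_iff.2 (fun y hy => hdom ⟨y, hy⟩ y.2) hx

end MR

/-! ### The operation `S ◇ f` for continuous `f` -/

section Approximation

set_option linter.unusedSectionVars false

variable {E : Type*} [NormedAddCommGroup E] [NormedSpace ℝ E] [CompleteSpace E]

/-- The approximants are the forward averages r⁻¹ ∫ f over [t, t + r]. They are primitives of
continuous functions, and uniform continuity is used on [0, b + 1] because they look ahead by r < 1.
-/
theorem exists_primitive_near {f : ℝ → E} (hf : Continuous f) (b : ℝ) {e : ℝ} (he : 0 < e) :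
    ∃ (x₀ : E) (φ : ℝ → E), Continuous φ ∧
      ∀ t ∈ Icc 0 b, ‖x₀ + (∫ s in (0 : ℝ)..t, φ s) - f t‖ ≤ e := by
  have huc := (isCompact_Icc (a := (0 : ℝ)) (b := b + 1)).uniformContinuousOn_of_continuous
    hf.continuousOn
  obtain ⟨d, hd, huc⟩ := Metric.uniformContinuousOn_iff.1 huc e he
  obtain ⟨r, hr0, hr⟩ := exists_between (lt_min hd one_pos)
  have hrd : r < d := hr.trans_le (min_le_left _ _)
  have hr1 : r < 1 := hr.trans_le (min_le_right _ _)
  refine ⟨r⁻¹ • ∫ s in (0 : ℝ)..r, f s, fun s => r⁻¹ • (f (s + r) - f s), by fun_prop,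
    fun t ht => ?_⟩
  have hi : ∀ a b, IntervalIntegrable f volume a b := fun a b => hf.intervalIntegrable a b
  have hi' : IntervalIntegrable (fun s => f (s + r)) volume 0 t :=
    (by fun_prop : Continuous fun s => f (s + r)).intervalIntegrable _ _
  have e1 : r⁻¹ • (∫ s in (0 : ℝ)..r, f s) + (∫ s in (0 : ℝ)..t, r⁻¹ • (f (s + r) - f s)) - f t =
      r⁻¹ • ∫ s in t..(t + r), (f s - f t) := by
    rw [intervalIntegral.integral_smul, ← smul_add, intervalIntegral.integral_sub hi' (hi _ _),
      intervalIntegral.integral_comp_add_right (fun s => f s),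
      intervalIntegral.integral_sub (hi _ _) intervalIntegrable_const,
      intervalIntegral.integral_const, smul_sub, add_sub_cancel_left, smul_smul,
      inv_mul_cancel₀ hr0.ne', one_smul, zero_add]
    congr 2
    rw [← intervalIntegral.integral_add_adjacent_intervals (hi 0 t) (hi t r),
      ← intervalIntegral.integral_add_adjacent_intervals (hi t r) (hi r (t + r))]
    abel
  rw [e1, norm_smul, norm_inv, Real.norm_eq_abs, abs_of_pos hr0, inv_mul_le_iff₀ hr0, mul_comm]
  refine (intervalIntegral.norm_integral_le_of_norm_le_const (C := e) fun s hs => ?_).trans ?_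
  · rw [uIoc_of_le (by linarith)] at hs
    rw [← dist_eq_norm]
    refine (huc s ⟨by linarith [ht.1, hs.1], by linarith [ht.2, hs.2]⟩ t
      ⟨ht.1, by linarith [ht.2]⟩ ?_).le
    rw [Real.dist_eq, abs_of_pos (by linarith [hs.1])]
    linarith [hs.2]
  · rw [add_sub_cancel_left, abs_of_pos hr0]

theorem exists_continuous_eqOn_Icc {g : ℝ → E} {b : ℝ} (hb : 0 ≤ b)
    (hg : ContinuousOn g (Icc 0 b)) : ∃ g' : ℝ → E, Continuous g' ∧ EqOn g' g (Icc 0 b) :=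
  ⟨IccExtend hb ((Icc 0 b).domRestrict g), (continuousOn_iff_continuous_domRestrict.1 hg).Icc_extend',
    fun t ht => by rw [IccExtend_of_mem hb _ ht]; rfl⟩

end Approximation

section MR

set_option linter.unusedSectionVars false

variable {Z : Type u} [NormedAddCommGroup Z] [NormedSpace ℝ Z] [CompleteSpace Z]
  {A : Z →ₗ.[ℝ] Z} {T₀ : ℝ → DomClosure A →L[ℝ] DomClosure A} {μ : ℝ} {S : ℝ → Z →L[ℝ] Z}
  {δ : ℝ → ℝ}

theorem diamond_eq_of_integral_eq {g V : ℝ → Z} {b : ℝ} (hb : 0 < b)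
    (hV : ContinuousOn V (Icc 0 b))
    (h : ∀ t ∈ Icc 0 b, opConv (fun s => S s) g t = ∫ s in (0 : ℝ)..t, V s) :
    EqOn (diamond b S g) V (Icc 0 b) := by
  intro t ht
  exact ((hasDerivWithinAt_integral_Icc hV ht).congr (fun s hs => h s hs) (h t ht)).derivWithin
    (uniqueDiffOn_Icc hb t ht)

theorem opConv_max_zero {g g' : ℝ → Z} {t : ℝ} (ht : 0 ≤ t) (hg : EqOn g g' (Icc 0 t)) :
    opConv (fun s => S s) g t = opConv (fun s => S (max s 0)) g' t :=
  opConv_congr ht (fun s hs x => by rw [max_eq_left hs.1]) hg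

theorem norm_le_supNormOn {b : ℝ} {V : ℝ → Z} (hV : ContinuousOn V (Icc 0 b)) {t : ℝ}
    (ht : t ∈ Icc 0 b) : ‖V t‖ ≤ supNormOn b V :=
  le_csSup (isCompact_Icc.image_of_continuousOn hV.norm).bddAbove ⟨t, ht, rfl⟩

theorem supNormOn_le {b : ℝ} (hb : 0 ≤ b) {V : ℝ → Z} {m : ℝ} (h : ∀ t ∈ Icc 0 b, ‖V t‖ ≤ m) :
    supNormOn b V ≤ m := by
  refine csSup_le ⟨_, 0, left_mem_Icc.2 hb, rfl⟩ ?_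
  rintro _ ⟨t, ht, rfl⟩
  exact h t ht

theorem continuous_primitive_conv (hB : Continuous fun p : ℝ × Z => S (max p.1 0) p.2)
    {φ : ℝ → Z} (hφ : Continuous φ) (x₀ : Z) :
    Continuous fun t => S (max t 0) x₀ + opConv (fun s => S (max s 0)) φ t :=
  (hB.comp (continuous_id.prodMk continuous_const)).add
    (continuous_opConv (B := fun s => S (max s 0)) hB hφ)

theorem opConv_primitive_eq_integral (hB : Continuous fun p : ℝ × Z => S (max p.1 0) p.2)
    {φ : ℝ → Z} (hφ : Continuous φ) (x₀ : Z) {t : ℝ} (ht : 0 ≤ t) :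
    opConv (fun s => S (max s 0)) (fun s => x₀ + ∫ r in (0 : ℝ)..s, φ r) t =
      ∫ s in (0 : ℝ)..t, (S (max s 0) x₀ + opConv (fun s => S (max s 0)) φ s) := by
  rw [opConv_primitive (B := fun s => S (max s 0)) hB hφ x₀ t ht,
    ← integral_opConv (B := fun s => S (max s 0)) hB hφ ht,
    intervalIntegral.integral_add]
  · rfl
  · exact (hB.comp (continuous_id.prodMk continuous_const)).intervalIntegrable _ _
  · exact (continuous_opConv (B := fun s => S (max s 0)) hB hφ).intervalIntegrable _ _

/-- For the C¹ function x₀ + ∫ φ the derivative of the convolution is explicitly S x₀ + S * φ, so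
the MR estimate applies. The factor `max (δ b) 0` appears because no sign of `δ` is assumed. -/
theorem IsMROperator.norm_primitive_le (h : IsMROperator A T₀ μ S δ) {b : ℝ} (hb : 0 < b)
    {φ : ℝ → Z} (hφ : Continuous φ) {x₀ : Z} {m : ℝ}
    (hm : ∀ s ∈ Icc 0 b, ‖x₀ + ∫ r in (0 : ℝ)..s, φ r‖ ≤ m) {t : ℝ} (ht : t ∈ Icc 0 b) :
    ‖S (max t 0) x₀ + opConv (fun s => S (max s 0)) φ t‖ ≤ max (δ b) 0 * m := by
  have hB := h.integrated.continuous
  set f : ℝ → Z := fun s => x₀ + ∫ r in (0 : ℝ)..s, φ r with hf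
  set V : ℝ → Z := fun t => S (max t 0) x₀ + opConv (fun s => S (max s 0)) φ t with hV
  have hVc : Continuous V := continuous_primitive_conv hB hφ x₀
  have hfd : ∀ s, HasDerivAt f (φ s) s := fun s =>
    (intervalIntegral.integral_hasDerivAt_right (hφ.intervalIntegrable 0 s)
      (hφ.stronglyMeasurableAtFilter _ _) hφ.continuousAt).const_add x₀
  have hfC : ContDiff ℝ 1 f := by
    refine contDiff_one_iff_deriv.2 ⟨fun s => (hfd s).differentiableAt, ?_⟩
    rw [show deriv f = φ from funext fun s => (hfd s).deriv]
    exact hφ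
  have hD : EqOn (diamond b S f) V (Icc 0 b) := by
    refine diamond_eq_of_integral_eq hb hVc.continuousOn fun s hs => ?_
    rw [opConv_max_zero hs.1 (fun _ _ => rfl)]
    exact opConv_primitive_eq_integral hB hφ x₀ hs.1
  have hm0 : 0 ≤ supNormOn b f :=
    (norm_nonneg _).trans (norm_le_supNormOn hfC.continuous.continuousOn ht)
  calc ‖V t‖ ≤ supNormOn b (diamond b S f) := by
        rw [← hD ht]
        exact norm_le_supNormOn (hVc.continuousOn.congr hD) ht
    _ ≤ δ b * supNormOn b f := h.diamond_le b hb f hfC.contDiffOn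
    _ ≤ max (δ b) 0 * supNormOn b f := by gcongr; exact le_max_left _ _
    _ ≤ max (δ b) 0 * m := by
        gcongr
        · exact supNormOn_le hb.le hm

/-- For continuous `g` the convolution `S * g` is continuously differentiable, with the same bound
on the derivative as for smooth `g`. -/
theorem IsMROperator.diamond_spec (h : IsMROperator A T₀ μ S δ) {b : ℝ} (hb : 0 < b)
    {g : ℝ → Z} (hg : ContinuousOn g (Icc 0 b)) :
    ContinuousOn (diamond b S g) (Icc 0 b) ∧
    (∀ t ∈ Icc 0 b, opConv (fun s => S s) g t = ∫ s in (0 : ℝ)..t, diamond b S g s) ∧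
    ∀ m, (∀ s ∈ Icc 0 b, ‖g s‖ ≤ m) → ∀ t ∈ Icc 0 b, ‖diamond b S g t‖ ≤ max (δ b) 0 * m := by
  have hB := h.integrated.continuous
  obtain ⟨f, hf, hfg⟩ := exists_continuous_eqOn_Icc hb.le hg
  set e : ℕ → ℝ := fun n => 1 / ((n : ℝ) + 1) with he
  have he0 : ∀ n, 0 < e n := fun n => Nat.one_div_pos_of_nat
  have helim : Tendsto e atTop (𝓝 0) := tendsto_one_div_add_atTop_nhds_zero_nat
  choose x φ hφ hx using fun n => exists_primitive_near hf b (he0 n)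
  -- `V n` is the derivative of S * fₙ for C¹ approximants fₙ of g. The MR bound for differences
  -- makes the `V n` uniformly Cauchy, and their continuous limit turns out to be the derivative of
  -- S * g.
  set V : ℕ → ℝ → Z := fun n t => S (max t 0) (x n) + opConv (fun s => S (max s 0)) (φ n) t
    with hV
  have hVc : ∀ n, Continuous (V n) := fun n => continuous_primitive_conv hB (hφ n) (x n)
  set D := max (δ b) 0 with hD
  have hD0 : 0 ≤ D := le_max_right _ _
  have hVV : ∀ n m, ∀ t ∈ Icc 0 b, ‖V n t - V m t‖ ≤ D * (e n + e m) := by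
    intro n m t ht
    have h1 := h.norm_primitive_le hb ((hφ n).sub (hφ m)) (x₀ := x n - x m) (m := e n + e m)
      (fun s hs => ?_) ht
    · convert h1 using 2
      simp only [hV, opConv, Pi.sub_apply, map_sub]
      rw [intervalIntegral.integral_sub]
      · abel
      · exact (hB.comp ((continuous_const.sub continuous_id).prodMk (hφ n))).intervalIntegrable _ _
      · exact (hB.comp ((continuous_const.sub continuous_id).prodMk (hφ m))).intervalIntegrable _ _
    · simp only [Pi.sub_apply]
      rw [intervalIntegral.integral_sub ((hφ n).intervalIntegrable _ _)
        ((hφ m).intervalIntegrable _ _)]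
      calc _ = ‖(x n + (∫ r in (0 : ℝ)..s, φ n r) - f s) -
            (x m + (∫ r in (0 : ℝ)..s, φ m r) - f s)‖ := by congr 1; abel
        _ ≤ _ := (norm_sub_le _ _).trans (add_le_add (hx n s hs) (hx m s hs))
  have hlim : ∀ t ∈ Icc 0 b, ∃ v, Tendsto (fun n => V n t) atTop (𝓝 v) := by
    intro t ht
    refine cauchySeq_tendsto_of_complete (cauchySeq_of_le_tendsto_0 (fun N => D * (2 * e N)) ?_ ?_)
    · intro n m N hn hm
      rw [dist_eq_norm]
      refine (hVV n m t ht).trans ?_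
      have hmono : ∀ {k}, N ≤ k → e k ≤ e N := fun hk => Nat.one_div_le_one_div hk
      gcongr
      linarith [hmono hn, hmono hm]
    · simpa using (helim.const_mul 2).const_mul D
  choose! v hv using hlim
  have hVv : ∀ n, ∀ t ∈ Icc 0 b, ‖V n t - v t‖ ≤ D * e n := by
    intro n t ht
    have h1 : Tendsto (fun m => ‖V n t - V m t‖) atTop (𝓝 ‖V n t - v t‖) :=
      (tendsto_const_nhds.sub (hv t ht)).norm
    have h2 : Tendsto (fun m => D * (e n + e m)) atTop (𝓝 (D * (e n + 0))) :=
      (helim.const_add _).const_mul _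
    rw [add_zero] at h2
    exact le_of_tendsto_of_tendsto' h1 h2 fun m => hVV n m t ht
  have hDe : Tendsto (fun n => D * e n) atTop (𝓝 0) := by simpa using helim.const_mul D
  have hvc : ContinuousOn v (Icc 0 b) := by
    have hu : TendstoUniformlyOn V v atTop (Icc 0 b) := by
      refine Metric.tendstoUniformlyOn_iff.2 fun r hr => ?_
      filter_upwards [hDe.eventually_lt_const hr] with n hn t ht
      rw [dist_comm, dist_eq_norm]
      exact (hVv n t ht).trans_lt hn
    exact hu.continuousOn (Frequently.of_forall fun n => (hVc n).continuousOn)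
  obtain ⟨C, hC0, hC⟩ : ∃ C : ℝ, 0 ≤ C ∧ ∀ s ∈ Icc 0 b, ‖S s‖ ≤ C := by
    obtain ⟨K, w, hK⟩ := h.integrated.2.1
    refine ⟨|K| * Real.exp (|w| * b), by positivity, fun s hs => (hK s hs.1).trans ?_⟩
    gcongr
    · exact le_abs_self K
    · exact hs.1
    · exact le_abs_self w
    · exact hs.2
  have hint : ∀ t ∈ Icc 0 b, opConv (fun s => S s) g t = ∫ s in (0 : ℝ)..t, v s := by
    intro t ht
    rw [opConv_max_zero ht.1 fun s hs => (hfg ⟨hs.1, hs.2.trans ht.2⟩).symm]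
    rw [← sub_eq_zero, ← norm_le_zero_iff]
    have h1 : Tendsto (fun n => C * e n * t + D * e n * t) atTop (𝓝 0) := by
      simpa using ((helim.const_mul C).mul_const t).add ((helim.const_mul D).mul_const t)
    refine ge_of_tendsto' h1 fun n => ?_
    -- Two errors, both tending to 0: replacing `f` by its approximant under the bounded operators
    -- S, and replacing `v` by `V n`.
    have h2 : opConv (fun s => S (max s 0)) f t - ∫ s in (0 : ℝ)..t, v s =
        (∫ s in (0 : ℝ)..t, S (max (t - s) 0) (f s - (x n + ∫ r in (0 : ℝ)..s, φ n r))) +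
          ∫ s in (0 : ℝ)..t, (V n s - v s) := by
      have hvi : IntervalIntegrable v volume 0 t := by
        refine (hvc.mono ?_).intervalIntegrable
        rw [uIcc_of_le ht.1]; exact Icc_subset_Icc_right ht.2
      have hpc : Continuous fun s => x n + ∫ r in (0 : ℝ)..s, φ n r :=
        continuous_const.add (intervalIntegral.continuous_primitive
          (fun a b => (hφ n).intervalIntegrable a b) 0)
      rw [intervalIntegral.integral_sub ((hVc n).intervalIntegrable _ _) hvi,
        ← opConv_primitive_eq_integral hB (hφ n) (x n) ht.1]
      simp only [map_sub]
      rw [intervalIntegral.integral_sub]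
      · simp only [opConv]; abel
      · exact (hB.comp ((continuous_const.sub continuous_id).prodMk hf)).intervalIntegrable _ _
      · exact (hB.comp ((continuous_const.sub continuous_id).prodMk hpc)).intervalIntegrable _ _
    rw [h2]
    refine (norm_add_le _ _).trans (add_le_add ?_ ?_)
    · refine (intervalIntegral.norm_integral_le_of_norm_le_const (C := C * e n)
        fun s hs => ?_).trans (by rw [sub_zero, abs_of_nonneg ht.1])
      rw [uIoc_of_le ht.1] at hs
      refine (S _).le_of_opNorm_le_of_le (hC _ ⟨le_max_right _ _, max_le ?_ hb.le⟩) ?_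
      · linarith [hs.1, ht.2]
      · rw [norm_sub_rev]
        exact hx n s ⟨hs.1.le, hs.2.trans ht.2⟩
    · refine (intervalIntegral.norm_integral_le_of_norm_le_const (C := D * e n)
        fun s hs => ?_).trans (by rw [sub_zero, abs_of_nonneg ht.1])
      rw [uIoc_of_le ht.1] at hs
      exact hVv n s ⟨hs.1.le, hs.2.trans ht.2⟩
  have hdia := diamond_eq_of_integral_eq hb hvc hint
  refine ⟨hvc.congr hdia, fun t ht => ?_, fun m hm t ht => ?_⟩
  · rw [hint t ht]
    exact integral_congr_Icc ht.1 fun s hs => (hdia ⟨hs.1, hs.2.trans ht.2⟩).symm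
  · rw [hdia ht]
    have h1 : Tendsto (fun n => D * (m + e n)) atTop (𝓝 (D * m)) := by
      simpa using (helim.const_add m).const_mul D
    refine le_of_tendsto_of_tendsto' (hv t ht).norm h1 fun n => ?_
    refine h.norm_primitive_le hb (hφ n) (fun s hs => ?_) ht
    have h2 := norm_add_le (f s) (x n + (∫ r in (0 : ℝ)..s, φ n r) - f s)
    rw [add_sub_cancel] at h2
    refine h2.trans (add_le_add ?_ (hx n s hs))
    rw [hfg hs]; exact hm s hs

/-- On a one-point interval `derivWithin` takes its default value 0, which is also the correct value
of S ◇ g at time 0. This lets intervals of length 0 be treated with the others. -/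
theorem diamond_zero (g : ℝ → Z) (t : ℝ) : diamond 0 S g t = 0 := by
  rw [diamond, Icc_self]
  exact derivWithin_zero_of_not_accPt (mt Set.Infinite.of_accPt (by simp))

end MR

/-! ### Mild solutions and the variation of constants formula -/

section MR

set_option linter.unusedSectionVars false

variable {Z : Type u} [NormedAddCommGroup Z] [NormedSpace ℝ Z] [CompleteSpace Z]
  {A : Z →ₗ.[ℝ] Z} {T₀ : ℝ → DomClosure A →L[ℝ] DomClosure A} {μ : ℝ} {S : ℝ → Z →L[ℝ] Z}
  {δ : ℝ → ℝ}

/-- `z` solves `z(t) = z(0) + A ∫₀ᵗ z + ∫₀ᵗ g` on `[0, b]`, with `A` expressed through its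
resolvent `R₀` at `l₀`. -/
def MildOn (l₀ : ℝ) (R₀ : Z →L[ℝ] Z) (b : ℝ) (z g : ℝ → Z) : Prop :=
  ∀ t ∈ Icc 0 b, ∫ s in (0 : ℝ)..t, z s =
    R₀ (l₀ • (∫ s in (0 : ℝ)..t, z s) - (z t - z 0 - ∫ s in (0 : ℝ)..t, g s))

theorem MildOn.congr {l₀ : ℝ} {R₀ : Z →L[ℝ] Z} {b : ℝ} {z z' g g' : ℝ → Z}
    (h : MildOn l₀ R₀ b z g) (hz : EqOn z z' (Icc 0 b)) (hg : EqOn g g' (Icc 0 b)) :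
    MildOn l₀ R₀ b z' g' := by
  intro t ht
  have hsub : Icc 0 t ⊆ Icc 0 b := Icc_subset_Icc_right ht.2
  have h1 := h t ht
  rwa [integral_congr_Icc ht.1 (hz.mono hsub), integral_congr_Icc ht.1 (hg.mono hsub), hz ht,
    hz ⟨le_rfl, ht.1.trans ht.2⟩] at h1

/-- Subtract the equation at time r from the one at time r + t. The resolvent form is linear, so no
domain question arises. -/
theorem MildOn.shift {l₀ : ℝ} {R₀ : Z →L[ℝ] Z} {b : ℝ} {z g : ℝ → Z} (h : MildOn l₀ R₀ b z g)
    (hz : ContinuousOn z (Icc 0 b)) (hg : ContinuousOn g (Icc 0 b)) {r : ℝ} (hr : r ∈ Icc 0 b) :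
    MildOn l₀ R₀ (b - r) (fun s => z (r + s)) fun s => g (r + s) := by
  intro t ht
  have hrt : r + t ∈ Icc 0 b := ⟨add_nonneg hr.1 ht.1, by linarith [ht.2]⟩
  have hi : ∀ {G : ℝ → Z}, ContinuousOn G (Icc 0 b) →
      ∫ s in (0 : ℝ)..t, G (r + s) = (∫ s in (0 : ℝ)..(r + t), G s) - ∫ s in (0 : ℝ)..r, G s := by
    intro G hG
    have hI : ∀ {a}, a ∈ Icc 0 b → IntervalIntegrable G volume 0 a := fun {a} ha =>
      (hG.mono (by rw [uIcc_of_le ha.1]; exact Icc_subset_Icc_right ha.2)).intervalIntegrable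
    rw [intervalIntegral.integral_comp_add_left, intervalIntegral.integral_interval_sub_left
      (hI hrt) (hI hr), add_zero]
  have h1 := h _ hrt
  have h2 := h _ hr
  simp only [add_zero]
  rw [hi hz, hi hg]
  nth_rw 1 [h1, h2]
  rw [← map_sub]
  congr 1
  rw [smul_sub]
  abel

theorem opConv_smul_eq {g : ℝ → Z} (hg : Continuous g) {t : ℝ} (ht : 0 ≤ t) :
    opConv (fun (s : ℝ) (x : Z) => s • x) g t = ∫ s in (0 : ℝ)..t, ∫ r in (0 : ℝ)..s, g r := by
  have h := integral_opConv (B := fun (_ : ℝ) (x : Z) => x) continuous_snd hg ht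
  simp only [opConv, opPrim, intervalIntegral.integral_const, sub_zero] at h
  exact h.symm

section

variable {l₀ : ℝ} {R₀ : Z →L[ℝ] Z}

theorem GeneratesIntegratedSemigroup.opPrim_max_eq (h : GeneratesIntegratedSemigroup A S)
    (h₀ : IsResolventAt A l₀ R₀) (x : Z) {t : ℝ} (ht : 0 ≤ t) :
    opPrim (fun s => S (max s 0)) t x =
      R₀ (l₀ • opPrim (fun s => S (max s 0)) t x - (S (max t 0) x - t • x)) := by
  have h1 : opPrim (fun s => S (max s 0)) t x = ∫ s in (0 : ℝ)..t, S s x :=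
    integral_congr_Icc ht fun s hs => by simp only [max_eq_left hs.1]
  rw [h1, max_eq_left ht]
  exact h.opPrim_eq h₀ x ht

theorem GeneratesIntegratedSemigroup.apply_of_resolvent (h : GeneratesIntegratedSemigroup A S)
    (h₀ : IsResolventAt A l₀ R₀) {x y : Z} (hxy : x = R₀ (l₀ • x - y)) {t : ℝ} (ht : 0 ≤ t) :
    S (max t 0) x = t • x + opPrim (fun s => S (max s 0)) t y := by
  obtain ⟨hd, rfl⟩ := h₀.eq_apply_iff.1 hxy
  have h1 : opPrim (fun s => S (max s 0)) t (A ⟨x, hd⟩) = ∫ s in (0 : ℝ)..t, S s (A ⟨x, hd⟩) :=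
    integral_congr_Icc ht fun s hs => by simp only [max_eq_left hs.1]
  rw [h1, max_eq_left ht]
  exact h.apply_domain ⟨x, hd⟩ ht

/-- The right side is the variation of constants formula integrated once, which makes sense for
every continuous g. Forward: apply S(t)x = tx + ∫ S(s)Ax to the values of u = ∫ z inside S * u.
Backward: the strong primitive of S satisfies a resolvent equation, which is convolved with g and
differentiated once. -/
theorem GeneratesIntegratedSemigroup.mildOn_iff (h : GeneratesIntegratedSemigroup A S)
    (h₀ : IsResolventAt A l₀ R₀) {b : ℝ} (hb : 0 < b) {z g : ℝ → Z} (hz : Continuous z)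
    (hg : Continuous g) :
    MildOn l₀ R₀ b z g ↔ ∀ t ∈ Icc 0 b, ∫ s in (0 : ℝ)..t, z s =
      S (max t 0) (z 0) + opConv (fun s => S (max s 0)) g t := by
  have hB := h.continuous
  have hW := continuous_opPrim (B := fun s => S (max s 0)) hB
  have hBx : ∀ x, Continuous fun t => S (max t 0) x := fun x =>
    hB.comp (continuous_id.prodMk continuous_const)
  have hprim : ∀ {f : ℝ → Z}, Continuous f → Continuous fun t => ∫ s in (0 : ℝ)..t, f s :=
    fun hf => intervalIntegral.continuous_primitive (fun a b => hf.intervalIntegrable a b) 0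
  have hu := hprim hz
  have hk := hprim hg
  have hcg := continuous_opConv (B := fun s => S (max s 0)) hB hg
  have hWg := continuous_opConv hW hg
  constructor
  · intro hm
    have hk' : Continuous fun s => z 0 + ∫ r in (0 : ℝ)..s, g r := continuous_const.add hk
    -- With W = ∫ S, integration by parts gives S * u = W * z, while mildness gives S * u = t * u +
    -- W * z - W * (z(0) + ∫ g). The unknown term W * z cancels.
    have e1 : ∀ t ∈ Icc 0 b, opConv (fun (s : ℝ) (x : Z) => s • x)
        (fun t => ∫ s in (0 : ℝ)..t, z s) t =
        opConv (opPrim fun s => S (max s 0)) (fun s => z 0 + ∫ r in (0 : ℝ)..s, g r) t := by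
      intro t ht
      have e2 := opConv_primitive (B := fun s => S (max s 0)) hB hz 0 t ht.1
      simp only [zero_add] at e2
      have e3 : opConv (fun s => S (max s 0)) (fun t => ∫ s in (0 : ℝ)..t, z s) t =
          opConv (fun (s : ℝ) (x : Z) => s • x) (fun t => ∫ s in (0 : ℝ)..t, z s) t +
          (opConv (opPrim fun s => S (max s 0)) z t -
          opConv (opPrim fun s => S (max s 0)) (fun s => z 0 + ∫ r in (0 : ℝ)..s, g r) t) := by
        have c1 : Continuous fun s => (t - s) • ∫ r in (0 : ℝ)..s, z r := by fun_prop
        have c2 : Continuous fun s => opPrim (fun s => S (max s 0)) (t - s) (z s) :=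
          hW.comp ((continuous_const.sub continuous_id).prodMk hz)
        have c3 : Continuous fun s => opPrim (fun s => S (max s 0)) (t - s)
            (z 0 + ∫ r in (0 : ℝ)..s, g r) :=
          hW.comp ((continuous_const.sub continuous_id).prodMk hk')
        have c4 : Continuous fun s => opPrim (fun s => S (max s 0)) (t - s) (z s) -
            opPrim (fun s => S (max s 0)) (t - s) (z 0 + ∫ r in (0 : ℝ)..s, g r) := c2.sub c3
        simp only [opConv]
        rw [← intervalIntegral.integral_sub (c2.intervalIntegrable _ _)
          (c3.intervalIntegrable _ _), ← intervalIntegral.integral_add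
          (c1.intervalIntegrable _ _) (c4.intervalIntegrable _ _)]
        refine integral_congr_Icc ht.1 fun s hs => ?_
        rw [h.apply_of_resolvent h₀ (hm s ⟨hs.1, hs.2.trans ht.2⟩)
          (sub_nonneg.2 hs.2)]
        congr 1
        simp only [opPrim]
        rw [← intervalIntegral.integral_sub ((hBx _).intervalIntegrable _ _)
          ((hBx _).intervalIntegrable _ _)]
        refine intervalIntegral.integral_congr fun r _ => ?_
        simp only [← map_sub, sub_sub]
      have e4 : opPrim (fun s => S (max s 0)) t 0 = 0 := by simp [opPrim]
      rw [e2, e4, zero_add] at e3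
      rw [← sub_eq_zero, ← neg_eq_zero, ← sub_eq_zero.2 e3]
      abel
    -- Both sides of `e1` are integrals of convolutions, so one differentiation gives this, and a
    -- second one gives the claim.
    have e5 : EqOn (fun t => ∫ s in (0 : ℝ)..t, ∫ r in (0 : ℝ)..s, z r)
        (fun t => opPrim (fun s => S (max s 0)) t (z 0) +
          opConv (opPrim fun s => S (max s 0)) g t) (Icc 0 b) := by
      refine eqOn_of_integral_eq hb (hprim hu).continuousOn
        ((hW.comp (continuous_id.prodMk continuous_const)).add hWg).continuousOn fun t ht => ?_
      rw [← opConv_smul_eq hu ht.1, e1 t ht, ← integral_opConv (B := fun s => S (max s 0)) hB hk'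
        ht.1]
      refine integral_congr_Icc ht.1 fun s hs => ?_
      exact opConv_primitive (B := fun s => S (max s 0)) hB hg (z 0) s hs.1
    refine eqOn_of_integral_eq hb hu.continuousOn ((hBx _).add hcg).continuousOn fun t ht => ?_
    refine (e5 ht).trans ?_
    simp only
    rw [← integral_opConv (B := fun s => S (max s 0)) hB hg ht.1, intervalIntegral.integral_add
      ((hBx _).intervalIntegrable _ _) (hcg.intervalIntegrable _ _)]
    rfl
  · intro hI
    have hR : Continuous fun t => R₀ (l₀ • (∫ s in (0 : ℝ)..t, z s) -
        (z t - z 0 - ∫ s in (0 : ℝ)..t, g s)) := by fun_prop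
    refine eqOn_of_integral_eq hb hu.continuousOn hR.continuousOn fun t ht => ?_
    have e1 : ∫ s in (0 : ℝ)..t, ∫ r in (0 : ℝ)..s, z r =
        opPrim (fun s => S (max s 0)) t (z 0) + opConv (opPrim fun s => S (max s 0)) g t := by
      rw [integral_congr_Icc ht.1 fun s hs => hI s ⟨hs.1, hs.2.trans ht.2⟩,
        ← integral_opConv (B := fun s => S (max s 0)) hB hg ht.1, intervalIntegral.integral_add
        ((hBx _).intervalIntegrable _ _) (hcg.intervalIntegrable _ _)]
      rfl
    -- The resolvent equation for W(t - s)x at x = g(s), integrated over s. Boundedness of `R₀`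
    -- allows it to leave the integral.
    have e2 : opConv (opPrim fun s => S (max s 0)) g t =
        R₀ (l₀ • opConv (opPrim fun s => S (max s 0)) g t -
          (opConv (fun s => S (max s 0)) g t - opConv (fun (s : ℝ) (x : Z) => s • x) g t)) := by
      have c1 : Continuous fun s => (t - s) • g s := by fun_prop
      have c2 : Continuous fun s => opPrim (fun s => S (max s 0)) (t - s) (g s) :=
        hW.comp ((continuous_const.sub continuous_id).prodMk hg)
      have c3 : Continuous fun s => S (max (t - s) 0) (g s) :=
        hB.comp ((continuous_const.sub continuous_id).prodMk hg)
      have c4 : Continuous fun s => S (max (t - s) 0) (g s) - (t - s) • g s := c3.sub c1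
      have c5 : Continuous fun s => l₀ • opPrim (fun s => S (max s 0)) (t - s) (g s) :=
        c2.const_smul l₀
      have c6 : Continuous fun s => l₀ • opPrim (fun s => S (max s 0)) (t - s) (g s) -
          (S (max (t - s) 0) (g s) - (t - s) • g s) := c5.sub c4
      simp only [opConv]
      rw [← intervalIntegral.integral_smul, ← intervalIntegral.integral_sub
        (c3.intervalIntegrable _ _) (c1.intervalIntegrable _ _),
        ← intervalIntegral.integral_sub (c5.intervalIntegrable _ _)
        (c4.intervalIntegrable _ _), ← R₀.intervalIntegral_comp_comm
        (c6.intervalIntegrable _ _)]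
      refine integral_congr_Icc ht.1 fun s hs => ?_
      exact h.opPrim_max_eq h₀ (g s) (sub_nonneg.2 hs.2)
    have hR' : Continuous fun t => l₀ • (∫ s in (0 : ℝ)..t, z s) -
        (z t - z 0 - ∫ s in (0 : ℝ)..t, g s) := by fun_prop
    rw [R₀.intervalIntegral_comp_comm (hR'.intervalIntegrable _ _)]
    have i1 : ∫ s in (0 : ℝ)..t, (l₀ • (∫ s in (0 : ℝ)..s, z s) -
        (z s - z 0 - ∫ s in (0 : ℝ)..s, g s)) = l₀ • (∫ s in (0 : ℝ)..t, ∫ r in (0 : ℝ)..s, z r) -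
        ((∫ s in (0 : ℝ)..t, z s) - t • z 0 - ∫ s in (0 : ℝ)..t, ∫ r in (0 : ℝ)..s, g r) := by
      have c1 : Continuous fun s => z s - z 0 := hz.sub continuous_const
      have c2 : Continuous fun s => z s - z 0 - ∫ r in (0 : ℝ)..s, g r := c1.sub hk
      have c3 : Continuous fun s => l₀ • ∫ r in (0 : ℝ)..s, z r := hu.const_smul l₀
      rw [intervalIntegral.integral_sub (c3.intervalIntegrable _ _) (c2.intervalIntegrable _ _),
        intervalIntegral.integral_sub (c1.intervalIntegrable _ _) (hk.intervalIntegrable _ _),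
        intervalIntegral.integral_sub (hz.intervalIntegrable _ _) intervalIntegrable_const,
        intervalIntegral.integral_smul]
      simp
    rw [i1, e1, hI t ht, ← opConv_smul_eq hg ht.1]
    nth_rw 1 [h.opPrim_max_eq h₀ (z 0) ht.1, e2]
    rw [← map_add]
    congr 1
    rw [smul_add]
    abel

end

/-- On the closure of D(A) one has S(t)x = ∫ T₀(s)x, and S * g = ∫ S ◇ g, so the integrated formula
is the primitive of the variation of constants formula. For b < 0 both sides are void, and for b = 0
both are trivial since T₀(0) = I. -/
theorem IsMROperator.variation_iff_mildOn (h : IsMROperator A T₀ μ S δ) {l₀ : ℝ}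
    {R₀ : Z →L[ℝ] Z} (h₀ : IsResolventAt A l₀ R₀) {b : ℝ} {z : ℝ → DomClosure A} {g : ℝ → Z}
    (hz : ContinuousOn z (Icc 0 b)) (hg : ContinuousOn g (Icc 0 b)) :
    (∀ t ∈ Icc 0 b, (z t : Z) = T₀ t (z 0) + diamond b S g t) ↔
      MildOn l₀ R₀ b (fun s => (z s : Z)) g := by
  have hz' : ContinuousOn (fun s => (z s : Z)) (Icc 0 b) :=
    continuous_subtype_val.comp_continuousOn hz
  rcases lt_trichotomy b 0 with hb | rfl | hb
  · simp [MildOn, Icc_eq_empty (not_le.2 hb)]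
  · simp [MildOn, diamond_zero, h.semigroup_zero]
  obtain ⟨z₁, hz₁, hzz⟩ := exists_continuous_eqOn_Icc hb.le hz'
  obtain ⟨g₁, hg₁, hgg⟩ := exists_continuous_eqOn_Icc hb.le hg
  have h0 : (0 : ℝ) ∈ Icc 0 b := left_mem_Icc.2 hb.le
  obtain ⟨hdc, hdi, -⟩ := h.diamond_spec hb hg
  have hT : ContinuousOn (fun t => (T₀ t (z 0) : Z)) (Ici 0) :=
    continuous_subtype_val.comp_continuousOn (h.semigroup.1 _)
  have hI : (∀ t ∈ Icc 0 b, (z t : Z) = T₀ t (z 0) + diamond b S g t) ↔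
      ∀ t ∈ Icc 0 b, ∫ s in (0 : ℝ)..t, (z s : Z) =
        ∫ s in (0 : ℝ)..t, ((T₀ s (z 0) : Z) + diamond b S g s) :=
    ⟨fun hv t ht => integral_congr_Icc ht.1 fun s hs => hv s ⟨hs.1, hs.2.trans ht.2⟩,
      fun hi => eqOn_of_integral_eq hb hz' ((hT.mono Icc_subset_Ici_self).add hdc) hi⟩
  have hmi : MildOn l₀ R₀ b (fun s => (z s : Z)) g ↔ MildOn l₀ R₀ b z₁ g₁ :=
    ⟨fun hm => hm.congr hzz.symm hgg.symm, fun hm => hm.congr hzz hgg⟩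
  rw [hI, hmi, h.integrated.mildOn_iff h₀ hb hz₁ hg₁]
  refine forall₂_congr fun t ht => ?_
  have hsub : Icc 0 t ⊆ Icc 0 b := Icc_subset_Icc_right ht.2
  rw [integral_congr_Icc ht.1 (hzz.mono hsub), intervalIntegral.integral_add
    (hT.intervalIntegrable_of_Ici le_rfl ht.1), ← hdi t ht, ← h.apply_closure _ ht.1, hzz h0,
    max_eq_left ht.1, opConv_max_zero ht.1 (hgg.mono hsub).symm]
  exact (hdc.mono (by rw [uIcc_of_le ht.1]; exact hsub)).intervalIntegrable

end MR

/-! ### The linear inhomogeneous equation along an orbit -/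

section MR

set_option linter.unusedSectionVars false

variable {Z : Type u} [NormedAddCommGroup Z] [NormedSpace ℝ Z] [CompleteSpace Z]
  {A : Z →ₗ.[ℝ] Z} {T₀ : ℝ → DomClosure A →L[ℝ] DomClosure A} {μ : ℝ} {S : ℝ → Z →L[ℝ] Z}
  {δ : ℝ → ℝ}

/-- `diamond` depends on its horizon through the one-sided derivative at the right end. Horizons
therefore have to be compared when intervals are shortened. -/
theorem IsMROperator.diamond_eqOn (h : IsMROperator A T₀ μ S δ) {b b' : ℝ} (hb' : 0 < b')
    (hbb : b' ≤ b) {g : ℝ → Z} (hg : ContinuousOn g (Icc 0 b)) :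
    EqOn (diamond b' S g) (diamond b S g) (Icc 0 b') := by
  obtain ⟨hc, hi, -⟩ := h.diamond_spec (hb'.trans_le hbb) hg
  exact diamond_eq_of_integral_eq hb' (hc.mono (Icc_subset_Icc_right hbb)) fun t ht =>
    hi t ⟨ht.1, ht.2.trans hbb⟩

theorem IsMROperator.tendsto_max (h : IsMROperator A T₀ μ S δ) :
    Tendsto (fun t => max (δ t) 0) (𝓝[>] 0) (𝓝 0) := by
  simpa using h.tendsto.max (tendsto_const_nhds (x := (0 : ℝ)))

/-- On shrinking horizons b' the value at 0 is bounded by a constant times `max (δ b') 0`, which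
tends to 0. -/
theorem IsMROperator.diamond_at_zero (h : IsMROperator A T₀ μ S δ) {b : ℝ} (hb : 0 ≤ b)
    {g : ℝ → Z} (hg : ContinuousOn g (Icc 0 b)) : diamond b S g 0 = 0 := by
  rcases hb.eq_or_lt with rfl | hb
  · exact diamond_zero g 0
  obtain ⟨C, hC⟩ := isCompact_Icc.exists_bound_of_continuousOn hg
  rw [← norm_le_zero_iff]
  have h1 : Tendsto (fun t => max (δ t) 0 * C) (𝓝[>] 0) (𝓝 0) := by
    simpa using h.tendsto_max.mul_const C
  refine ge_of_tendsto h1 ?_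
  filter_upwards [Ioc_mem_nhdsGT hb] with b' hb'
  rw [← h.diamond_eqOn hb'.1 hb'.2 hg ⟨le_rfl, hb'.1.le⟩]
  have hsub : Icc 0 b' ⊆ Icc 0 b := Icc_subset_Icc_right hb'.2
  exact (h.diamond_spec hb'.1 (hg.mono hsub)).2.2 C (fun s hs => hC s (hsub hs)) 0
    ⟨le_rfl, hb'.1.le⟩

theorem MildOn.sub {l₀ : ℝ} {R₀ : Z →L[ℝ] Z} {b : ℝ} {z z' g g' : ℝ → Z}
    (h : MildOn l₀ R₀ b z g) (h' : MildOn l₀ R₀ b z' g') (hz : ContinuousOn z (Icc 0 b))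
    (hz' : ContinuousOn z' (Icc 0 b)) (hg : ContinuousOn g (Icc 0 b))
    (hg' : ContinuousOn g' (Icc 0 b)) :
    MildOn l₀ R₀ b (fun s => z s - z' s) fun s => g s - g' s := by
  intro t ht
  have hI : ∀ {G : ℝ → Z}, ContinuousOn G (Icc 0 b) → IntervalIntegrable G volume 0 t :=
    fun {G} hG => (hG.mono (by
      rw [uIcc_of_le ht.1]; exact Icc_subset_Icc_right ht.2)).intervalIntegrable
  rw [intervalIntegral.integral_sub (hI hz) (hI hz'), intervalIntegral.integral_sub (hI hg)
    (hI hg')]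
  nth_rw 1 [h t ht, h' t ht]
  rw [← map_sub]
  congr 1
  simp only [smul_sub]
  abel

end MR

section Orbits

variable {M : Type v} [TopologicalSpace M] (φ : Flow ℝ≥0 M)

theorem orb_zero (ω : M) : orb φ 0 ω = ω := by simp [orb]

theorem orb_orb {s t : ℝ} (hs : 0 ≤ s) (ht : 0 ≤ t) (ω : M) :
    orb φ t (orb φ s ω) = orb φ (s + t) ω := by
  rw [orb, orb, orb, Real.toNNReal_add hs ht, add_comm, φ.map_add]

theorem continuous_orb (ω : M) : Continuous fun t => orb φ t ω :=
  φ.continuous continuous_real_toNNReal continuous_const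

end Orbits

/-! ### Variation of constants solutions along an orbit. -/

namespace DichotomySystem

set_option linter.unusedSectionVars false

variable {M : Type v} [TopologicalSpace M] {φ : Flow ℝ≥0 M} {Z : Type u} [NormedAddCommGroup Z]
  [NormedSpace ℝ Z] [CompleteSpace Z] {C₁ : ℝ} {μs μu : M → ℝ}
  (𝒮 : DichotomySystem φ Z C₁ μs μu)

theorem continuousOn_L {ω : M} {z : ℝ → 𝒮.E} {s : Set ℝ} (hz : ContinuousOn z s) :
    ContinuousOn (fun r => 𝒮.L (orb φ r ω) (z r)) s :=
  𝒮.isPert.continuous.comp_continuousOn ((continuous_orb φ ω).continuousOn.prodMk hz)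

theorem continuousOn_L_add {ω : M} {z : ℝ → 𝒮.E} {g : ℝ → Z} {s : Set ℝ}
    (hz : ContinuousOn z s) (hg : ContinuousOn g s) :
    ContinuousOn (fun r => 𝒮.L (orb φ r ω) (z r) + g r) s :=
  (𝒮.continuousOn_L hz).add hg

/-- `z` is a continuous solution of `ż = A z + L(tω) z + g` on `[0, b]`, in the sense of the
variation of constants formula. -/
structure IsVar (b : ℝ) (ω : M) (z : ℝ → 𝒮.E) (g : ℝ → Z) : Prop where
  cont : ContinuousOn z (Icc 0 b)
  contg : ContinuousOn g (Icc 0 b)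
  eq : ∀ t ∈ Icc 0 b, (z t : Z) =
    𝒮.T₀ t (z 0) + diamond b 𝒮.S (fun s => 𝒮.L (orb φ s ω) (z s) + g s) t

variable {𝒮} {b : ℝ} {ω : M} {z z' : ℝ → 𝒮.E} {g g' : ℝ → Z}

theorem IsVar.coe_cont (h : 𝒮.IsVar b ω z g) : ContinuousOn (fun t => (z t : Z)) (Icc 0 b) :=
  continuous_subtype_val.comp_continuousOn h.cont

theorem isVar_iff_mildOn {l₀ : ℝ} {R₀ : Z →L[ℝ] Z} (h₀ : IsResolventAt 𝒮.A l₀ R₀)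
    (hz : ContinuousOn z (Icc 0 b)) (hg : ContinuousOn g (Icc 0 b)) :
    𝒮.IsVar b ω z g ↔
      MildOn l₀ R₀ b (fun s => (z s : Z)) fun s => 𝒮.L (orb φ s ω) (z s) + g s := by
  rw [← 𝒮.isMR.variation_iff_mildOn h₀ hz (𝒮.continuousOn_L_add hz hg)]
  exact ⟨fun h => h.eq, fun h => ⟨hz, hg, h⟩⟩

theorem IsVar.congr (h : 𝒮.IsVar b ω z g) (hz : EqOn z z' (Icc 0 b)) (hg : EqOn g g' (Icc 0 b)) :
    𝒮.IsVar b ω z' g' := by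
  obtain ⟨l₀, R₀, h₀⟩ := 𝒮.isMR.resolvent
  rw [isVar_iff_mildOn h₀ (h.cont.congr hz.symm) (h.contg.congr hg.symm)]
  refine ((isVar_iff_mildOn h₀ h.cont h.contg).1 h).congr (fun s hs => ?_) fun s hs => ?_
  · simp only [hz hs]
  · simp only [hz hs, hg hs]

theorem IsVar.restrict (h : 𝒮.IsVar b ω z g) {b' : ℝ} (hb' : b' ≤ b) : 𝒮.IsVar b' ω z g := by
  have hsub : Icc 0 b' ⊆ Icc 0 b := Icc_subset_Icc_right hb'
  obtain ⟨l₀, R₀, h₀⟩ := 𝒮.isMR.resolvent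
  rw [isVar_iff_mildOn h₀ (h.cont.mono hsub) (h.contg.mono hsub)]
  exact fun t ht => (isVar_iff_mildOn h₀ h.cont h.contg).1 h t (hsub ht)

theorem IsVar.shift (h : 𝒮.IsVar b ω z g) {r : ℝ} (hr : r ∈ Icc 0 b) :
    𝒮.IsVar (b - r) (orb φ r ω) (fun s => z (r + s)) fun s => g (r + s) := by
  have hmap : MapsTo (fun s => r + s) (Icc 0 (b - r)) (Icc 0 b) := fun s hs =>
    ⟨add_nonneg hr.1 hs.1, by linarith [hs.2]⟩
  have hadd : ContinuousOn (fun s => r + s) (Icc 0 (b - r)) := by fun_prop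
  obtain ⟨l₀, R₀, h₀⟩ := 𝒮.isMR.resolvent
  refine (isVar_iff_mildOn h₀ (h.cont.comp hadd hmap) (h.contg.comp hadd hmap)).2 ?_
  refine (((isVar_iff_mildOn h₀ h.cont h.contg).1 h).shift h.coe_cont
    (𝒮.continuousOn_L_add h.cont h.contg) hr).congr (fun _ _ => rfl) fun s hs => ?_
  simp only [orb_orb φ hr.1 hs.1, Function.comp_apply]

theorem IsVar.sub (h : 𝒮.IsVar b ω z g) (h' : 𝒮.IsVar b ω z' g') :
    𝒮.IsVar b ω (fun s => z s - z' s) fun s => g s - g' s := by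
  obtain ⟨l₀, R₀, h₀⟩ := 𝒮.isMR.resolvent
  refine (isVar_iff_mildOn h₀ (h.cont.sub h'.cont) (h.contg.sub h'.contg)).2 ?_
  refine (((isVar_iff_mildOn h₀ h.cont h.contg).1 h).sub
    ((isVar_iff_mildOn h₀ h'.cont h'.contg).1 h') h.coe_cont h'.coe_cont
    (𝒮.continuousOn_L_add h.cont h.contg) (𝒮.continuousOn_L_add h'.cont h'.contg)).congr
    (fun s hs => ?_) fun s hs => ?_
  · simp
  · simp only [Pi.sub_apply, map_sub]; abel

/-- Here δ₁ arises: at a maximum point s of the norm, |z(s)| ≤ δ(τ|z(s)| + m), and τδ < 1 allows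
this to be solved for |z(s)|. -/
theorem IsVar.norm_le (h : 𝒮.IsVar b ω z g) (hb : 0 < b) (h0 : z 0 = 0) {τ m : ℝ}
    (hτ : ∀ s ∈ Icc 0 b, ‖𝒮.L (orb φ s ω)‖ ≤ τ) (hm : ∀ s ∈ Icc 0 b, ‖g s‖ ≤ m)
    (hlt : τ * max (𝒮.δ b) 0 < 1) {t : ℝ} (ht : t ∈ Icc 0 b) :
    ‖z t‖ ≤ max (𝒮.δ b) 0 / (1 - τ * max (𝒮.δ b) 0) * m := by
  obtain ⟨s, hs, hmax⟩ := isCompact_Icc.exists_isMaxOn ⟨0, left_mem_Icc.2 hb.le⟩ h.cont.norm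
  have h1 := (𝒮.isMR.diamond_spec hb (𝒮.continuousOn_L_add (ω := ω) h.cont h.contg)).2.2
    (τ * ‖z s‖ + m) (fun r hr => (norm_add_le _ _).trans (add_le_add
      ((𝒮.L _).le_of_opNorm_le_of_le (hτ r hr) (hmax hr)) (hm r hr))) s hs
  have h2 := h.eq s hs
  simp only [h0, map_zero, ZeroMemClass.coe_zero, zero_add] at h2
  have h3 : ‖z s‖ ≤ max (𝒮.δ b) 0 * (τ * ‖z s‖ + m) := by
    rw [← h2] at h1; exact h1
  refine (hmax ht).trans ?_
  simp only
  rw [div_mul_eq_mul_div, le_div_iff₀ (by linarith)]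
  linarith

theorem norm_L_le (𝒮 : DichotomySystem φ Z C₁ μs μu) (ω : M) (s : ℝ) :
    ‖𝒮.L (orb φ s ω)‖ ≤ 𝒮.tau ω := by
  have h1 : ‖𝒮.L (orb φ s ω)‖ₑ ≤ supOpNorm φ 𝒮.L ω :=
    le_iSup (fun t : ℝ≥0 => ‖𝒮.L (φ t ω)‖ₑ) s.toNNReal
  have h2 := ENNReal.toReal_mono (𝒮.isPert.bounded.1 ω).ne h1
  simpa [tau] using h2

theorem tau_nonneg (𝒮 : DichotomySystem φ Z C₁ μs μu) (ω : M) : 0 ≤ 𝒮.tau ω :=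
  ENNReal.toReal_nonneg

/-- Uniqueness for the linear equation. On steps of a length d with τδ < 1 the previous estimate
with zero forcing gives 0, and the steps are chained. -/
theorem IsVar.eq_zero (h : 𝒮.IsVar b ω z 0) (h0 : z 0 = 0) : ∀ t ∈ Icc 0 b, z t = 0 := by
  obtain ⟨d, hd, hlt⟩ : ∃ d > 0, ∀ t, 0 < t → t ≤ d → 𝒮.tau ω * max (𝒮.δ t) 0 < 1 := by
    have h1 : Tendsto (fun t => 𝒮.tau ω * max (𝒮.δ t) 0) (𝓝[>] 0) (𝓝 0) := by
      simpa using 𝒮.isMR.tendsto_max.const_mul (𝒮.tau ω)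
    have h2 := h1.eventually_lt_const one_pos
    obtain ⟨d, hd, hd'⟩ := mem_nhdsGT_iff_exists_Ioc_subset.1 h2
    exact ⟨d, hd, fun t ht ht' => hd' ⟨ht, ht'⟩⟩
  have key : ∀ n : ℕ, ∀ t ∈ Icc 0 b, t ≤ n * d → z t = 0 := by
    intro n
    induction n with
    | zero =>
      intro t ht htn
      have : t = 0 := le_antisymm (by simpa using htn) ht.1
      rw [this, h0]
    | succ n ih =>
      intro t ht htn
      rcases le_or_gt t (n * d) with hle | hlt'
      · exact ih t ht hle
      have hr : (n * d : ℝ) ∈ Icc 0 b := ⟨by positivity, hlt'.le.trans ht.2⟩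
      have h1 := (h.shift hr).restrict (b' := t - n * d) (by linarith [ht.2])
      have h2 := h1.norm_le (sub_pos.2 hlt') (by simpa using ih _ hr le_rfl)
        (m := 0) (fun s hs => by rw [orb_orb φ hr.1 hs.1]; exact 𝒮.norm_L_le ω _)
        (fun s hs => by simp) (hlt _ (sub_pos.2 hlt') (by push_cast at htn; linarith))
        (right_mem_Icc.2 (sub_pos.2 hlt').le)
      rw [mul_zero, norm_le_zero_iff, add_sub_cancel] at h2
      exact h2
  intro t ht
  obtain ⟨n, hn⟩ := exists_nat_ge (t / d)
  exact key n t ht ((div_le_iff₀ hd).1 hn)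

theorem isVar_cocycle (𝒮 : DichotomySystem φ Z C₁ μs μu) {b : ℝ} (ω : M) (x : 𝒮.E) :
    𝒮.IsVar b ω (fun t => 𝒮.T t ω x) 0 ∧ 𝒮.T 0 ω x = x := by
  have hc : ContinuousOn (fun t => 𝒮.T t ω x) (Icc 0 b) :=
    (𝒮.isCocycle.continuous x).comp (f := fun t : ℝ => (t, ω))
      (Continuous.continuousOn (by fun_prop)) fun t ht => ⟨ht.1, mem_univ _⟩
  have h0 : 𝒮.T 0 ω x = x := by
    refine Subtype.ext ?_
    rw [𝒮.isCocycle.variation ω x 0 le_rfl, diamond_zero, add_zero, 𝒮.isMR.semigroup_zero]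
  refine ⟨⟨hc, continuousOn_const, fun t ht => ?_⟩, h0⟩
  simp only [Pi.zero_apply, add_zero]
  rw [𝒮.isCocycle.variation ω x t ht.1, h0]
  congr 1
  have hL := 𝒮.continuousOn_L (ω := ω) hc
  -- The cocycle equation uses the horizon t itself, whereas `IsVar` needs the fixed horizon b.
  rcases ht.1.eq_or_lt with rfl | ht0
  · rw [diamond_zero, 𝒮.isMR.diamond_at_zero ht.2 hL]
  · exact 𝒮.isMR.diamond_eqOn ht0 ht.2 hL ⟨ht.1, le_rfl⟩

theorem isVar_forcedResponse {v : ℝ → 𝒮.E} (hb : 0 ≤ b) (hg : ContinuousOn g (Icc 0 b))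
    (h : 𝒮.IsForcedResponse b ω g v) : 𝒮.IsVar b ω v g ∧ v 0 = 0 := by
  have h0 : v 0 = 0 := by
    refine Subtype.ext ?_
    rw [h.2 0 ⟨le_rfl, hb⟩, 𝒮.isMR.diamond_at_zero hb (𝒮.continuousOn_L_add h.1 hg)]
    rfl
  refine ⟨⟨h.1, hg, fun t ht => ?_⟩, h0⟩
  rw [h0, map_zero, ZeroMemClass.coe_zero, zero_add]
  exact h.2 t ht

theorem IsVar.eq_add (h : 𝒮.IsVar b ω z g) {r : ℝ} (hr : r ∈ Icc 0 b) {w : ℝ → 𝒮.E}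
    (hw : 𝒮.IsVar (b - r) (orb φ r ω) w fun s => g (r + s)) (hw0 : w 0 = 0) {s : ℝ}
    (hs : s ∈ Icc 0 (b - r)) : z (r + s) = 𝒮.T s (orb φ r ω) (z r) + w s := by
  obtain ⟨hT, hT0⟩ := 𝒮.isVar_cocycle (b := b - r) (orb φ r ω) (z r)
  have h1 := ((h.shift hr).sub hT).sub hw
  have h2 := (h1.congr (fun _ _ => rfl) (g' := 0) fun s _ => by simp).eq_zero
    (by simp [hT0, hw0]) s hs
  rw [sub_sub, sub_eq_zero] at h2
  exact h2

/-- The cocycle law is not assumed. It follows from uniqueness, applied to the shifted solution. -/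
theorem cocycle_add (𝒮 : DichotomySystem φ Z C₁ μs μu) (ω : M) {r s : ℝ} (hr : 0 ≤ r)
    (hs : 0 ≤ s) (x : 𝒮.E) : 𝒮.T s (orb φ r ω) (𝒮.T r ω x) = 𝒮.T (r + s) ω x := by
  have h1 := (𝒮.isVar_cocycle (b := r + s) ω x).1
  have h2 := h1.eq_add (r := r) ⟨hr, by linarith⟩ (w := 0) (s := s) ?_ rfl ⟨hs, by linarith⟩
  · simpa using h2.symm
  · have h3 := (𝒮.isVar_cocycle (b := r + s - r) (orb φ r ω) 0).1
    exact h3.congr (fun t _ => by simp) fun _ _ => rfl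

/-- The remainder of a solution after subtraction of the homogeneous one. -/
theorem IsVar.remainder (h : 𝒮.IsVar b ω z g) {r : ℝ} (hr : r ∈ Icc 0 b) :
    𝒮.IsVar (b - r) (orb φ r ω) (fun s => z (r + s) - 𝒮.T s (orb φ r ω) (z r))
      (fun s => g (r + s)) ∧ z (r + 0) - 𝒮.T 0 (orb φ r ω) (z r) = 0 := by
  obtain ⟨hT, hT0⟩ := 𝒮.isVar_cocycle (b := b - r) (orb φ r ω) (z r)
  exact ⟨((h.shift hr).sub hT).congr (fun _ _ => rfl) fun s _ => by simp, by simp [hT0]⟩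

/-! ### Projections -/

theorem P_T (𝒮 : DichotomySystem φ Z C₁ μs μu) {t : ℝ} (ht : 0 ≤ t) (ω : M) (x : 𝒮.E) :
    𝒮.P (orb φ t ω) (𝒮.T t ω x) = 𝒮.T t ω (𝒮.P ω x) := by
  have h := 𝒮.dichotomy
  have hX : 𝒮.P (orb φ t ω) (𝒮.T t ω (𝒮.P ω x)) = 𝒮.T t ω (𝒮.P ω x) := by
    obtain ⟨y, hy⟩ := h.mapsTo_X ω t ht (LinearMap.mem_range_self _ x : 𝒮.P ω x ∈ (𝒮.P ω).range)
    have hy' : 𝒮.P (orb φ t ω) y = 𝒮.T t ω (𝒮.P ω x) := hy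
    rw [← hy', h.proj]
  have hY : 𝒮.P (orb φ t ω) (𝒮.T t ω (x - 𝒮.P ω x)) = 0 := by
    refine (h.bijOn_Y ω t ht).mapsTo (x := x - 𝒮.P ω x) ?_
    change 𝒮.P ω (x - 𝒮.P ω x) = 0
    rw [map_sub, h.proj, sub_self]
  rw [map_sub, map_sub, hX, sub_eq_zero] at hY
  exact hY

theorem Pc_apply (𝒮 : DichotomySystem φ Z C₁ μs μu) (ω : M) (x : 𝒮.E) :
    𝒮.Pc ω x = x - 𝒮.P ω x := rfl

theorem P_add_Pc (𝒮 : DichotomySystem φ Z C₁ μs μu) (ω : M) (x : 𝒮.E) :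
    𝒮.P ω x + 𝒮.Pc ω x = x := by rw [Pc_apply]; abel

theorem Pc_T (𝒮 : DichotomySystem φ Z C₁ μs μu) {t : ℝ} (ht : 0 ≤ t) (ω : M) (x : 𝒮.E) :
    𝒮.Pc (orb φ t ω) (𝒮.T t ω x) = 𝒮.T t ω (𝒮.Pc ω x) := by
  rw [Pc_apply, Pc_apply, 𝒮.P_T ht, map_sub]

theorem P_mem (𝒮 : DichotomySystem φ Z C₁ μs μu) (ω : M) (x : 𝒮.E) : 𝒮.P ω x ∈ (𝒮.P ω).range :=
  LinearMap.mem_range_self _ x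

theorem Pc_mem (𝒮 : DichotomySystem φ Z C₁ μs μu) (ω : M) (x : 𝒮.E) :
    𝒮.Pc ω x ∈ (𝒮.P ω).ker := by
  change 𝒮.P ω (x - 𝒮.P ω x) = 0
  rw [map_sub, 𝒮.dichotomy.proj, sub_self]

theorem T_Shat (𝒮 : DichotomySystem φ Z C₁ μs μu) {t : ℝ} (ht : 0 ≤ t) (ω : M) (x : 𝒮.E) :
    𝒮.T t ω (𝒮.Shat t ω (𝒮.Pc (orb φ t ω) x)) = 𝒮.Pc (orb φ t ω) x := by
  obtain ⟨y, hy, hy'⟩ := (𝒮.dichotomy.bijOn_Y ω t ht).surjOn (𝒮.Pc_mem (orb φ t ω) x)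
  exact Function.invFunOn_eq ⟨y, hy, hy'⟩

theorem continuousOn_f {f : M → 𝒮.E → Z} (hf : 𝒮.IsNonlinearity f) {s : Set ℝ}
    (hz : ContinuousOn z s) : ContinuousOn (fun r => f (orb φ r ω) (z r)) s :=
  hf.continuous.comp_continuousOn ((continuous_orb φ ω).continuousOn.prodMk hz)

/-- The backward formulas at times t and 0 both refer to the unstable component of z(b). Pushing
them forward to time b removes the inverses and eliminates that component. Injectivity of the
cocycle on Y then gives the unstable half of z(t) = T(t, ω)z(0) + v₀(t). The stable half is the
first dichotomy equation. -/
theorem isVar_of_solvesDichotomyEq {f : M → 𝒮.E → Z} (hf : 𝒮.IsNonlinearity f) (hb : 0 ≤ b)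
    (h : 𝒮.SolvesDichotomyEq f b ω z) : 𝒮.IsVar b ω z fun s => f (orb φ s ω) (z s) := by
  obtain ⟨hz, v, hv, he⟩ := h
  have hfz : ContinuousOn (fun s => f (orb φ s ω) (z s)) (Icc 0 b) := continuousOn_f hf hz
  have hvar : ∀ r ∈ Icc 0 b, 𝒮.IsVar (b - r) (orb φ r ω) (v r)
      (fun s => f (orb φ (r + s) ω) (z (r + s))) ∧ v r 0 = 0 := by
    intro r hr
    have hmap : MapsTo (fun s => r + s) (Icc 0 (b - r)) (Icc 0 b) := fun s hs =>
      ⟨add_nonneg hr.1 hs.1, by linarith [hs.2]⟩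
    have hadd : ContinuousOn (fun s => r + s) (Icc 0 (b - r)) := by fun_prop
    obtain ⟨h1, h2⟩ := isVar_forcedResponse (sub_nonneg.2 hr.2)
      (continuousOn_f hf (hz.comp hadd hmap)) (hv r hr)
    exact ⟨h1.congr (fun _ _ => rfl) fun s hs => by simp [orb_orb φ hr.1 hs.1], h2⟩
  have h0 : (0 : ℝ) ∈ Icc 0 b := ⟨le_rfl, hb⟩
  obtain ⟨hv0, hv00⟩ := hvar 0 h0
  simp only [sub_zero, orb_zero, zero_add] at hv0
  have key : ∀ t ∈ Icc 0 b, z t = 𝒮.T t ω (z 0) + v 0 t := by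
    intro t ht
    obtain ⟨hvt, hvt0⟩ := hvar t ht
    have hbt : 0 ≤ b - t := sub_nonneg.2 ht.2
    have horb : orb φ (b - t) (orb φ t ω) = orb φ b ω := by
      rw [orb_orb φ ht.1 hbt, add_sub_cancel]
    have e0 := congrArg (𝒮.T b ω) (he 0 h0).2
    simp only [sub_zero, orb_zero, map_sub] at e0
    rw [𝒮.T_Shat hb, 𝒮.T_Shat hb] at e0
    have e1 := congrArg (𝒮.T (b - t) (orb φ t ω)) (he t ht).2
    rw [map_sub, ← horb, 𝒮.T_Shat hbt, 𝒮.T_Shat hbt, horb] at e1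
    -- The response started at 0 splits at time t into a transported part and the response started
    -- at t, which is what the two backward formulas differ by.
    have e2 := hv0.eq_add ht hvt hvt0 (right_mem_Icc.2 hbt)
    rw [add_sub_cancel] at e2
    have e3 : 𝒮.T (b - t) (orb φ t ω) (𝒮.Pc (orb φ t ω) (z t)) =
        𝒮.T (b - t) (orb φ t ω) (𝒮.Pc (orb φ t ω) (𝒮.T t ω (z 0) + v 0 t)) := by
      rw [e1, map_add, map_add, ← 𝒮.Pc_T hbt, ← 𝒮.Pc_T hbt, 𝒮.cocycle_add ω ht.1 hbt,
        add_sub_cancel, horb, 𝒮.Pc_T hb, e0, e2, map_add]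
      abel
    have e4 := (𝒮.dichotomy.bijOn_Y (orb φ t ω) (b - t) hbt).injOn (𝒮.Pc_mem _ _)
      (𝒮.Pc_mem _ _) e3
    have e5 := (he t ht).1
    rw [← 𝒮.P_T ht.1, ← map_add] at e5
    rw [← 𝒮.P_add_Pc (orb φ t ω) (z t), e4, e5, 𝒮.P_add_Pc]
  -- The homogeneous solution is added by subtracting the one that starts at -z(0).
  have h1 := (hv0.sub ((𝒮.isVar_cocycle (b := b) ω (-z 0)).1))
  refine h1.congr (fun t ht => ?_) fun t _ => by simp
  simp only [map_neg, sub_neg_eq_add, key t ht]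
  abel

theorem isVar_of_isMildSolution {f : M → 𝒮.E → Z} (hf : 𝒮.IsNonlinearity f)
    (h : 𝒮.IsMildSolution f b ω z) : 𝒮.IsVar b ω z fun s => f (orb φ s ω) (z s) := by
  obtain ⟨l₀, R₀, h₀⟩ := 𝒮.isMR.resolvent
  rw [isVar_iff_mildOn h₀ h.1 (continuousOn_f hf h.1)]
  intro t ht
  obtain ⟨hd, he⟩ := h.2 t ht
  refine h₀.eq_apply_iff.2 ⟨hd, ?_⟩
  change _ = (z t : Z) - z 0 - _
  rw [he]; abel

end DichotomySystem

/-! ### Cone estimates for pairs of scalar functions -/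

/-- Two nonnegative continuous functions on `[0, b]`; up to an error of size `κ(t) sup (p + q)` on
intervals of length `t ≤ h`, the first one grows at most like `e^{at}` and the second one at least
like `e^{ut}`. -/
structure ConePair (a u : ℝ) (κ : ℝ → ℝ) (h b : ℝ) (p q : ℝ → ℝ) : Prop where
  contp : ContinuousOn p (Icc 0 b)
  contq : ContinuousOn q (Icc 0 b)
  p_nonneg : ∀ t, 0 ≤ p t
  q_nonneg : ∀ t, 0 ≤ q t
  step_p : ∀ t₁ t₂, 0 ≤ t₁ → t₁ < t₂ → t₂ ≤ b → t₂ - t₁ ≤ h → ∀ m,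
    (∀ s ∈ Icc t₁ t₂, p s + q s ≤ m) →
      p t₂ ≤ Real.exp (a * (t₂ - t₁)) * p t₁ + κ (t₂ - t₁) * m
  step_q : ∀ t₁ t₂, 0 ≤ t₁ → t₁ < t₂ → t₂ ≤ b → t₂ - t₁ ≤ h → ∀ m,
    (∀ s ∈ Icc t₁ t₂, p s + q s ≤ m) →
      q t₁ ≤ Real.exp (-u * (t₂ - t₁)) * q t₂ + κ (t₂ - t₁) * m

namespace ConePair

variable {a u h b : ℝ} {κ : ℝ → ℝ} {p q : ℝ → ℝ}

/-- Time reversal. -/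
theorem reverse (H : ConePair a u κ h b p q) :
    ConePair (-u) (-a) κ h b (fun t => q (b - t)) fun t => p (b - t) := by
  have hmap : MapsTo (fun t => b - t) (Icc 0 b) (Icc 0 b) := fun t ht =>
    ⟨by linarith [ht.2], by linarith [ht.1]⟩
  have hsub : ContinuousOn (fun t => b - t) (Icc 0 b) := by fun_prop
  refine ⟨H.contq.comp hsub hmap, H.contp.comp hsub hmap, fun t => H.q_nonneg _,
    fun t => H.p_nonneg _, fun t₁ t₂ h1 h12 h2 hh m hm => ?_, fun t₁ t₂ h1 h12 h2 hh m hm => ?_⟩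
  · have := H.step_q (b - t₂) (b - t₁) (by linarith) (by linarith) (by linarith) (by linarith) m
      fun s hs => by
        have := hm (b - s) ⟨by linarith [hs.2], by linarith [hs.1]⟩
        rw [sub_sub_cancel] at this
        linarith
    rwa [sub_sub_sub_cancel_left] at this
  · have := H.step_p (b - t₂) (b - t₁) (by linarith) (by linarith) (by linarith) (by linarith) m
      fun s hs => by
        have := hm (b - s) ⟨by linarith [hs.2], by linarith [hs.1]⟩
        rw [sub_sub_cancel] at this
        linarith
    rwa [sub_sub_sub_cancel_left, ← neg_neg a] at this

theorem mono {κ' : ℝ → ℝ} {h' : ℝ} (H : ConePair a u κ h b p q) (hh : h' ≤ h)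
    (hκ : ∀ t, 0 < t → t ≤ h' → κ t ≤ κ' t) : ConePair a u κ' h' b p q := by
  have hm0 : ∀ {t₁ t₂ m : ℝ}, t₁ < t₂ → (∀ s ∈ Icc t₁ t₂, p s + q s ≤ m) → 0 ≤ m :=
    fun h12 hm => (add_nonneg (H.p_nonneg _) (H.q_nonneg _)).trans (hm _ (left_mem_Icc.2 h12.le))
  refine ⟨H.contp, H.contq, H.p_nonneg, H.q_nonneg, fun t₁ t₂ h1 h12 h2 hd m hm => ?_,
    fun t₁ t₂ h1 h12 h2 hd m hm => ?_⟩
  · have h3 := H.step_p t₁ t₂ h1 h12 h2 (hd.trans hh) m hm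
    have h4 := mul_le_mul_of_nonneg_right (hκ _ (sub_pos.2 h12) hd) (hm0 h12 hm)
    linarith
  · have h3 := H.step_q t₁ t₂ h1 h12 h2 (hd.trans hh) m hm
    have h4 := mul_le_mul_of_nonneg_right (hκ _ (sub_pos.2 h12) hd) (hm0 h12 hm)
    linarith

/-! #### Errors of first order -/

/-- In the limit the step inequalities read p' ≤ ap + c(p + q) and q' ≥ uq - c(p + q), for right
Dini derivatives. The weight θ is 1 for the comparison of p with rq and 0 for the growth of q alone.
-/
theorem eventually_slope_lt (H : ConePair a u κ h b p q) (hh : 0 < h) {c : ℝ}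
    (hκ : Tendsto (fun t => κ t / t) (𝓝[>] 0) (𝓝 c)) {r : ℝ → ℝ} {r' x θ : ℝ}
    (hr : HasDerivAt r r' x) (hr0 : ∀ t, x ≤ t → 0 ≤ r t) (hθ : 0 ≤ θ) (hx : x ∈ Ico 0 b) {ρ : ℝ}
    (hρ : θ * (a * p x + c * (p x + q x)) - r' * q x - r x * (u * q x - c * (p x + q x)) < ρ) :
    ∀ᶠ z in 𝓝[>] x, slope (fun t => θ * p t - r t * q t) x z < ρ := by
  -- A level slightly above p + q at x bounds p + q on short intervals to the right and still leaves
  -- the strict inequality.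
  obtain ⟨m, hm, hmρ⟩ : ∃ m, p x + q x < m ∧
      θ * (a * p x + c * m) - r' * q x - r x * (u * q x - c * m) < ρ := by
    have h1 : Tendsto (fun m => θ * (a * p x + c * m) - r' * q x - r x * (u * q x - c * m))
        (𝓝[>] (p x + q x)) (𝓝 (θ * (a * p x + c * (p x + q x)) - r' * q x -
          r x * (u * q x - c * (p x + q x)))) :=
      tendsto_nhdsWithin_of_tendsto_nhds (Continuous.tendsto (by fun_prop) _)
    obtain ⟨m, hm⟩ := ((h1.eventually_lt_const hρ).and self_mem_nhdsWithin).exists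
    exact ⟨m, hm.2, hm.1⟩
  have hnear : ∀ᶠ z in 𝓝[>] x, ∀ s ∈ Icc x z, p s + q s ≤ m := by
    have h1 : ∀ᶠ s in 𝓝[≥] x, p s + q s < m := by
      have h2 : ContinuousWithinAt (fun s => p s + q s) (Icc 0 b) x :=
        (H.contp.add H.contq) x ⟨hx.1, hx.2.le⟩
      exact nhdsWithin_le_of_mem (Icc_mem_nhdsGE_of_mem hx) (h2.eventually_lt_const hm)
    obtain ⟨y, hy, hy'⟩ := mem_nhdsGE_iff_exists_Ico_subset.1 h1
    filter_upwards [Ioo_mem_nhdsGT hy] with z hz s hs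
    exact (hy' ⟨hs.1, hs.2.trans_lt hz.2⟩).le
  have hexp : ∀ w : ℝ, Tendsto (slope (fun z => Real.exp (w * (z - x))) x) (𝓝[>] x) (𝓝 w) := by
    intro w
    have h1 : HasDerivAt (fun z => Real.exp (w * (z - x))) w x := by
      have h2 := (((hasDerivAt_id x).sub_const x).const_mul w).exp
      simpa using h2
    exact (hasDerivAt_iff_tendsto_slope.1 h1).mono_left (nhdsWithin_mono _ fun z hz => ne_of_gt hz)
  have hshift : Tendsto (fun z => z - x) (𝓝[>] x) (𝓝[>] 0) := by
    refine tendsto_nhdsWithin_iff.2 ⟨?_, ?_⟩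
    · exact tendsto_nhdsWithin_of_tendsto_nhds (by simpa using (continuous_sub_right x).tendsto x)
    · filter_upwards [self_mem_nhdsWithin] with z hz using sub_pos.2 (mem_Ioi.1 hz)
  have hrs : Tendsto (slope r x) (𝓝[>] x) (𝓝 r') :=
    (hasDerivAt_iff_tendsto_slope.1 hr).mono_left (nhdsWithin_mono _ fun z hz => ne_of_gt hz)
  have hrc : Tendsto r (𝓝[>] x) (𝓝 (r x)) :=
    tendsto_nhdsWithin_of_tendsto_nhds hr.continuousAt
  have hexpc : Tendsto (fun z => Real.exp (u * (z - x))) (𝓝[>] x) (𝓝 1) := by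
    refine tendsto_nhdsWithin_of_tendsto_nhds ?_
    have : Continuous fun z => Real.exp (u * (z - x)) := by fun_prop
    simpa using this.tendsto x
  have hΨ : Tendsto (fun z => θ * (slope (fun z => Real.exp (a * (z - x))) x z * p x +
      κ (z - x) / (z - x) * m) - slope r x z * q x -
      r z * (slope (fun z => Real.exp (u * (z - x))) x z * q x -
        Real.exp (u * (z - x)) * (κ (z - x) / (z - x)) * m)) (𝓝[>] x)
      (𝓝 (θ * (a * p x + c * m) - r' * q x - r x * (u * q x - 1 * c * m))) :=
    ((((hexp a).mul_const _).add ((hκ.comp hshift).mul_const m)).const_mul θ |>.sub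
      (hrs.mul_const _)).sub (hrc.mul (((hexp u).mul_const _).sub
        ((hexpc.mul (hκ.comp hshift)).mul_const m)))
  rw [one_mul] at hΨ
  filter_upwards [hΨ.eventually_lt_const hmρ, hnear, Ioo_mem_nhdsGT hx.2,
    Ioo_mem_nhdsGT (show x < x + h by linarith)] with z hz hzm hzb hzh
  refine lt_of_le_of_lt ?_ hz
  have hd : 0 < z - x := sub_pos.2 hzb.1
  have e1 := H.step_p x z hx.1 hzb.1 hzb.2.le (by linarith [hzh.2]) m hzm
  have e2 := H.step_q x z hx.1 hzb.1 hzb.2.le (by linarith [hzh.2]) m hzm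
  -- Solved for `q z`, since the backward estimate has to serve as a lower bound for the later
  -- value.
  have e3 : Real.exp (u * (z - x)) * q x ≤ q z + Real.exp (u * (z - x)) * κ (z - x) * m := by
    have h1 := mul_le_mul_of_nonneg_left e2 (Real.exp_pos (u * (z - x))).le
    rw [mul_add, ← mul_assoc, ← Real.exp_add, neg_mul, add_neg_cancel, Real.exp_zero, one_mul,
      ← mul_assoc] at h1
    exact h1
  simp only [slope_def_field, sub_self, mul_zero, Real.exp_zero]
  have e4 := mul_le_mul_of_nonneg_left e1 hθ
  have e5 := mul_le_mul_of_nonneg_left e3 (hr0 z hzb.1.le)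
  rw [div_le_iff₀ hd]
  have hd' := hd.ne'
  have e6 : (θ * ((Real.exp (a * (z - x)) - 1) / (z - x) * p x + κ (z - x) / (z - x) * m) -
      (r z - r x) / (z - x) * q x - r z * ((Real.exp (u * (z - x)) - 1) / (z - x) * q x -
        Real.exp (u * (z - x)) * (κ (z - x) / (z - x)) * m)) * (z - x) =
      θ * ((Real.exp (a * (z - x)) - 1) * p x + κ (z - x) * m) -
      (r z - r x) * q x - r z * ((Real.exp (u * (z - x)) - 1) * q x -
        Real.exp (u * (z - x)) * κ (z - x) * m) := by
    field_simp
  rw [e6]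
  nlinarith [e4, e5]

/-- The cone contraction for errors of first order. -/
theorem cone_of_tendsto (H : ConePair a u κ h b p q) (hh : 0 < h) (hb : 0 ≤ b) {e σ : ℝ}
    (hκ : Tendsto (fun t => κ t / t) (𝓝[>] 0) (𝓝 (e / 2))) (he : 0 ≤ e) (hσ : σ = u - a - e)
    (hgap : 0 < u - a - 2 * e) {α : ℝ} (hα0 : 0 ≤ α) (hα1 : α ≤ 1) (hp : p 0 ≤ α * q 0) :
    p b ≤ (Real.exp (-σ * b) * α + (1 - Real.exp (-σ * b)) * (e / σ)) * q b ∧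
      q 0 ≤ Real.exp ((-u + e) * b) * q b := by
  have hσ0 : 0 < σ := by linarith
  have hcb0 : 0 ≤ e / σ := div_nonneg he hσ0.le
  have hcb1 : e / σ ≤ 1 := (div_le_one hσ0).2 (by linarith)
  -- The ratio p/q obeys the Riccati inequality r' ≤ -σr + (e/2)(1 + r²). For r ≤ 1 the right side
  -- is at most -σr + e, and this `r` solves the linear equation with r(0) = α.
  set r : ℝ → ℝ := fun t => Real.exp (-σ * t) * (α - e / σ) + e / σ with hr
  have hrd : ∀ t, HasDerivAt r (-σ * r t + e) t := by
    intro t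
    have h1 : HasDerivAt (fun t => Real.exp (-σ * t)) (Real.exp (-σ * t) * (-σ)) t := by
      simpa using ((hasDerivAt_id t).const_mul (-σ)).exp
    refine ((h1.mul_const (α - e / σ)).add_const (e / σ)).congr_deriv ?_
    simp only [hr]
    field_simp
    ring
  have hrmem : ∀ t, 0 ≤ t → 0 ≤ r t ∧ r t ≤ 1 := by
    intro t ht
    have h1 : Real.exp (-σ * t) ≤ 1 := Real.exp_le_one_iff.2 (by nlinarith)
    have h2 := Real.exp_pos (-σ * t)
    constructor <;> simp only [hr] <;> nlinarith
  have key : ∀ t ∈ Icc 0 b, p t ≤ r t * q t := by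
    -- The comparison theorem needs a strict derivative inequality at contact points. The small
    -- growing barrier supplies it, and ξ → 0 afterwards.
    have hmain : ∀ ξ > 0, ∀ t ∈ Icc 0 b, p t - r t * q t ≤
        ξ * Real.exp ((|a| + e + 1) * t) := by
      intro ξ hξ
      have hq : ∀ t, 0 ≤ t → 0 ≤ p t := fun t _ => H.p_nonneg t
      refine image_le_of_liminf_slope_right_lt_deriv_boundary'
        (f := fun t => p t - r t * q t)
        (f' := fun x => (a * p x + e / 2 * (p x + q x)) - (-σ * r x + e) * q x -
          r x * (u * q x - e / 2 * (p x + q x)))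
        (B := fun t => ξ * Real.exp ((|a| + e + 1) * t))
        (B' := fun t => (|a| + e + 1) * (ξ * Real.exp ((|a| + e + 1) * t)))
        (H.contp.sub (ContinuousOn.mul (fun t _ => (hrd t).continuousAt.continuousWithinAt)
          H.contq)) ?_ ?_ ?_ ?_ ?_
      · intro x hx ρ hρ
        have h1 := H.eventually_slope_lt hh hκ (hrd x)
          (fun t ht => (hrmem t (hx.1.trans ht)).1) zero_le_one hx (ρ := ρ) (by rwa [one_mul])
        simp only [one_mul] at h1
        exact h1.frequently
      · have : r 0 = α := by simp [hr]
        simp only [this, mul_zero, Real.exp_zero, mul_one]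
        linarith
      · fun_prop
      · intro x _
        have h1 : HasDerivAt (fun t => Real.exp ((|a| + e + 1) * t))
            (Real.exp ((|a| + e + 1) * x) * (|a| + e + 1)) x := by
          simpa using ((hasDerivAt_id x).const_mul (|a| + e + 1)).exp
        have h2 := h1.const_mul ξ
        refine (h2.congr_deriv ?_).hasDerivWithinAt
        ring
      · intro x hx hFB
        set β := ξ * Real.exp ((|a| + e + 1) * x) with hβ
        have hβ0 : 0 < β := by positivity
        obtain ⟨h0, h1⟩ := hrmem x hx.1
        have hpx : p x = r x * q x + β := by linarith
        have hqx := H.q_nonneg x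
        rw [hpx]
        -- At a contact point p = rq + β. The terms in q collapse to a nonpositive one because r ≤
        -- 1, and only a multiple of β is left.
        have e1 : a * (r x * q x + β) + e / 2 * (r x * q x + β + q x) - (-σ * r x + e) * q x -
            r x * (u * q x - e / 2 * (r x * q x + β + q x)) =
            -(e / 2 * (1 - r x ^ 2) * q x) + β * (a + e / 2 + e / 2 * r x) := by
          rw [hσ]; ring
        rw [e1]
        have e2 : 0 ≤ e / 2 * (1 - r x ^ 2) * q x := by
          have : 0 ≤ 1 - r x ^ 2 := by nlinarith
          positivity
        have e3 : a + e / 2 + e / 2 * r x < |a| + e + 1 := by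
          have := le_abs_self a
          nlinarith
        nlinarith [mul_lt_mul_of_pos_left e3 hβ0]
    intro t ht
    have h1 : Tendsto (fun ξ : ℝ => ξ * Real.exp ((|a| + e + 1) * t)) (𝓝[>] 0) (𝓝 0) := by
      refine tendsto_nhdsWithin_of_tendsto_nhds ?_
      simpa using (continuous_mul_const (Real.exp ((|a| + e + 1) * t))).tendsto 0
    have h2 : p t - r t * q t ≤ 0 := by
      refine ge_of_tendsto h1 ?_
      filter_upwards [self_mem_nhdsWithin] with ξ hξ using hmain ξ hξ t ht
    linarith
  constructor
  · refine (key b ⟨hb, le_rfl⟩).trans (le_of_eq ?_)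
    simp only [hr]; ring
  -- Inside the cone p ≤ q, hence q' ≥ (u - e)q, so e^{-(u-e)t}q does not decrease.
  · have hmain := image_le_of_liminf_slope_right_le_deriv_boundary
      (f := fun t => 0 * p t - Real.exp (-(u - e) * t) * q t) (a := 0) (b := b)
      (B := fun _ => -q 0) (B' := fun _ => 0)
      ((continuousOn_const.mul H.contp).sub (ContinuousOn.mul (by fun_prop) H.contq))
      (by simp) continuousOn_const (fun x _ => hasDerivWithinAt_const _ _ _) ?_
      (right_mem_Icc.2 hb)
    · rw [zero_mul, zero_sub, neg_le_neg_iff] at hmain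
      refine hmain.trans (le_of_eq ?_)
      ring_nf
    · intro x hx ρ hρ
      have h1 : HasDerivAt (fun t => Real.exp (-(u - e) * t))
          (-(u - e) * Real.exp (-(u - e) * x)) x := by
        have := ((hasDerivAt_id x).const_mul (-(u - e))).exp
        simpa [mul_comm] using this
      refine (H.eventually_slope_lt hh hκ h1 (fun t _ => (Real.exp_pos _).le) le_rfl hx
        (lt_of_le_of_lt ?_ hρ)).frequently
      obtain ⟨h2, h3⟩ := hrmem x hx.1
      have h4 := key x ⟨hx.1, hx.2.le⟩
      have h5 : p x ≤ q x := h4.trans (by nlinarith [H.q_nonneg x])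
      have h6 : 0 ≤ Real.exp (-(u - e) * x) * (e / 2 * (q x - p x)) := by
        have := sub_nonneg.2 h5
        positivity
      linarith

end ConePair

/-! ### Cone estimates with bounded errors -/

/-- The admissible size of the error, in terms of a bound `N` of the rates, the loss `x` of the
rate per step and the gain `G` of the cones. -/
noncomputable def coneThreshold (N x G : ℝ) : ℝ :=
  Real.exp (-2 * N) * (1 - Real.exp (-x)) * (1 - Real.exp (-G / 4)) / 16

theorem coneThreshold_pos {N x G : ℝ} (hx : 0 < x) (hG : 0 < G) : 0 < coneThreshold N x G := by
  have h1 : 0 < 1 - Real.exp (-x) := sub_pos.2 (Real.exp_lt_one_iff.2 (by linarith))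
  have h2 : 0 < 1 - Real.exp (-G / 4) := sub_pos.2 (Real.exp_lt_one_iff.2 (by linarith))
  have := Real.exp_pos (-2 * N)
  unfold coneThreshold
  positivity

theorem coneThreshold_mono {N N' x x' G G' : ℝ} (hN : N' ≤ N) (hx : x ≤ x') (hG : G ≤ G')
    (hx0 : 0 ≤ x) (hG0 : 0 ≤ G) : coneThreshold N x G ≤ coneThreshold N' x' G' := by
  have h1 : 0 ≤ 1 - Real.exp (-x) := sub_nonneg.2 (Real.exp_le_one_iff.2 (by linarith))
  have h2 : 0 ≤ 1 - Real.exp (-G / 4) := sub_nonneg.2 (Real.exp_le_one_iff.2 (by linarith))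
  have h3 : 0 ≤ 1 - Real.exp (-x') := sub_nonneg.2 (Real.exp_le_one_iff.2 (by linarith))
  unfold coneThreshold
  have e1 : Real.exp (-2 * N) ≤ Real.exp (-2 * N') := Real.exp_le_exp.2 (by linarith)
  have e2 : 1 - Real.exp (-x) ≤ 1 - Real.exp (-x') := by
    have : Real.exp (-x') ≤ Real.exp (-x) := Real.exp_le_exp.2 (by linarith)
    linarith
  have e3 : 1 - Real.exp (-G / 4) ≤ 1 - Real.exp (-G' / 4) := by
    have : Real.exp (-G' / 4) ≤ Real.exp (-G / 4) := Real.exp_le_exp.2 (by linarith)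
    linarith
  gcongr

namespace ConePair

variable {a u h b κ : ℝ} {p q : ℝ → ℝ}

/-- On a short interval the pair is controlled by the value of `p` on the left and the value of
`q` on the right. -/
theorem sum_le (H : ConePair a u (fun _ => κ) h b p q) (hκ0 : 0 ≤ κ) (hκ : 4 * κ ≤ 1) {t₁ t₂ : ℝ}
    (h1 : 0 ≤ t₁) (h12 : t₁ < t₂) (h2 : t₂ ≤ b) (hd : t₂ - t₁ ≤ h) {K : ℝ}
    (hK : Real.exp ((|a| + |u|) * h) ≤ K) :
    ∀ s ∈ Icc t₁ t₂, p s + q s ≤ 2 * K * (p t₁ + q t₂) := by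
  have hsub : Icc t₁ t₂ ⊆ Icc 0 b := Icc_subset_Icc h1 h2
  -- At a maximum point p is estimated from the left end and q from the right end. The total error
  -- is 2κ times the maximum, at most half of it, and is absorbed.
  obtain ⟨s₀, hs₀, hmax⟩ := isCompact_Icc.exists_isMaxOn (nonempty_Icc.2 h12.le)
    ((H.contp.add H.contq).mono hsub)
  have hh0 : 0 ≤ h := (sub_pos.2 h12).le.trans hd
  have hexp : ∀ w d, |w| ≤ |a| + |u| → 0 ≤ d → d ≤ h → Real.exp (w * d) ≤ K := by
    intro w d hw hd0 hdh
    refine (Real.exp_le_exp.2 ?_).trans hK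
    calc w * d ≤ |w| * d := mul_le_mul_of_nonneg_right (le_abs_self w) hd0
      _ ≤ (|a| + |u|) * h := by gcongr
  have hK1 : 1 ≤ K := by
    have := hexp 0 0 (by simp; positivity) le_rfl hh0
    simpa using this
  set m := p s₀ + q s₀ with hm
  have hle : ∀ s ∈ Icc t₁ t₂, p s + q s ≤ m := fun s hs => hmax hs
  have hm0 : 0 ≤ m := add_nonneg (H.p_nonneg _) (H.q_nonneg _)
  have ep : p s₀ ≤ K * p t₁ + κ * m := by
    rcases hs₀.1.eq_or_lt with he | hlt
    · rw [← he]
      nlinarith [H.p_nonneg t₁, mul_nonneg hκ0 hm0]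
    · have e1 := H.step_p t₁ s₀ h1 hlt (hs₀.2.trans h2) (by linarith [hs₀.2]) m
        fun s hs => hle s ⟨hs.1, hs.2.trans hs₀.2⟩
      have e2 := hexp a (s₀ - t₁) (by simp) (by linarith) (by linarith [hs₀.2])
      nlinarith [mul_le_mul_of_nonneg_right e2 (H.p_nonneg t₁)]
  have eq : q s₀ ≤ K * q t₂ + κ * m := by
    rcases hs₀.2.eq_or_lt with he | hlt
    · rw [he]
      nlinarith [H.q_nonneg t₂, mul_nonneg hκ0 hm0]
    · have e1 := H.step_q s₀ t₂ (h1.trans hs₀.1) hlt h2 (by linarith [hs₀.1]) m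
        fun s hs => hle s ⟨hs₀.1.trans hs.1, hs.2⟩
      have e2 := hexp (-u) (t₂ - s₀) (by simp) (by linarith) (by linarith [hs₀.1])
      nlinarith [mul_le_mul_of_nonneg_right e2 (H.q_nonneg t₂)]
  intro s hs
  refine (hle s hs).trans ?_
  nlinarith [mul_le_mul_of_nonneg_right hκ hm0]

/-- One step of length at most `h`. -/
theorem cone_step (H : ConePair a u (fun _ => κ) h b p q) (hκ0 : 0 ≤ κ) {K x : ℝ}
    (hK : Real.exp ((|a| + |u|) * h) ≤ K) (hx1 : x ≤ 1) (hKκ : 8 * K ^ 2 * κ ≤ x)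
    {t₁ t₂ : ℝ} (h1 : 0 ≤ t₁) (h12 : t₁ < t₂) (h2 : t₂ ≤ b) (hd : t₂ - t₁ ≤ h) {ρ : ℝ}
    (hρ0 : 0 ≤ ρ) (hρ1 : ρ ≤ 1) (hp : p t₁ ≤ ρ * q t₁) :
    p t₂ ≤ (ρ * (Real.exp (-(u - a) * (t₂ - t₁)) * Real.exp x) + 2 * K * κ) * q t₂ ∧
      q t₁ ≤ Real.exp (-u * (t₂ - t₁)) * Real.exp x * q t₂ := by
  set d := t₂ - t₁ with hd'
  have hd0 : 0 < d := sub_pos.2 h12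
  have hh0 : 0 ≤ h := hd0.le.trans hd
  have hexp : ∀ w, |w| ≤ |a| + |u| → Real.exp (w * d) ≤ K := by
    intro w hw
    refine (Real.exp_le_exp.2 ?_).trans hK
    calc w * d ≤ |w| * d := mul_le_mul_of_nonneg_right (le_abs_self w) hd0.le
      _ ≤ (|a| + |u|) * h := by gcongr
  have hK1 : 1 ≤ K := by simpa using hexp 0 (by simp; positivity)
  set κ' := 2 * K * κ with hκ'
  have hκ'0 : 0 ≤ κ' := by positivity
  set ν := K * κ' with hν
  have hν0 : 0 ≤ ν := by positivity
  have hνx : 4 * ν ≤ x := by rw [hν, hκ']; linarith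
  have hκν : κ' ≤ ν := le_mul_of_one_le_left hκ'0 hK1
  have hκ4 : 4 * κ ≤ 1 := by nlinarith
  have hm := H.sum_le hκ0 hκ4 h1 h12 h2 hd hK
  have ep := H.step_p t₁ t₂ h1 h12 h2 hd _ hm
  have eq := H.step_q t₁ t₂ h1 h12 h2 hd _ hm
  rw [← hd'] at ep eq
  have hp0 := H.p_nonneg t₁
  have hq1 := H.q_nonneg t₁
  have hq2 := H.q_nonneg t₂
  have ep' : p t₂ ≤ Real.exp (a * d) * p t₁ + κ' * (p t₁ + q t₂) := by
    rw [hκ']; linarith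
  have eq' : q t₁ ≤ Real.exp (-u * d) * q t₂ + κ' * (p t₁ + q t₂) := by
    rw [hκ']; linarith
  have hgrow : ∀ w, |w| ≤ |a| + |u| → Real.exp (w * d) + κ' ≤ Real.exp (w * d) * Real.exp ν := by
    intro w hw
    have e1 := hexp (-w) (by rwa [abs_neg])
    have e2 : 1 ≤ Real.exp (w * d) * K := by
      have h3 : Real.exp (w * d) * Real.exp (-w * d) = 1 := by rw [← Real.exp_add]; simp
      rw [← h3]; gcongr
    have e3 := Real.add_one_le_exp ν
    have e4 : κ' ≤ Real.exp (w * d) * ν := by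
      rw [hν, ← mul_assoc]; exact le_mul_of_one_le_left hκ'0 e2
    nlinarith [Real.exp_pos (w * d)]
  have ga := hgrow a (by simp)
  have gu := hgrow (-u) (by simp)
  have hpq : p t₁ ≤ q t₁ := hp.trans (by nlinarith)
  have e1 : (1 - κ') * q t₁ ≤ Real.exp (-u * d) * Real.exp ν * q t₂ := by nlinarith
  have e2 : 1 ≤ (1 - κ') * Real.exp (2 * ν) := by
    have h3 := Real.add_one_le_exp (2 * ν)
    have h4 : 0 ≤ 1 - κ' := by linarith
    nlinarith
  have e3 : q t₁ ≤ Real.exp (-u * d) * Real.exp (3 * ν) * q t₂ := by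
    have h3 : Real.exp (3 * ν) = Real.exp ν * Real.exp (2 * ν) := by
      rw [← Real.exp_add]; ring_nf
    have h4 := mul_le_mul_of_nonneg_right e1 (Real.exp_pos (2 * ν)).le
    rw [h3]
    nlinarith
  constructor
  · have e4 : p t₂ ≤ Real.exp (a * d) * Real.exp ν * (ρ * q t₁) + κ' * q t₂ := by
      have h3 := mul_le_mul_of_nonneg_right ga hp0
      have h4 := mul_le_mul_of_nonneg_left hp
        (mul_pos (Real.exp_pos (a * d)) (Real.exp_pos ν)).le
      linarith
    have e5 : Real.exp (a * d) * Real.exp ν * (ρ * q t₁) ≤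
        Real.exp (a * d) * Real.exp ν * (ρ * (Real.exp (-u * d) * Real.exp (3 * ν) * q t₂)) := by
      gcongr
    have e6 : Real.exp (a * d) * Real.exp ν * (ρ * (Real.exp (-u * d) * Real.exp (3 * ν) * q t₂)) =
        ρ * (Real.exp (-(u - a) * d) * Real.exp (4 * ν)) * q t₂ := by
      have h3 : Real.exp (-(u - a) * d) * Real.exp (4 * ν) =
          Real.exp (a * d) * Real.exp ν * (Real.exp (-u * d) * Real.exp (3 * ν)) := by
        simp only [← Real.exp_add]; ring_nf
      rw [h3]; ring
    have e7 : ρ * (Real.exp (-(u - a) * d) * Real.exp (4 * ν)) * q t₂ ≤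
        ρ * (Real.exp (-(u - a) * d) * Real.exp x) * q t₂ := by
      gcongr
    linarith
  · refine e3.trans ?_
    gcongr
    linarith

/-- Iteration of the cone contraction in steps of length `h`. -/
theorem cone_iterate (H : ConePair a u (fun _ => κ) h b p q) (hκ0 : 0 ≤ κ) (hh : 0 < h)
    {K η ρ₀ A : ℝ} (hK : Real.exp ((|a| + |u|) * h) ≤ K) (hx1 : η * h ≤ 1)
    (hKκ : 8 * K ^ 2 * κ ≤ η * h) (hρ₀ : 0 ≤ ρ₀) (hA0 : 0 ≤ A)
    (hA : 2 * K * κ ≤ A * (1 - Real.exp (-(u - a - η) * h))) (hρA : ρ₀ + A ≤ 1)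
    (hη : η ≤ u - a) (hp : p 0 ≤ ρ₀ * q 0) (n : ℕ) (hn : n * h ≤ b) :
    p (n * h) ≤ (ρ₀ * Real.exp (-(u - a - η) * (n * h)) + A) * q (n * h) ∧
      q 0 ≤ Real.exp ((-u + η) * (n * h)) * q (n * h) := by
  induction n with
  | zero =>
    simp only [Nat.cast_zero, zero_mul, mul_zero, Real.exp_zero, mul_one, one_mul, le_refl,
      and_true]
    nlinarith [H.q_nonneg 0]
  | succ n ih =>
    have hstep : ((n + 1 : ℕ) : ℝ) * h - n * h = h := by push_cast; ring
    have hlt : (n : ℝ) * h < ((n + 1 : ℕ) : ℝ) * h := by linarith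
    obtain ⟨ih1, ih2⟩ := ih (hlt.le.trans hn)
    have hnh : 0 ≤ (n : ℝ) * h := by positivity
    have hE : Real.exp (-(u - a - η) * (n * h)) ≤ 1 :=
      Real.exp_le_one_iff.2 (by nlinarith)
    have hE0 := Real.exp_pos (-(u - a - η) * (n * h))
    obtain ⟨s1, s2⟩ := H.cone_step hκ0 hK hx1 hKκ hnh hlt hn hstep.le
      (ρ := ρ₀ * Real.exp (-(u - a - η) * (n * h)) + A) (by positivity) (by nlinarith) ih1
    rw [hstep] at s1 s2
    have hq := H.q_nonneg (((n + 1 : ℕ) : ℝ) * h)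
    constructor
    · refine s1.trans (mul_le_mul_of_nonneg_right ?_ hq)
      -- The loss e^{ηh} lowers the gap u - a by η. Hypothesis `hA` says that the offset A
      -- reproduces itself: A e^{-(u-a-η)h} + 2Kκ ≤ A.
      have e1 : Real.exp (-(u - a) * h) * Real.exp (η * h) = Real.exp (-(u - a - η) * h) := by
        rw [← Real.exp_add]; ring_nf
      have e2 : Real.exp (-(u - a - η) * (((n + 1 : ℕ) : ℝ) * h)) =
          Real.exp (-(u - a - η) * (n * h)) * Real.exp (-(u - a - η) * h) := by
        rw [← Real.exp_add]; push_cast; ring_nf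
      rw [e1, e2]
      linarith
    · refine ih2.trans ?_
      have e1 : Real.exp ((-u + η) * (((n + 1 : ℕ) : ℝ) * h)) =
          Real.exp ((-u + η) * (n * h)) * (Real.exp (-u * h) * Real.exp (η * h)) := by
        simp only [← Real.exp_add]; push_cast; ring_nf
      rw [e1, mul_assoc]
      gcongr

/-- Arbitrary times: the iteration in steps of length `h`, followed by a shorter step. -/
theorem cone_terminal (H : ConePair a u (fun _ => κ) h b p q) (hb : 0 ≤ b) (hκ0 : 0 ≤ κ)
    (hh : 0 < h) {K η ρ₀ A : ℝ} (hK : Real.exp ((|a| + |u|) * h) ≤ K) (hη : 0 < η)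
    (hx1 : η * h ≤ 1 / 2) (hKκ : 8 * K ^ 2 * κ ≤ η * h) (hρ₀ : 0 ≤ ρ₀) (hA0 : 0 ≤ A)
    (hA : 2 * K * κ ≤ A * (1 - Real.exp (-(u - a - η) * h))) (hρA : ρ₀ + A ≤ 1)
    (hgap : 2 * η ≤ u - a) (hp : p 0 ≤ ρ₀ * q 0) :
    p b ≤ (ρ₀ * (Real.exp (-(u - a - η) * b) * Real.exp (η * h)) + 3 * A) * q b ∧
      q 0 ≤ Real.exp ((-u + η) * b) * Real.exp (η * h) * q b := by
  have hκA : 2 * K * κ ≤ A := by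
    refine hA.trans (mul_le_of_le_one_right hA0 ?_)
    linarith [Real.exp_pos (-(u - a - η) * h)]
  obtain ⟨n, hnb, hbn⟩ : ∃ n : ℕ, n * h ≤ b ∧ b < (n + 1) * h := by
    refine ⟨⌊b / h⌋₊, ?_, ?_⟩
    · exact (le_div_iff₀ hh).1 (Nat.floor_le (div_nonneg hb hh.le))
    · exact (div_lt_iff₀ hh).1 (Nat.lt_floor_add_one _)
  obtain ⟨i1, i2⟩ := H.cone_iterate hκ0 hh hK (by linarith) hKκ hρ₀ hA0 hA hρA
    (by linarith) hp n hnb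
  have hx0 : 0 < η * h := mul_pos hη hh
  have hnh : 0 ≤ (n : ℝ) * h := by positivity
  generalize hx : η * h = x at *
  generalize hr : (n : ℝ) * h = r at *
  have hrb : b - r ≤ h := by linarith
  have hg1 : 0 ≤ u - a - η := by linarith
  have hg0 : 0 ≤ u - a := by linarith
  have hE1 : Real.exp (-(u - a - η) * r) ≤ 1 :=
    Real.exp_le_one_iff.2 (by linarith [mul_nonneg hg1 hnh])
  have hE0 : 0 < Real.exp (-(u - a - η) * r) := Real.exp_pos _
  have hex2 : Real.exp x ≤ 2 := by
    have h1 : Real.exp (-x) ≥ 1 / 2 := by linarith [Real.add_one_le_exp (-x)]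
    have h2 : Real.exp x * Real.exp (-x) = 1 := by rw [← Real.exp_add]; simp
    nlinarith [Real.exp_pos x]
  have hqb := H.q_nonneg b
  have h1x : 1 ≤ Real.exp x := Real.one_le_exp hx0.le
  rcases hnb.eq_or_lt with he | hlt
  · rw [he] at i1 i2
    constructor
    · refine i1.trans (mul_le_mul_of_nonneg_right ?_ hqb)
      have h3 : Real.exp (-(u - a - η) * b) ≤ Real.exp (-(u - a - η) * b) * Real.exp x :=
        le_mul_of_one_le_right (Real.exp_pos _).le h1x
      have h4 := mul_le_mul_of_nonneg_left h3 hρ₀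
      linarith
    · refine i2.trans (mul_le_mul_of_nonneg_right ?_ hqb)
      exact le_mul_of_one_le_right (Real.exp_pos _).le h1x
  · have hρE := mul_le_mul_of_nonneg_left hE1 hρ₀
    obtain ⟨s1, s2⟩ := H.cone_step hκ0 hK (by linarith) hKκ hnh hlt le_rfl hrb
      (ρ := ρ₀ * Real.exp (-(u - a - η) * r) + A) (by positivity) (by linarith) i1
    have hd : 0 ≤ b - r := by linarith
    constructor
    · refine s1.trans (mul_le_mul_of_nonneg_right ?_ hqb)
      have e1 : Real.exp (-(u - a - η) * r) * Real.exp (-(u - a) * (b - r)) ≤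
          Real.exp (-(u - a - η) * b) := by
        rw [← Real.exp_add]
        exact Real.exp_le_exp.2 (by linarith [mul_nonneg hη.le hd])
      -- The last short step need not contract: it can double the offset A and adds a further 2Kκ ≤
      -- A, whence 3A.
      have e2 : Real.exp (-(u - a) * (b - r)) * Real.exp x ≤ 2 := by
        have h5 : Real.exp (-(u - a) * (b - r)) ≤ 1 :=
          Real.exp_le_one_iff.2 (by linarith [mul_nonneg hg0 hd])
        have h6 := mul_le_mul h5 hex2 (Real.exp_pos x).le zero_le_one
        linarith
      have e3 := mul_le_mul_of_nonneg_left (mul_le_mul_of_nonneg_right e1 (Real.exp_pos x).le) hρ₀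
      have e4 := mul_le_mul_of_nonneg_left e2 hA0
      linarith
    · refine i2.trans ?_
      have e1 : Real.exp ((-u + η) * r) * (Real.exp (-u * (b - r)) * Real.exp x) ≤
          Real.exp ((-u + η) * b) * Real.exp x := by
        rw [← mul_assoc]
        refine mul_le_mul_of_nonneg_right ?_ (Real.exp_pos x).le
        rw [← Real.exp_add]
        exact Real.exp_le_exp.2 (by linarith [mul_nonneg hη.le hd])
      have e2 := mul_le_mul_of_nonneg_left s2 (Real.exp_pos ((-u + η) * r)).le
      have e3 := mul_le_mul_of_nonneg_right e1 hqb
      linarith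

/-- Accounts for the shape of `coneThreshold`: e^{-2N} cancels K², the factor 1 - e^{-x} pays for
the geometric series with offset A = ρ(1 - e^{-G/4})/8, and 3A fits into the final offset because
e^{-G/2} ≥ 1/2. -/
theorem cone_of_const (H : ConePair a u (fun _ => κ) h b p q) (hb : 0 ≤ b) (hκ0 : 0 ≤ κ)
    (hh : 0 < h) (hh1 : h ≤ 1) {η G ρ ρ₀ : ℝ} (hη : 0 < η) (hgap : 2 * η ≤ u - a)
    (hG1 : G ≤ 1) (hηG : 8 * (η * h) ≤ G) (hρ1 : ρ ≤ 1 / 2)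
    (hκ : κ ≤ ρ * coneThreshold (|a| + |u|) (η * h) G) (hρ₀ : 0 ≤ ρ₀) (hρ₀ρ : ρ₀ ≤ ρ)
    (hp : p 0 ≤ ρ₀ * q 0) :
    p b ≤ (Real.exp (G / 4) * Real.exp (-(u - a - η) * b) * ρ₀ +
        ρ * (Real.exp (-G / 2) * (1 - Real.exp (-G / 4)))) * q b ∧
      q 0 ≤ 2 * Real.exp ((-u + η) * b) * q b := by
  set N := |a| + |u| with hN
  have hN0 : 0 ≤ N := by positivity
  set K := Real.exp N with hKdef
  have hK1 : 1 ≤ K := Real.one_le_exp hN0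
  have hK : Real.exp (N * h) ≤ K := Real.exp_le_exp.2 (mul_le_of_le_one_right hN0 hh1)
  set x := η * h with hx
  have hx0 : 0 < x := mul_pos hη hh
  have hρ : 0 ≤ ρ := hρ₀.trans hρ₀ρ
  set X := 1 - Real.exp (-x) with hX
  have hX0 : 0 < X := sub_pos.2 (Real.exp_lt_one_iff.2 (by linarith))
  have hXx : X ≤ x := by linarith [Real.add_one_le_exp (-x)]
  set Y := 1 - Real.exp (-G / 4) with hY
  have hY0 : 0 < Y := sub_pos.2 (Real.exp_lt_one_iff.2 (by linarith))
  have hY1 : Y ≤ 1 := by linarith [Real.exp_pos (-G / 4)]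
  have hKκ : K ^ 2 * κ ≤ ρ * (X * Y / 16) := by
    have h1 : coneThreshold N x G = Real.exp (-2 * N) * (X * Y / 16) := by
      rw [coneThreshold]; ring
    have h2 : K ^ 2 * Real.exp (-2 * N) = 1 := by
      rw [hKdef, ← Real.exp_nat_mul, ← Real.exp_add]; simp
    calc K ^ 2 * κ ≤ K ^ 2 * (ρ * coneThreshold N x G) := by gcongr
      _ = (K ^ 2 * Real.exp (-2 * N)) * (ρ * (X * Y / 16)) := by rw [h1]; ring
      _ = _ := by rw [h2, one_mul]
  have hKκ' : K * κ ≤ ρ * (X * Y / 16) :=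
    (mul_le_mul_of_nonneg_right (le_self_pow₀ hK1 two_ne_zero) hκ0).trans hKκ
  set A := ρ * (Y / 8) with hA
  have hA0 : 0 ≤ A := by positivity
  have hXY : X * Y ≤ X := mul_le_of_le_one_right hX0.le hY1
  have hρX : ρ * (X * Y) ≤ 1 / 2 * X := mul_le_mul hρ1 hXY (by positivity) (by norm_num)
  have h8 : 8 * K ^ 2 * κ ≤ x := by linarith
  have hA' : 2 * K * κ ≤ A * (1 - Real.exp (-(u - a - η) * h)) := by
    have h1 : X ≤ 1 - Real.exp (-(u - a - η) * h) := by
      have : Real.exp (-(u - a - η) * h) ≤ Real.exp (-x) := Real.exp_le_exp.2 (by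
        rw [neg_mul, neg_le_neg_iff]; exact mul_le_mul_of_nonneg_right (by linarith) hh.le)
      linarith
    calc 2 * K * κ ≤ A * X := by rw [hA]; linarith
      _ ≤ _ := by gcongr
  have hρA : ρ₀ + A ≤ 1 := by 
    have := mul_le_mul hρ1 hY1 hY0.le (by norm_num)
    rw [hA]; linarith
  have hfin := H.cone_terminal hb hκ0 hh hK hη (by linarith) h8 hρ₀ hA0 hA' hρA hgap hp
  have hexG : Real.exp x ≤ Real.exp (G / 4) := Real.exp_le_exp.2 (by linarith)
  have hex2 : Real.exp x ≤ 2 := by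
    have h1 : Real.exp (-x) ≥ 1 / 2 := by linarith [Real.add_one_le_exp (-x)]
    have h2 : Real.exp x * Real.exp (-x) = 1 := by rw [← Real.exp_add]; simp
    nlinarith [Real.exp_pos x]
  have hqb := H.q_nonneg b
  constructor
  · refine hfin.1.trans (mul_le_mul_of_nonneg_right ?_ hqb)
    have e1 : Real.exp (-G / 2) ≥ 1 / 2 := by linarith [Real.add_one_le_exp (-G / 2)]
    have e2 : 3 * A ≤ ρ * (Real.exp (-G / 2) * Y) := by
      rw [hA]
      have h3 := mul_le_mul_of_nonneg_right e1 (mul_nonneg hρ hY0.le)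
      linarith [mul_nonneg hρ hY0.le]
    have e3 := mul_le_mul_of_nonneg_left hexG (mul_nonneg hρ₀ (Real.exp_pos (-(u - a - η) * b)).le)
    linarith
  · refine hfin.2.trans (mul_le_mul_of_nonneg_right ?_ hqb)
    rw [mul_comm]
    gcongr

/-- The cone conditions for bounded errors. -/
theorem cone_conditions (H : ConePair a u (fun _ => κ) h b p q) (hb : 0 ≤ b) (hκ0 : 0 ≤ κ)
    (hh : 0 < h) (hh1 : h ≤ 1) {η G ρ ε₁ : ℝ} (hη : 0 < η) (hgap : 2 * η ≤ u - a) (hG : 0 < G)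
    (hG1 : G ≤ 1) (hηG : 8 * (η * h) ≤ G) (hGε : G ≤ (u - a - η) * ε₁) (hρ0 : 0 ≤ ρ)
    (hρ1 : ρ ≤ 1 / 2) (hκ : κ ≤ ρ * coneThreshold (|a| + |u|) (η * h) G) :
    (p 0 ≤ ρ * Real.exp (-G / 2) * q 0 → p b ≤ ρ * q b) ∧
    (p 0 ≤ ρ * q 0 → q 0 ≤ 2 * Real.exp ((-u + η) * b) * q b) ∧
    (ε₁ ≤ b → p 0 ≤ ρ * q 0 → p b ≤ ρ * Real.exp (-G / 2) * q b) := by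
  have hqb := H.q_nonneg b
  -- Starting from the narrow cone the bound is ρe^{-G/4} plus at most ρ(1 - e^{-G/4}), so at most
  -- ρ.
  have e0 : Real.exp (G / 4) * Real.exp (-G / 2) = Real.exp (-G / 4) := by
    rw [← Real.exp_add]; ring_nf
  have e1 : Real.exp (-G / 2) ≤ 1 := Real.exp_le_one_iff.2 (by linarith)
  have hY : 0 ≤ 1 - Real.exp (-G / 4) := sub_nonneg.2 (Real.exp_le_one_iff.2 (by linarith))
  refine ⟨fun hp => ?_, fun hp => ?_, fun hεb hp => ?_⟩
  · refine (H.cone_of_const hb hκ0 hh hh1 hη hgap hG1 hηG hρ1 hκ (by positivity)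
      (mul_le_of_le_one_right hρ0 e1) hp).1.trans (mul_le_mul_of_nonneg_right ?_ hqb)
    have e2 : Real.exp (-(u - a - η) * b) ≤ 1 := Real.exp_le_one_iff.2 (by nlinarith)
    have e3 : Real.exp (G / 4) * Real.exp (-(u - a - η) * b) * (ρ * Real.exp (-G / 2)) ≤
        ρ * Real.exp (-G / 4) := by
      rw [← e0]
      have := mul_le_mul_of_nonneg_left e2 (mul_nonneg hρ0
        (mul_pos (Real.exp_pos (G / 4)) (Real.exp_pos (-G / 2))).le)
      linarith
    have e4 : ρ * (Real.exp (-G / 2) * (1 - Real.exp (-G / 4))) ≤ ρ * (1 - Real.exp (-G / 4)) := by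
      gcongr
      exact mul_le_of_le_one_left hY e1
    linarith
  · exact (H.cone_of_const hb hκ0 hh hh1 hη hgap hG1 hηG hρ1 hκ hρ0 le_rfl hp).2
  · refine (H.cone_of_const hb hκ0 hh hh1 hη hgap hG1 hηG hρ1 hκ hρ0
      le_rfl hp).1.trans (mul_le_mul_of_nonneg_right ?_ hqb)
    -- After time ε₁ the wide cone has gained e^{-G}: e^{G/4}e^{-G}ρ plus the offset is exactly
    -- ρe^{-G/2}.
    have e2 : Real.exp (-(u - a - η) * b) ≤ Real.exp (-G) := Real.exp_le_exp.2 (by nlinarith)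
    have e3 : Real.exp (G / 4) * Real.exp (-G) = Real.exp (-G / 2) * Real.exp (-G / 4) := by
      rw [← Real.exp_add, ← Real.exp_add]; ring_nf
    have e4 : Real.exp (G / 4) * Real.exp (-(u - a - η) * b) * ρ ≤
        Real.exp (-G / 2) * Real.exp (-G / 4) * ρ := by
      rw [← e3]; gcongr
    linarith

end ConePair

/-! ### From the system to pairs of scalar functions -/

namespace DichotomySystem

set_option linter.unusedSectionVars false

variable {M : Type v} [TopologicalSpace M] {φ : Flow ℝ≥0 M} {Z : Type u} [NormedAddCommGroup Z]
  [NormedSpace ℝ Z] [CompleteSpace Z] {C₁ : ℝ} {μs μu : M → ℝ}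
  (𝒮 : DichotomySystem φ Z C₁ μs μu)

theorem eps_nonneg (f : M → 𝒮.E → Z) (ω : M) : 0 ≤ 𝒮.eps f ω := ENNReal.toReal_nonneg

/-- `lipConst` is an infimum, so the estimate is proved for every larger constant and passed to the
limit. -/
theorem norm_f_sub_le {f : M → 𝒮.E → Z} (hf : 𝒮.IsNonlinearity f) (ω : M) (s : ℝ) (x y : 𝒮.E) :
    ‖f (orb φ s ω) x - f (orb φ s ω) y‖ ≤ 𝒮.eps f ω * ‖x - y‖ := by
  have h1 : lipConst (f (orb φ s ω)) ≤ 𝒮.supLip f ω :=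
    le_iSup (fun t : ℝ≥0 => lipConst (f (φ t ω))) s.toNNReal
  have h2 : ∀ c > 𝒮.eps f ω, ‖f (orb φ s ω) x - f (orb φ s ω) y‖ ≤ c * ‖x - y‖ := by
    intro c hc
    have hc0 : 0 ≤ c := (𝒮.eps_nonneg f ω).trans hc.le
    have h3 : lipConst (f (orb φ s ω)) < ENNReal.ofReal c :=
      h1.trans_lt ((ENNReal.lt_ofReal_iff_toReal_lt (hf.lipschitz.1 ω).ne).2 hc)
    simp only [lipConst, iInf_lt_iff] at h3
    obtain ⟨K, hK, hKc⟩ := h3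
    have h4 : (K : ℝ) ≤ c := by
      have := ENNReal.toReal_mono ENNReal.ofReal_ne_top hKc.le
      rwa [ENNReal.coe_toReal, ENNReal.toReal_ofReal hc0] at this
    have h5 := hK.dist_le_mul x y
    rw [dist_eq_norm, dist_eq_norm] at h5
    exact h5.trans (by gcongr)
  have h3 : Tendsto (fun c => c * ‖x - y‖) (𝓝[>] (𝒮.eps f ω)) (𝓝 (𝒮.eps f ω * ‖x - y‖)) :=
    ((continuous_id.mul continuous_const).tendsto _).mono_left nhdsWithin_le_nhds
  exact ge_of_tendsto h3 (eventually_mem_nhdsWithin.mono h2)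

/-- Bounds along the forward orbit of `ω` for the growth rates of the linear cocycle, for the
perturbation `L` and for the Lipschitz constant of `f`. -/
structure OrbitBounds (f : M → 𝒮.E → Z) (ω : M) (a u τ ε : ℝ) : Prop where
  stable : ∀ t ≥ 0, ∀ r ≥ 0, ∀ x ∈ (𝒮.P (orb φ r ω)).range,
    ‖𝒮.T t (orb φ r ω) x‖ ≤ Real.exp (a * t) * ‖x‖
  unstable : ∀ t ≥ 0, ∀ r ≥ 0, ∀ y ∈ (𝒮.P (orb φ r ω)).ker,
    ‖y‖ ≤ Real.exp (-u * t) * ‖𝒮.T t (orb φ r ω) y‖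
  norm_L : ∀ r ≥ 0, ‖𝒮.L (orb φ r ω)‖ ≤ τ
  ε_nonneg : 0 ≤ ε
  lip : ∀ r ≥ 0, ∀ x y, ‖f (orb φ r ω) x - f (orb φ r ω) y‖ ≤ ε * ‖x - y‖

variable {𝒮} {f : M → 𝒮.E → Z} {ω : M} {a u τ ε b : ℝ}

theorem orbitBounds (hf : 𝒮.IsNonlinearity f) (ω : M) :
    𝒮.OrbitBounds f ω (μs ω) (μu ω) (𝒮.tau ω) (𝒮.eps f ω) :=
  ⟨𝒮.dichotomy.stable ω, 𝒮.dichotomy.unstable ω, fun r _ => 𝒮.norm_L_le ω r, 𝒮.eps_nonneg f ω,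
    fun r _ => 𝒮.norm_f_sub_le hf ω r⟩

/-- Bounds along the whole forward orbit are inherited by its points. This is why the conditions at
sω hold with functions evaluated at ω. -/
theorem OrbitBounds.shift (h : 𝒮.OrbitBounds f ω a u τ ε) {s : ℝ} (hs : 0 ≤ s) :
    𝒮.OrbitBounds f (orb φ s ω) a u τ ε := by
  refine ⟨fun t ht r hr => ?_, fun t ht r hr => ?_, fun r hr => ?_, h.ε_nonneg, fun r hr => ?_⟩
  all_goals rw [orb_orb φ hs hr]
  exacts [h.stable t ht _ (add_nonneg hs hr), h.unstable t ht _ (add_nonneg hs hr),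
    h.norm_L _ (add_nonneg hs hr), h.lip _ (add_nonneg hs hr)]

/-- The size of the error over a time interval of length `t`. -/
noncomputable def stepError (𝒮 : DichotomySystem φ Z C₁ μs μu) (u τ ε t : ℝ) : ℝ :=
  C₁ * ε * (max (𝒮.δ t) 0 / (1 - τ * max (𝒮.δ t) 0)) * max 1 (Real.exp (-u * t))

/-- Strong continuity of the projections suffices because their norms are bounded by C₁. -/
theorem continuousOn_P {z : ℝ → 𝒮.E} {s : Set ℝ} (hz : ContinuousOn z s) :
    ContinuousOn (fun t => 𝒮.P (orb φ t ω) (z t)) s := by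
  intro t ht
  rw [ContinuousWithinAt, tendsto_iff_norm_sub_tendsto_zero]
  have h1 : Tendsto (fun r => C₁ * ‖z r - z t‖ +
      ‖𝒮.P (orb φ r ω) (z t) - 𝒮.P (orb φ t ω) (z t)‖) (𝓝[s] t) (𝓝 (C₁ * 0 + 0)) := by
    refine Tendsto.add (Tendsto.const_mul _ ?_) ?_
    · exact tendsto_iff_norm_sub_tendsto_zero.1 (hz t ht)
    · refine tendsto_iff_norm_sub_tendsto_zero.1 ?_
      exact (((𝒮.dichotomy.continuous (z t)).comp (continuous_orb φ ω)).tendsto t).mono_left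
        nhdsWithin_le_nhds
  rw [mul_zero, add_zero] at h1
  refine squeeze_zero (fun _ => norm_nonneg _) (fun r => ?_) h1
  have h2 : 𝒮.P (orb φ r ω) (z r) - 𝒮.P (orb φ t ω) (z t) = 𝒮.P (orb φ r ω) (z r - z t) +
      (𝒮.P (orb φ r ω) (z t) - 𝒮.P (orb φ t ω) (z t)) := by
    rw [map_sub]; abel
  rw [h2]
  exact (norm_add_le _ _).trans (add_le_add_left
    ((𝒮.P _).le_of_opNorm_le (𝒮.dichotomy.angle _) _) _)

/-- The remainder after subtracting the cocycle solves the equation with zero initial value and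
forcing at most ε|w| ≤ ε(p + q). Projecting costs C₁, and pulling the unstable part back to the left
end costs e^{-ut}, hence the maximum with 1 in `stepError`. -/
theorem OrbitBounds.conePair (hB : 𝒮.OrbitBounds f ω a u τ ε) {z z' : ℝ → 𝒮.E}
    (hz : 𝒮.IsVar b ω z fun s => f (orb φ s ω) (z s))
    (hz' : 𝒮.IsVar b ω z' fun s => f (orb φ s ω) (z' s)) {h : ℝ}
    (hlt : ∀ t, 0 < t → t ≤ h → τ * max (𝒮.δ t) 0 < 1) :
    ConePair a u (𝒮.stepError u τ ε) h b (fun t => ‖𝒮.P (orb φ t ω) (z t - z' t)‖)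
      (fun t => ‖𝒮.Pc (orb φ t ω) (z t - z' t)‖) := by
  have hd := hz.sub hz'
  have hcP := continuousOn_P (𝒮 := 𝒮) (ω := ω) hd.cont
  have hC₁ := 𝒮.dichotomy.angle_pos
  have key : ∀ t₁ t₂, 0 ≤ t₁ → t₁ < t₂ → t₂ ≤ b → t₂ - t₁ ≤ h → ∀ m,
      (∀ s ∈ Icc t₁ t₂, ‖𝒮.P (orb φ s ω) (z s - z' s)‖ + ‖𝒮.Pc (orb φ s ω) (z s - z' s)‖ ≤ m) →
      ‖(z t₂ - z' t₂) - 𝒮.T (t₂ - t₁) (orb φ t₁ ω) (z t₁ - z' t₁)‖ ≤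
        ε * (max (𝒮.δ (t₂ - t₁)) 0 / (1 - τ * max (𝒮.δ (t₂ - t₁)) 0)) * m := by
    intro t₁ t₂ h1 h12 h2 hh m hm
    obtain ⟨hw, hw0⟩ := hd.remainder (r := t₁) ⟨h1, h12.le.trans h2⟩
    have hpos : 0 < t₂ - t₁ := sub_pos.2 h12
    have h3 := (hw.restrict (b' := t₂ - t₁) (by linarith)).norm_le hpos (by simpa using hw0)
      (τ := τ) (m := ε * m) (fun s hs => by
        rw [orb_orb φ h1 hs.1]; exact hB.norm_L _ (add_nonneg h1 hs.1)) (fun s hs => by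
        refine (hB.lip _ (add_nonneg h1 hs.1) _ _).trans
          (mul_le_mul_of_nonneg_left ?_ hB.ε_nonneg)
        refine le_trans ?_ (hm (t₁ + s) ⟨by linarith [hs.1], by linarith [hs.2]⟩)
        have := norm_add_le (𝒮.P (orb φ (t₁ + s) ω) (z (t₁ + s) - z' (t₁ + s)))
          (𝒮.Pc (orb φ (t₁ + s) ω) (z (t₁ + s) - z' (t₁ + s)))
        rwa [𝒮.P_add_Pc] at this) (hlt _ hpos hh) (right_mem_Icc.2 hpos.le)
    simp only [add_sub_cancel] at h3
    calc _ ≤ _ := h3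
      _ = _ := by ring
  have hD : ∀ t, 0 < t → t ≤ h → 0 ≤ max (𝒮.δ t) 0 / (1 - τ * max (𝒮.δ t) 0) := fun t ht hth =>
    div_nonneg (le_max_right _ _) (by linarith [hlt t ht hth])
  refine ⟨hcP.norm, (hd.cont.sub hcP).norm, fun t => norm_nonneg _, fun t => norm_nonneg _,
    fun t₁ t₂ h1 h12 h2 hh m hm => ?_, fun t₁ t₂ h1 h12 h2 hh m hm => ?_⟩
  all_goals
    have hw := key t₁ t₂ h1 h12 h2 hh m hm
    have hpos : 0 < t₂ - t₁ := sub_pos.2 h12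
    have horb : orb φ (t₂ - t₁) (orb φ t₁ ω) = orb φ t₂ ω := by
      rw [orb_orb φ h1 hpos.le, add_sub_cancel]
    have hm0 : 0 ≤ m := le_trans (add_nonneg (norm_nonneg _) (norm_nonneg _))
      (hm t₁ ⟨le_rfl, h12.le⟩)
    set w := (z t₂ - z' t₂) - 𝒮.T (t₂ - t₁) (orb φ t₁ ω) (z t₁ - z' t₁) with hwdef
    have he : z t₂ - z' t₂ = 𝒮.T (t₂ - t₁) (orb φ t₁ ω) (z t₁ - z' t₁) + w := by
      rw [hwdef]; abel
    have hX0 : 0 ≤ C₁ * (ε * (max (𝒮.δ (t₂ - t₁)) 0 /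
        (1 - τ * max (𝒮.δ (t₂ - t₁)) 0)) * m) :=
      mul_nonneg hC₁.le (mul_nonneg (mul_nonneg hB.ε_nonneg (hD _ hpos hh)) hm0)
  · have e1 : 𝒮.P (orb φ t₂ ω) (z t₂ - z' t₂) =
        𝒮.T (t₂ - t₁) (orb φ t₁ ω) (𝒮.P (orb φ t₁ ω) (z t₁ - z' t₁)) + 𝒮.P (orb φ t₂ ω) w := by
      rw [he, map_add, ← 𝒮.P_T hpos.le, horb]
    rw [e1]
    refine (norm_add_le _ _).trans (add_le_add (hB.stable _ hpos.le _ h1 _ (𝒮.P_mem _ _)) ?_)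
    have e2 := (𝒮.P (orb φ t₂ ω)).le_of_opNorm_le_of_le (𝒮.dichotomy.angle _) hw
    refine e2.trans ?_
    have e3 := mul_le_mul_of_nonneg_left (le_max_left 1 (Real.exp (-u * (t₂ - t₁)))) hX0
    rw [stepError]
    linarith
  · have e1 : 𝒮.T (t₂ - t₁) (orb φ t₁ ω) (𝒮.Pc (orb φ t₁ ω) (z t₁ - z' t₁)) =
        𝒮.Pc (orb φ t₂ ω) (z t₂ - z' t₂) - 𝒮.Pc (orb φ t₂ ω) w := by
      rw [he, map_add, ← 𝒮.Pc_T hpos.le, horb]; abel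
    have e0 := hB.unstable _ hpos.le _ h1 _ (𝒮.Pc_mem (orb φ t₁ ω) (z t₁ - z' t₁))
    rw [e1] at e0
    have e2 := (𝒮.Pc (orb φ t₂ ω)).le_of_opNorm_le_of_le (𝒮.dichotomy.angle_compl _) hw
    have e3 := mul_le_mul_of_nonneg_left (le_max_right 1 (Real.exp (-u * (t₂ - t₁)))) hX0
    have e4 := mul_le_mul_of_nonneg_left ((norm_sub_le (𝒮.Pc (orb φ t₂ ω) (z t₂ - z' t₂))
      (𝒮.Pc (orb φ t₂ ω) w)).trans (add_le_add_right e2 _))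
      (Real.exp_pos (-u * (t₂ - t₁))).le
    rw [stepError]
    linarith

theorem P_of_mem_X {x : 𝒮.E} (hx : x ∈ 𝒮.X ω) : 𝒮.P ω x = x := by
  obtain ⟨y, rfl⟩ := hx
  exact 𝒮.dichotomy.proj ω y

theorem P_split {z z' : 𝒮.E} {x x' : 𝒮.X ω} {y y' : 𝒮.Y ω} (h : z = (x : 𝒮.E) + y)
    (h' : z' = (x' : 𝒮.E) + y') :
    ‖𝒮.P ω (z - z')‖ = dist x x' ∧ ‖𝒮.Pc ω (z - z')‖ = dist y y' := by
  have hy : 𝒮.P ω (y : 𝒮.E) = 0 := y.2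
  have hy' : 𝒮.P ω (y' : 𝒮.E) = 0 := y'.2
  have h1 : 𝒮.P ω (z - z') = x - x' := by
    rw [h, h', map_sub, map_add, map_add, hy, hy', P_of_mem_X x.2, P_of_mem_X x'.2]
    abel
  constructor
  · rw [h1, Subtype.dist_eq, dist_eq_norm]
  · rw [Pc_apply, h1, Subtype.dist_eq, dist_eq_norm, h, h']
    congr 1; abel

/-- The cone conditions for correspondences whose points come from solutions of the equation. -/
theorem satisfiesAB_of_conePair (hB : 𝒮.OrbitBounds f ω a u τ ε) {h : ℝ}
    (hlt : ∀ t, 0 < t → t ≤ h → τ * max (𝒮.δ t) 0 < 1)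
    {R : Set ((𝒮.X ω × 𝒮.Y ω) × (𝒮.X (orb φ b ω) × 𝒮.Y (orb φ b ω)))}
    (hR : ∀ p ∈ R, ∃ z : ℝ → 𝒮.E, 𝒮.IsVar b ω z (fun s => f (orb φ s ω) (z s)) ∧
      z 0 = (p.1.1 : 𝒮.E) + (p.1.2 : 𝒮.E) ∧ z b = (p.2.1 : 𝒮.E) + (p.2.2 : 𝒮.E))
    {α α' lamU β β' lamS : ℝ}
    (hA : ∀ p q, ConePair a u (𝒮.stepError u τ ε) h b p q → p 0 ≤ α * q 0 →
      p b ≤ α' * q b ∧ q 0 ≤ lamU * q b)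
    (hA' : ∀ p q, ConePair (-u) (-a) (𝒮.stepError u τ ε) h b p q → p 0 ≤ β * q 0 →
      p b ≤ β' * q b ∧ q 0 ≤ lamS * q b) :
    SatisfiesAB R α α' lamU β β' lamS := by
  have key : ∀ p ∈ R, ∀ q ∈ R, ∃ x y : ℝ → ℝ, ConePair a u (𝒮.stepError u τ ε) h b x y ∧
      x 0 = dist p.1.1 q.1.1 ∧ y 0 = dist p.1.2 q.1.2 ∧ x b = dist p.2.1 q.2.1 ∧
      y b = dist p.2.2 q.2.2 := by
    intro p hp q hq
    obtain ⟨z, hz, hz0, hzb⟩ := hR p hp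
    obtain ⟨z', hz', hz0', hzb'⟩ := hR q hq
    obtain ⟨e1, e2⟩ := P_split hz0 hz0'
    obtain ⟨e3, e4⟩ := P_split hzb hzb'
    exact ⟨_, _, hB.conePair hz hz' hlt, by rw [orb_zero]; exact e1, by rw [orb_zero]; exact e2,
      e3, e4⟩
  constructor
  all_goals
    intro p hp q hq hpq
    obtain ⟨x, y, H, e1, e2, e3, e4⟩ := key p hp q hq
  · rw [← e1, ← e2] at hpq
    rw [← e3, ← e4]
    exact (hA x y H hpq).1
  · rw [← e1, ← e2] at hpq
    rw [← e2, ← e4]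
    exact (hA x y H hpq).2
  -- (B) runs from the end time to the initial time, so it is the first condition for the reversed
  -- pair.
  · rw [← e3, ← e4] at hpq
    rw [← e1, ← e2]
    simpa using (hA' _ _ H.reverse (by simpa using hpq)).1
  · rw [← e3, ← e4] at hpq
    rw [← e1, ← e3]
    simpa using (hA' _ _ H.reverse (by simpa using hpq)).2

theorem exists_isVar_of_mem_H (hf : 𝒮.IsNonlinearity f) (hb : 0 ≤ b) :
    ∀ p ∈ 𝒮.H f b ω, ∃ z : ℝ → 𝒮.E, 𝒮.IsVar b ω z (fun s => f (orb φ s ω) (z s)) ∧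
      z 0 = (p.1.1 : 𝒮.E) + (p.1.2 : 𝒮.E) ∧ z b = (p.2.1 : 𝒮.E) + (p.2.2 : 𝒮.E) := by
  rintro p ⟨z, hz, hz'⟩
  exact ⟨z, isVar_of_solvesDichotomyEq hf hb hz, hz'⟩

theorem exists_isVar_of_mem_U (hf : 𝒮.IsNonlinearity f) :
    ∀ p ∈ 𝒮.U f b ω, ∃ z : ℝ → 𝒮.E, 𝒮.IsVar b ω z (fun s => f (orb φ s ω) (z s)) ∧
      z 0 = (p.1.1 : 𝒮.E) + (p.1.2 : 𝒮.E) ∧ z b = (p.2.1 : 𝒮.E) + (p.2.2 : 𝒮.E) := by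
  rintro p ⟨z, hz, hz'⟩
  exact ⟨z, isVar_of_isMildSolution hf hz, hz'⟩

end DichotomySystem

/-! ### The case of an asymptotically linear error bound -/

theorem SatisfiesAB.mono {X₁ Y₁ X₂ Y₂ : Type*} [MetricSpace X₁] [MetricSpace Y₁] [MetricSpace X₂]
    [MetricSpace Y₂] {H : Set ((X₁ × Y₁) × (X₂ × Y₂))} {α α' α'' l l' β β' β'' m m' : ℝ}
    (h : SatisfiesAB H α α' l β β' m) (hα : α' ≤ α'') (hl : l ≤ l') (hβ : β' ≤ β'')
    (hm : m ≤ m') : SatisfiesAB H α α'' l' β β'' m' :=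
  ⟨fun p hp q hq hpq => (h.A1 p hp q hq hpq).trans (mul_le_mul_of_nonneg_right hα dist_nonneg),
    fun p hp q hq hpq => (h.A2 p hp q hq hpq).trans (mul_le_mul_of_nonneg_right hl dist_nonneg),
    fun p hp q hq hpq => (h.B1 p hp q hq hpq).trans (mul_le_mul_of_nonneg_right hβ dist_nonneg),
    fun p hp q hq hpq => (h.B2 p hp q hq hpq).trans (mul_le_mul_of_nonneg_right hm dist_nonneg)⟩

namespace DichotomySystem

set_option linter.unusedSectionVars false

variable {M : Type v} [TopologicalSpace M] {φ : Flow ℝ≥0 M} {Z : Type u} [NormedAddCommGroup Z]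
  [NormedSpace ℝ Z] [CompleteSpace Z] {C₁ : ℝ} {μs μu : M → ℝ}
  {𝒮 : DichotomySystem φ Z C₁ μs μu} {f : M → 𝒮.E → Z} {ω : M}

theorem eps'_nonneg (𝒮 : DichotomySystem φ Z C₁ μs μu) (f : M → 𝒮.E → Z) (ω : M) :
    0 ≤ 𝒮.eps' f ω :=
  mul_nonneg (mul_nonneg zero_le_two 𝒮.dichotomy.angle_pos.le) (𝒮.eps_nonneg f ω)

/-- The limit C₁ε is ε'/2, the constant e/2 of the differential inequalities. -/
theorem tendsto_stepError_div (hδ : Tendsto (fun t => 𝒮.δ t / t) (𝓝[>] 0) (𝓝 1)) (u τ ε : ℝ) :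
    Tendsto (fun t => 𝒮.stepError u τ ε t / t) (𝓝[>] 0) (𝓝 (C₁ * ε)) := by
  have h1 : Tendsto (fun t => max (𝒮.δ t / t) 0) (𝓝[>] 0) (𝓝 1) := by
    simpa using hδ.max (tendsto_const_nhds (x := (0 : ℝ)))
  have h2 : Tendsto (fun t => 1 - τ * max (𝒮.δ t) 0) (𝓝[>] 0) (𝓝 1) := by
    simpa using (𝒮.isMR.tendsto_max.const_mul τ).const_sub 1
  have h3 : Tendsto (fun t => max 1 (Real.exp (-u * t))) (𝓝[>] 0) (𝓝 1) := by
    have : Continuous fun t => max 1 (Real.exp (-u * t)) := by fun_prop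
    simpa using (this.tendsto 0).mono_left nhdsWithin_le_nhds
  have h4 := (((h1.div h2 one_ne_zero).const_mul (C₁ * ε)).mul h3)
  simp only [div_one, mul_one] at h4
  refine h4.congr' ?_
  filter_upwards [self_mem_nhdsWithin] with t ht
  have ht0 : (0 : ℝ) < t := ht
  have e1 : max (𝒮.δ t / t) 0 = max (𝒮.δ t) 0 / t := by
    rw [← max_div_div_right ht0.le, zero_div]
  rw [stepError, Pi.div_apply, e1]
  ring

theorem exists_step (𝒮 : DichotomySystem φ Z C₁ μs μu) (τ : ℝ) :
    ∃ h > 0, ∀ t, 0 < t → t ≤ h → τ * max (𝒮.δ t) 0 < 1 := by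
  have h1 : Tendsto (fun t => τ * max (𝒮.δ t) 0) (𝓝[>] 0) (𝓝 0) := by
    simpa using 𝒮.isMR.tendsto_max.const_mul τ
  obtain ⟨d, hd, hd'⟩ := mem_nhdsGT_iff_exists_Ioc_subset.1 (h1.eventually_lt_const one_pos)
  exact ⟨d, hd, fun t ht ht' => hd' ⟨ht, ht'⟩⟩

/-- The apertures relax exponentially towards the critical one. Reversal preserves u - a, so (A) and
(B) share the rate σ. -/
theorem satisfiesAB_of_tendsto (hδ : Tendsto (fun t => 𝒮.δ t / t) (𝓝[>] 0) (𝓝 1))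
    (hf : 𝒮.IsNonlinearity f) {σ : ℝ} (hσ : σ = μu ω - μs ω - 𝒮.eps' f ω)
    (hgap : 0 < μu ω - μs ω - 2 * 𝒮.eps' f ω) {α β : ℝ} (hα0 : 0 ≤ α) (hα1 : α ≤ 1) (hβ0 : 0 ≤ β)
    (hβ1 : β ≤ 1) {t s : ℝ} (ht : 0 ≤ t) (hs : 0 ≤ s) :
    SatisfiesAB (𝒮.H f t (orb φ s ω))
      α (Real.exp (-σ * t) * α + (1 - Real.exp (-σ * t)) * 𝒮.coneBound f ω) (𝒮.lamU f ω ^ t)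
      β (Real.exp (-σ * t) * β + (1 - Real.exp (-σ * t)) * 𝒮.coneBound f ω)
        (𝒮.lamS f ω ^ t) := by
  obtain ⟨h, hh, hlt⟩ := 𝒮.exists_step (𝒮.tau ω)
  have hκ : Tendsto (fun t => 𝒮.stepError (μu ω) (𝒮.tau ω) (𝒮.eps f ω) t / t) (𝓝[>] 0)
      (𝓝 (𝒮.eps' f ω / 2)) := by
    have e : 𝒮.eps' f ω / 2 = C₁ * 𝒮.eps f ω := by rw [eps']; ring
    rw [e]
    exact tendsto_stepError_div hδ _ _ _
  have he := 𝒮.eps'_nonneg f ω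
  rw [lamU, lamS, ← Real.exp_mul, ← Real.exp_mul, coneBound, ← hσ]
  refine satisfiesAB_of_conePair ((orbitBounds hf ω).shift hs) hlt (exists_isVar_of_mem_H hf ht)
    (fun p q H hp => H.cone_of_tendsto hh ht hκ he hσ hgap hα0 hα1 hp) fun p q H hp => ?_
  have := H.cone_of_tendsto hh ht hκ he (σ := σ) (by rw [hσ]; ring) (by linarith) hβ0 hβ1 hp
  rwa [neg_neg] at this

theorem coneBound_nonneg (hgap : 0 < μu ω - μs ω - 2 * 𝒮.eps' f ω) : 0 ≤ 𝒮.coneBound f ω := by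
  have := 𝒮.eps'_nonneg f ω
  exact div_nonneg this (by linarith)

/-- Pointwise cones with the critical aperture. -/
theorem satisfiesAB_pointwise (hδ : Tendsto (fun t => 𝒮.δ t / t) (𝓝[>] 0) (𝓝 1))
    (hf : 𝒮.IsNonlinearity f) (hgap : 0 < μu ω - μs ω - 2 * 𝒮.eps' f ω) {α β : ℝ}
    (hα : 𝒮.coneBound f ω ≤ α) (hα1 : α < 1) (hβ : 𝒮.coneBound f ω ≤ β) (hβ1 : β < 1)
    {t s : ℝ} (ht : 0 ≤ t) (hs : 0 ≤ s) :
    SatisfiesAB (𝒮.H f t (orb φ s ω)) α α (𝒮.lamU f ω ^ t) β β (𝒮.lamS f ω ^ t) := by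
  have h0 := coneBound_nonneg hgap
  have he := 𝒮.eps'_nonneg f ω
  have hE : Real.exp (-(μu ω - μs ω - 𝒮.eps' f ω) * t) ≤ 1 :=
    Real.exp_le_one_iff.2 (by
      rw [neg_mul, neg_nonpos]; exact mul_nonneg (by linarith) ht)
  have key : ∀ x, 𝒮.coneBound f ω ≤ x → Real.exp (-(μu ω - μs ω - 𝒮.eps' f ω) * t) * x +
      (1 - Real.exp (-(μu ω - μs ω - 𝒮.eps' f ω) * t)) * 𝒮.coneBound f ω ≤ x := by
    intro x hx
    nlinarith [mul_nonneg (sub_nonneg.2 hE) (sub_nonneg.2 hx)]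
  exact (satisfiesAB_of_tendsto hδ hf rfl hgap (h0.trans hα) hα1.le (h0.trans hβ) hβ1.le ht
    hs).mono (key α hα) le_rfl (key β hβ) le_rfl

/-- The contraction factor of a cone. -/
noncomputable def coneGain (γ z t : ℝ) : ℝ := Real.exp (-γ * t) + (1 - Real.exp (-γ * t)) * z

theorem coneGain_mem {γ z t : ℝ} (hγ : 0 < γ) (hz0 : 0 ≤ z) (hz1 : z < 1) (ht : 0 < t) :
    0 < coneGain γ z t ∧ coneGain γ z t < 1 := by
  have h1 : Real.exp (-γ * t) < 1 := Real.exp_lt_one_iff.2 (by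
    rw [neg_mul, neg_lt_zero]; exact mul_pos hγ ht)
  have h2 := Real.exp_pos (-γ * t)
  have h3 := mul_nonneg (sub_nonneg.2 h1.le) hz0
  have h4 := mul_pos (sub_pos.2 h1) (sub_pos.2 hz1)
  rw [coneGain]
  constructor <;> linarith

/-- For c ≤ zx the left side is at most (z + (1 - z)e^{-σt'})x. The smallest rate and the smallest
time are therefore the worst case. -/
theorem le_coneGain_mul {γ σ z t t' c x : ℝ} (hγ : 0 ≤ γ) (hσ : γ ≤ σ) (ht0 : 0 ≤ t)
    (ht : t ≤ t') (hz1 : z ≤ 1) (hx : 0 ≤ x) (hc : c ≤ z * x) :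
    Real.exp (-σ * t') * x + (1 - Real.exp (-σ * t')) * c ≤ coneGain γ z t * x := by
  have h1 : Real.exp (-σ * t') ≤ Real.exp (-γ * t) := Real.exp_le_exp.2 (by
    rw [neg_mul, neg_mul, neg_le_neg_iff]; exact mul_le_mul hσ ht ht0 (hγ.trans hσ))
  have h2 : Real.exp (-σ * t') ≤ 1 := Real.exp_le_one_iff.2 (by
    rw [neg_mul, neg_nonpos]; exact mul_nonneg (hγ.trans hσ) (ht0.trans ht))
  have h3 := mul_le_mul_of_nonneg_left hc (sub_nonneg.2 h2)
  have h4 := mul_le_mul_of_nonneg_right h1 (mul_nonneg (sub_nonneg.2 hz1) hx)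
  rw [coneGain]
  linarith

/-- Uniformly contracted cones. -/
theorem hasUniformCones_of_bound (hδ : Tendsto (fun t => 𝒮.δ t / t) (𝓝[>] 0) (𝓝 1))
    (hf : 𝒮.IsNonlinearity f) (hgap : ∀ ω, 0 < μu ω - μs ω - 2 * 𝒮.eps' f ω) {α ρ z γ : ℝ}
    (hα0 : 0 < α) (hα1 : α < 1) (hαρ : α < ρ) (hz0 : 0 ≤ z) (hz1 : z < 1) (hγ : 0 < γ)
    (hc : ∀ ω, 𝒮.coneBound f ω ≤ z * α) (hσ : ∀ ω, γ ≤ μu ω - μs ω - 𝒮.eps' f ω) :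
    𝒮.HasUniformCones f ρ := by
  have hlt : ∀ ω, 𝒮.coneBound f ω < α := fun ω =>
    (hc ω).trans_lt (mul_lt_of_lt_one_left hα0 hz1)
  refine ⟨α, α, hα0, hα1, hαρ, hα0, hα1, hαρ, fun ω => ⟨hlt ω, hlt ω⟩, fun ω t ht s hs =>
    satisfiesAB_pointwise hδ hf (hgap ω) (hlt ω).le hα1 (hlt ω).le hα1 ht hs, fun ε₁ hε₁ => ?_⟩
  obtain ⟨h1, h2⟩ := coneGain_mem hγ hz0 hz1 hε₁
  refine ⟨_, _, h1, h2, h1, h2, fun ω t ht s hs => ?_⟩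
  have key := le_coneGain_mul hγ.le (hσ ω) hε₁.le ht hz1.le hα0.le (hc ω)
  exact (satisfiesAB_of_tendsto hδ hf rfl (hgap ω) hα0.le hα1.le hα0.le hα1.le (hε₁.le.trans ht)
    hs).mono key le_rfl key le_rfl

/-- Pointwise contracted cones. -/
theorem exists_coneGain (hδ : Tendsto (fun t => 𝒮.δ t / t) (𝓝[>] 0) (𝓝 1))
    (hf : 𝒮.IsNonlinearity f) (hgap : ∀ ω, 0 < μu ω - μs ω - 2 * 𝒮.eps' f ω) {α β : M → ℝ}
    (h : ∀ ω, 𝒮.coneBound f ω < α ω ∧ α ω < 1 ∧ 𝒮.coneBound f ω < β ω ∧ β ω < 1) :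
    ∃ kα kβ : M → ℝ → ℝ, ∀ ω, ∀ ε₁ > 0,
      (0 < kα ω ε₁ ∧ kα ω ε₁ < 1 ∧ 0 < kβ ω ε₁ ∧ kβ ω ε₁ < 1) ∧
      ∀ t ≥ ε₁, ∀ s ≥ 0, SatisfiesAB (𝒮.H f t (orb φ s ω))
        (α ω) (kα ω ε₁ * α ω) (𝒮.lamU f ω ^ t) (β ω) (kβ ω ε₁ * β ω) (𝒮.lamS f ω ^ t) := by
  refine ⟨fun ω => coneGain (μu ω - μs ω - 𝒮.eps' f ω) (𝒮.coneBound f ω / α ω),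
    fun ω => coneGain (μu ω - μs ω - 𝒮.eps' f ω) (𝒮.coneBound f ω / β ω), fun ω ε₁ hε₁ => ?_⟩
  obtain ⟨hα, hα1, hβ, hβ1⟩ := h ω
  have h0 := coneBound_nonneg (hgap ω)
  have hα0 := h0.trans_lt hα
  have hβ0 := h0.trans_lt hβ
  have hγ : 0 < μu ω - μs ω - 𝒮.eps' f ω := by
    have := 𝒮.eps'_nonneg f ω
    linarith [hgap ω]
  have zα := (div_lt_one hα0).2 hα
  have zβ := (div_lt_one hβ0).2 hβ
  obtain ⟨g1, g2⟩ := coneGain_mem hγ (div_nonneg h0 hα0.le) zα hε₁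
  obtain ⟨g3, g4⟩ := coneGain_mem hγ (div_nonneg h0 hβ0.le) zβ hε₁
  refine ⟨⟨g1, g2, g3, g4⟩, fun t ht s hs => ?_⟩
  exact (satisfiesAB_of_tendsto hδ hf rfl (hgap ω) hα0.le hα1.le hβ0.le hβ1.le (hε₁.le.trans ht)
    hs).mono (le_coneGain_mul hγ.le le_rfl hε₁.le ht zα.le hα0.le (by field_simp; rfl)) le_rfl
    (le_coneGain_mul hγ.le le_rfl hε₁.le ht zβ.le hβ0.le (by field_simp; rfl)) le_rfl

/-- The gap gives σ ≥ cε', so the critical aperture is at most 1/c everywhere. The midpoint of 1/c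
and 1 is a uniform aperture with room to contract. -/
theorem uniform_of_gap (hδ : Tendsto (fun t => 𝒮.δ t / t) (𝓝[>] 0) (𝓝 1))
    (hf : 𝒮.IsNonlinearity f) {c γ : ℝ} (hc : 1 < c) (hγ : 0 < γ)
    (hgap : ∀ ω, γ ≤ μu ω - μs ω - (1 + c) * 𝒮.eps' f ω) :
    𝒮.HasUniformCones f 1 ∧ ∃ q < 1, ∀ ω, 𝒮.lamS f ω * 𝒮.lamU f ω ≤ q := by
  have he := 𝒮.eps'_nonneg f
  have hce : ∀ ω, 0 ≤ (c - 1) * 𝒮.eps' f ω := fun ω => mul_nonneg (by linarith) (he ω)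
  have hc0 : 0 < c := by linarith
  have hc1 : 1 / c < 1 := (div_lt_one hc0).2 hc
  have hc2 : 0 < 1 / c := by positivity
  constructor
  · have hα0 : 0 < (1 + 1 / c) / 2 := by linarith
    refine hasUniformCones_of_bound hδ hf (fun ω => by linarith [hgap ω, hce ω])
      (α := (1 + 1 / c) / 2) (z := 1 / c / ((1 + 1 / c) / 2)) hα0 (by linarith) (by linarith)
      (by positivity) ((div_lt_one hα0).2 (by linarith)) hγ (fun ω => ?_)
      fun ω => by linarith [hgap ω, hce ω, he ω]
    rw [div_mul_cancel₀ _ hα0.ne', coneBound, div_le_div_iff₀ (by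
      linarith [hgap ω, hce ω, he ω]) hc0]
    linarith [hgap ω]
  · refine ⟨Real.exp (-γ), Real.exp_lt_one_iff.2 (by linarith), fun ω => ?_⟩
    rw [lamS, lamU, ← Real.exp_add]
    exact Real.exp_le_exp.2 (by linarith [hgap ω, hce ω])

/-- If μ_u - μ_s ≥ γ > 0, then ε' ≤ γα/4 keeps σ ≥ γ/2 and the critical aperture at most α/2. If
there is no such γ, no f satisfies the gap condition, since ε' ≥ 0, and any ε₀ will do. -/
theorem uniform_small (𝒮 : DichotomySystem φ Z C₁ μs μu)
    (hδ : Tendsto (fun t => 𝒮.δ t / t) (𝓝[>] 0) (𝓝 1)) {c ρ : ℝ} (hc : 1 < c) (hρ : 0 < ρ) :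
    ∃ ε₀ > 0, ∀ f : M → 𝒮.E → Z, 𝒮.IsNonlinearity f →
      (∃ γ > 0, ∀ ω, γ ≤ μu ω - μs ω - (1 + c) * 𝒮.eps' f ω) →
      (∀ ω, 𝒮.eps' f ω ≤ ε₀) → 𝒮.HasUniformCones f ρ := by
  by_cases h : ∃ γ > 0, ∀ ω, γ ≤ μu ω - μs ω
  · obtain ⟨γ, hγ, hgap⟩ := h
    set α := min ρ 1 / 2 with hα
    have hα0 : 0 < α := by positivity
    have hα1 : α ≤ 1 / 2 := by linarith [min_le_right ρ 1]
    have hαρ : α < ρ := by linarith [min_le_left ρ 1]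
    refine ⟨γ * α / 4, by positivity, fun f hf ⟨γ', hγ', hgap'⟩ hε => ?_⟩
    have he := 𝒮.eps'_nonneg f
    have h1 : γ * α / 4 ≤ γ / 8 := by nlinarith
    refine hasUniformCones_of_bound hδ hf (fun ω => ?_) hα0 (by linarith) hαρ (z := 1 / 2)
      (by norm_num) (by norm_num) (half_pos hγ) (fun ω => ?_)
      fun ω => by linarith [hgap ω, hε ω]
    · linarith [hgap ω, hε ω]
    · have h2 : γ / 2 ≤ μu ω - μs ω - 𝒮.eps' f ω := by linarith [hgap ω, hε ω]
      rw [coneBound, div_le_iff₀ (by linarith)]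
      have h3 := mul_le_mul_of_nonneg_left h2 (show 0 ≤ 1 / 2 * α by positivity)
      linarith [hε ω]
  · refine ⟨1, one_pos, fun f hf ⟨γ, hγ, hgap⟩ _ => absurd ⟨γ, hγ, fun ω => ?_⟩ h⟩
    have := mul_nonneg (by linarith : 0 ≤ 1 + c) (𝒮.eps'_nonneg f ω)
    linarith [hgap ω]

end DichotomySystem

/-! ### Cones for small Lipschitz constants -/

/-- On a trivial spectral space every nonnegative rate is valid, in particular 0, which occurs as an
infimum over the past. -/
theorem SatisfiesAB.improve {X₁ Y₁ X₂ Y₂ : Type*} [MetricSpace X₁] [MetricSpace Y₁]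
    [MetricSpace X₂] [MetricSpace Y₂] {H : Set ((X₁ × Y₁) × (X₂ × Y₂))}
    {α α' l l' β β' m m' : ℝ} (h : SatisfiesAB H α α' l β β' m)
    (hl : l ≤ l' ∨ (0 ≤ l' ∧ Subsingleton Y₁)) (hm : m ≤ m' ∨ (0 ≤ m' ∧ Subsingleton X₂)) :
    SatisfiesAB H α α' l' β β' m' := by
  refine ⟨h.A1, fun p hp q hq hpq => ?_, h.B1, fun p hp q hq hpq => ?_⟩
  · rcases hl with hl | ⟨hl, hY⟩
    · exact (h.A2 p hp q hq hpq).trans (mul_le_mul_of_nonneg_right hl dist_nonneg)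
    · rw [Subsingleton.elim p.1.2 q.1.2, dist_self]
      exact mul_nonneg hl dist_nonneg
  · rcases hm with hm | ⟨hm, hX⟩
    · exact (h.B2 p hp q hq hpq).trans (mul_le_mul_of_nonneg_right hm dist_nonneg)
    · rw [Subsingleton.elim p.2.1 q.2.1, dist_self]
      exact mul_nonneg hm dist_nonneg

/-- The admissible size of the Lipschitz constant for cones of aperture `1`. -/
noncomputable def lipThreshold (C₁ N x G : ℝ) : ℝ :=
  coneThreshold N x G / (max C₁ 1 * Real.exp N)

theorem lipThreshold_pos {C₁ N x G : ℝ} (hx : 0 < x) (hG : 0 < G) : 0 < lipThreshold C₁ N x G :=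
  div_pos (coneThreshold_pos hx hG) (mul_pos (by positivity) (Real.exp_pos N))

theorem lipThreshold_mono {C₁ N N' x x' G G' : ℝ} (hN : N' ≤ N) (hx : x ≤ x') (hG : G ≤ G')
    (hx0 : 0 < x) (hG0 : 0 < G) : lipThreshold C₁ N x G ≤ lipThreshold C₁ N' x' G' := by
  have h1 : 0 < max C₁ 1 := by positivity
  exact div_le_div₀ (coneThreshold_pos (hx0.trans_le hx) (hG0.trans_le hG)).le
    (coneThreshold_mono hN hx hG hx0.le hG0.le) (mul_pos h1 (Real.exp_pos _))
    (mul_le_mul_of_nonneg_left (Real.exp_le_exp.2 hN) h1.le)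

/-! ### Step lengths determined by δ₁. -/

section StepLength

variable {M : Type v} (δ₁ : ℝ → M → ℝ≥0∞)

/-- Time steps for which the linear equation is under control. -/
def stepSet (ω : M) : Set ℝ := {h | 0 < h ∧ h ≤ 1 ∧ δ₁ h ω ≤ 1}

open Classical in
/-- A length of time steps that depends on `δ₁` only. -/
noncomputable def stepLen (ω : M) : ℝ :=
  if (stepSet δ₁ ω).Nonempty then sSup (stepSet δ₁ ω) / 2 else 1

variable {δ₁} {ω : M}

theorem bddAbove_stepSet : BddAbove (stepSet δ₁ ω) := ⟨1, fun _ h => h.2.1⟩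

theorem half_le_stepLen {h : ℝ} (hh : h ∈ stepSet δ₁ ω) : h / 2 ≤ stepLen δ₁ ω := by
  rw [stepLen, if_pos ⟨h, hh⟩]
  linarith [le_csSup bddAbove_stepSet hh]

theorem stepLen_pos : 0 < stepLen δ₁ ω := by
  by_cases hS : (stepSet δ₁ ω).Nonempty
  · obtain ⟨h, hh⟩ := hS
    exact (half_pos hh.1).trans_le (half_le_stepLen hh)
  · rw [stepLen, if_neg hS]; exact one_pos

theorem stepLen_le_one : stepLen δ₁ ω ≤ 1 := by
  by_cases hS : (stepSet δ₁ ω).Nonempty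
  · rw [stepLen, if_pos hS]
    linarith [csSup_le hS fun h (hh : h ∈ stepSet δ₁ ω) => hh.2.1]
  · rw [stepLen, if_neg hS]

/-- The supremum may not be attained. Halving it leaves a member of the set above the chosen length.
-/
theorem exists_stepLen_le (hS : (stepSet δ₁ ω).Nonempty) : ∃ h ∈ stepSet δ₁ ω, stepLen δ₁ ω ≤ h := by
  have h0 := stepLen_pos (δ₁ := δ₁) (ω := ω)
  rw [stepLen, if_pos hS] at h0 ⊢
  obtain ⟨h, hh, hlt⟩ := exists_lt_of_lt_csSup hS (show sSup (stepSet δ₁ ω) / 2 < _ by linarith)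
  exact ⟨h, hh, hlt.le⟩

end StepLength

/-! ### Control of the linear equation through δ₁, and cones for small Lipschitz constants. -/

namespace DichotomySystem

set_option linter.unusedSectionVars false

variable {M : Type v} [TopologicalSpace M] {φ : Flow ℝ≥0 M} {Z : Type u} [NormedAddCommGroup Z]
  [NormedSpace ℝ Z] [CompleteSpace Z] {C₁ : ℝ} {μs μu : M → ℝ}
  {𝒮 : DichotomySystem φ Z C₁ μs μu} {f : M → 𝒮.E → Z} {ω : M}

/-- δ/(1 - τδ) ≤ 1 means δ(1 + τ) ≤ 1, a form that is monotone in δ and no longer needs the case τδ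
≥ 1. A negative δ is replaced by 0 on both sides. -/
theorem delta₁_le_one_iff {h : ℝ} : 𝒮.delta₁ h ω ≤ 1 ↔ max (𝒮.δ h) 0 * (1 + 𝒮.tau ω) ≤ 1 := by
  have hτ := 𝒮.tau_nonneg ω
  rw [delta₁]
  split_ifs with hlt
  · rw [ENNReal.ofReal_le_one, div_le_one (by linarith)]
    rcases le_total (𝒮.δ h) 0 with hd | hd
    · rw [max_eq_right hd]
      have := mul_nonneg_of_nonpos_of_nonpos hd (neg_nonpos.2 hτ)
      constructor <;> intro _ <;> linarith
    · rw [max_eq_left hd]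
      constructor <;> intro _ <;> linarith
  · have hd : 0 < 𝒮.δ h := by
      by_contra hd
      have := mul_nonneg hτ (neg_nonneg.2 (not_lt.1 hd))
      linarith
    rw [max_eq_left hd.le]
    simp only [top_le_iff, ENNReal.one_ne_top, false_iff, not_le]
    linarith

theorem max_δ_mono {t h : ℝ} (ht : 0 < t) (hth : t ≤ h) : max (𝒮.δ t) 0 ≤ max (𝒮.δ h) 0 :=
  max_le_max (𝒮.isMR.mono ht (ht.trans_le hth) hth) le_rfl

variable {δ₁ : ℝ → M → ℝ≥0∞}

theorem stepSet_nonempty (hδ : ∀ t > 0, ∀ ω, 𝒮.delta₁ t ω = δ₁ t ω) :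
    (stepSet δ₁ ω).Nonempty := by
  have h1 : Tendsto (fun t => max (𝒮.δ t) 0 * (1 + 𝒮.tau ω)) (𝓝[>] 0) (𝓝 0) := by
    simpa using 𝒮.isMR.tendsto_max.mul_const (1 + 𝒮.tau ω)
  obtain ⟨h, h2, h3⟩ := ((h1.eventually_lt_const one_pos).and (Ioc_mem_nhdsGT one_pos)).exists
  exact ⟨h, h3.1, h3.2, (hδ h h3.1 ω) ▸ delta₁_le_one_iff.2 h2.le⟩

theorem max_δ_le_of_le_stepLen (hδ : ∀ t > 0, ∀ ω, 𝒮.delta₁ t ω = δ₁ t ω) {t : ℝ} (ht : 0 < t)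
    (hts : t ≤ stepLen δ₁ ω) : max (𝒮.δ t) 0 * (1 + 𝒮.tau ω) ≤ 1 := by
  obtain ⟨h, hh, hle⟩ := exists_stepLen_le (stepSet_nonempty (ω := ω) hδ)
  have h1 := delta₁_le_one_iff.1 ((hδ h hh.1 ω).trans_le hh.2.2)
  refine le_trans (mul_le_mul_of_nonneg_right (max_δ_mono ht (hts.trans hle)) ?_) h1
  linarith [𝒮.tau_nonneg ω]

/-- Finiteness of `δ₁(t₀, ·)` on a set bounds the length of the time steps from below. -/
theorem exists_uniform_step (hδ : ∀ t > 0, ∀ ω, 𝒮.delta₁ t ω = δ₁ t ω) {t₀ : ℝ} (ht₀ : 0 < t₀) :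
    ∃ h > 0, ∀ ω, δ₁ t₀ ω < ⊤ → h ≤ stepLen δ₁ ω := by
  -- Finiteness of δ₁(t₀, ω) says τ(ω)δ(t₀) < 1. Then δ(h) ≤ 1/2 and δ(h) ≤ δ(t₀)/2 give δ(h)(1 +
  -- τ(ω)) ≤ 1 with h independent of ω.
  obtain ⟨h, hh0, hh1, hhd, hht⟩ : ∃ h, 0 < h ∧ h ≤ 1 ∧ max (𝒮.δ h) 0 ≤ 1 / 2 ∧
      max (𝒮.δ h) 0 ≤ max (𝒮.δ t₀) 0 / 2 := by
    rcases (le_max_right (𝒮.δ t₀) 0).eq_or_lt with h0 | h0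
    · refine ⟨min t₀ 1, by positivity, min_le_right _ _, ?_⟩
      have h1 := max_δ_mono (𝒮 := 𝒮) (show 0 < min t₀ 1 by positivity) (min_le_left _ _)
      rw [← h0] at h1 ⊢
      constructor <;> linarith
    · have h1 := 𝒮.isMR.tendsto_max.eventually_lt_const (show (0 : ℝ) < 1 / 2 by norm_num)
      have h2 := 𝒮.isMR.tendsto_max.eventually_lt_const (half_pos h0)
      obtain ⟨h, ⟨h3, h4⟩, h5⟩ := ((h1.and h2).and (Ioc_mem_nhdsGT one_pos)).exists
      exact ⟨h, h5.1, h5.2, h3.le, h4.le⟩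
  refine ⟨h / 2, half_pos hh0, fun ω hω => half_le_stepLen ⟨hh0, hh1, ?_⟩⟩
  rw [← hδ h hh0, delta₁_le_one_iff]
  rw [← hδ t₀ ht₀, delta₁] at hω
  split_ifs at hω with hlt
  · have hτ := 𝒮.tau_nonneg ω
    have h1 : 𝒮.tau ω * max (𝒮.δ t₀) 0 ≤ 1 := by
      rcases le_total (𝒮.δ t₀) 0 with hd | hd
      · rw [max_eq_right hd, mul_zero]; exact zero_le_one
      · rw [max_eq_left hd]; exact hlt.le
    have h2 := mul_le_mul_of_nonneg_left hht hτ
    linarith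
  · exact absurd hω (lt_irrefl _)

variable {a u τ ε b : ℝ}

theorem stepError_le (hε : 0 ≤ ε) {t : ℝ} (ht0 : 0 ≤ t) (ht1 : t ≤ 1)
    (hD : max (𝒮.δ t) 0 * (1 + τ) ≤ 1) :
    τ * max (𝒮.δ t) 0 < 1 ∧
      𝒮.stepError u τ ε t ≤ max C₁ 1 * Real.exp (|a| + |u|) * ε := by
  have hC := 𝒮.dichotomy.angle_pos
  have h0 := le_max_right (𝒮.δ t) 0
  have hlt : τ * max (𝒮.δ t) 0 < 1 := by
    rcases h0.eq_or_lt with h0 | h0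
    · rw [← h0, mul_zero]; exact one_pos
    · linarith
  refine ⟨hlt, ?_⟩
  have h1 : max (𝒮.δ t) 0 / (1 - τ * max (𝒮.δ t) 0) ≤ 1 := by
    rw [div_le_one (by linarith)]; linarith
  have h1' : 0 ≤ max (𝒮.δ t) 0 / (1 - τ * max (𝒮.δ t) 0) := div_nonneg h0 (by linarith)
  have h2 : max 1 (Real.exp (-u * t)) ≤ Real.exp (|a| + |u|) := by
    refine max_le (Real.one_le_exp (by positivity)) (Real.exp_le_exp.2 ?_)
    calc -u * t ≤ |u| * t := mul_le_mul_of_nonneg_right (neg_le_abs u) ht0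
      _ ≤ |u| := mul_le_of_le_one_right (abs_nonneg u) ht1
      _ ≤ |a| + |u| := le_add_of_nonneg_left (abs_nonneg a)
  have h3 : 0 ≤ max 1 (Real.exp (-u * t)) := by positivity
  calc 𝒮.stepError u τ ε t
      ≤ max C₁ 1 * ε * 1 * Real.exp (|a| + |u|) := by
        rw [stepError]
        gcongr
        exact le_max_left _ _
    _ = _ := by ring

/-- The cone conditions, when the Lipschitz constant is below the threshold. -/
theorem satisfiesAB_of_small (hB : 𝒮.OrbitBounds f ω a u τ ε) {h η G ρ ε₁ : ℝ}
    (hh : 0 < h) (hh1 : h ≤ 1) (hD : ∀ t, 0 < t → t ≤ h → max (𝒮.δ t) 0 * (1 + τ) ≤ 1)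
    (hη : 0 < η) (hgap : 2 * η ≤ u - a) (hG : 0 < G) (hG1 : G ≤ 1) (hηG : 8 * (η * h) ≤ G)
    (hGε : G ≤ (u - a - η) * ε₁) (hρ0 : 0 ≤ ρ) (hρ1 : ρ ≤ 1 / 2)
    (hε : ε ≤ ρ * lipThreshold C₁ (|a| + |u|) (η * h) G) (hb : 0 ≤ b)
    {R : Set ((𝒮.X ω × 𝒮.Y ω) × (𝒮.X (orb φ b ω) × 𝒮.Y (orb φ b ω)))}
    (hR : ∀ p ∈ R, ∃ z : ℝ → 𝒮.E, 𝒮.IsVar b ω z (fun s => f (orb φ s ω) (z s)) ∧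
      z 0 = (p.1.1 : 𝒮.E) + (p.1.2 : 𝒮.E) ∧ z b = (p.2.1 : 𝒮.E) + (p.2.2 : 𝒮.E)) :
    SatisfiesAB R (ρ * Real.exp (-G / 2)) ρ (2 * Real.exp ((-u + η) * b))
      (ρ * Real.exp (-G / 2)) ρ (2 * Real.exp ((a + η) * b)) ∧
    (ε₁ ≤ b → SatisfiesAB R ρ (ρ * Real.exp (-G / 2)) (2 * Real.exp ((-u + η) * b))
      ρ (ρ * Real.exp (-G / 2)) (2 * Real.exp ((a + η) * b))) := by
  have hε0 := hB.ε_nonneg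
  have hlt : ∀ t, 0 < t → t ≤ h → τ * max (𝒮.δ t) 0 < 1 := fun t ht hth =>
    (stepError_le (a := a) (u := u) hε0 ht.le (hth.trans hh1) (hD t ht hth)).1
  have hle : ∀ t, 0 < t → t ≤ h →
      𝒮.stepError u τ ε t ≤ max C₁ 1 * Real.exp (|a| + |u|) * ε := fun t ht hth =>
    (stepError_le hε0 ht.le (hth.trans hh1) (hD t ht hth)).2
  have hC : 0 < max C₁ 1 * Real.exp (|a| + |u|) := mul_pos (by positivity) (Real.exp_pos _)
  have hκ0 : 0 ≤ max C₁ 1 * Real.exp (|a| + |u|) * ε := mul_nonneg hC.le hε0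
  have hκ : max C₁ 1 * Real.exp (|a| + |u|) * ε ≤
      ρ * coneThreshold (|a| + |u|) (η * h) G := by
    refine (mul_le_mul_of_nonneg_left hε hC.le).trans_eq ?_
    rw [lipThreshold]
    field_simp
  have hexp : Real.exp (-G / 2) ≤ 1 := Real.exp_le_one_iff.2 (by linarith)
  have hA : ∀ p q, ConePair a u (𝒮.stepError u τ ε) h b p q →
      (p 0 ≤ ρ * Real.exp (-G / 2) * q 0 → p b ≤ ρ * q b) ∧
      (p 0 ≤ ρ * q 0 → q 0 ≤ 2 * Real.exp ((-u + η) * b) * q b) ∧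
      (ε₁ ≤ b → p 0 ≤ ρ * q 0 → p b ≤ ρ * Real.exp (-G / 2) * q b) := fun p q H =>
    (H.mono le_rfl hle).cone_conditions hb hκ0 hh hh1 hη hgap hG hG1 hηG hGε hρ0 hρ1 hκ
  have hA' : ∀ p q, ConePair (-u) (-a) (𝒮.stepError u τ ε) h b p q →
      (p 0 ≤ ρ * Real.exp (-G / 2) * q 0 → p b ≤ ρ * q b) ∧
      (p 0 ≤ ρ * q 0 → q 0 ≤ 2 * Real.exp ((a + η) * b) * q b) ∧
      (ε₁ ≤ b → p 0 ≤ ρ * q 0 → p b ≤ ρ * Real.exp (-G / 2) * q b) := fun p q H => by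
    have h1 := (H.mono le_rfl hle).cone_conditions hb hκ0 hh hh1 hη (by linarith) hG hG1 hηG
      (show G ≤ (-a - -u - η) * ε₁ by rwa [neg_sub_neg]) hρ0 hρ1
      (by rwa [abs_neg, abs_neg, add_comm |u|])
    rwa [neg_neg] at h1
  have hsmall : ∀ p q : ℝ → ℝ, 0 ≤ q 0 → p 0 ≤ ρ * Real.exp (-G / 2) * q 0 → p 0 ≤ ρ * q 0 :=
    fun p q hq hp => hp.trans
      (mul_le_mul_of_nonneg_right (mul_le_of_le_one_right hρ0 hexp) hq)
  refine ⟨satisfiesAB_of_conePair hB hlt hR (fun p q H hp => ⟨(hA p q H).1 hp,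
      (hA p q H).2.1 (hsmall p q (H.q_nonneg 0) hp)⟩) (fun p q H hp => ⟨(hA' p q H).1 hp,
      (hA' p q H).2.1 (hsmall p q (H.q_nonneg 0) hp)⟩), fun hεb =>
    satisfiesAB_of_conePair hB hlt hR (fun p q H hp => ⟨(hA p q H).2.2 hεb hp,
      (hA p q H).2.1 hp⟩) (fun p q H hp => ⟨(hA' p q H).2.2 hεb hp, (hA' p q H).2.1 hp⟩)⟩

end DichotomySystem

/-! ### Admissible cone functions -/

section Admissible

set_option linter.unusedSectionVars false

variable {M : Type v} [TopologicalSpace M] {φ : Flow ℝ≥0 M} {C₁ : ℝ} {μs μu : M → ℝ}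

/-- Growth rates `a`, `u` of the linear cocycles along forward orbits, with a margin `η'`, and
corresponding contraction factors, which may be smaller on trivial spectral spaces. -/
structure IsRateChoice (φ : Flow ℝ≥0 M) (C₁ : ℝ) (μs μu η' a u lamS lamU : M → ℝ) : Prop where
  le_μs : ∀ ω, a ω ≤ μs ω
  μu_le : ∀ ω, μu ω ≤ u ω
  lamS_nonneg : ∀ ω, 0 ≤ lamS ω
  lamU_nonneg : ∀ ω, 0 ≤ lamU ω
  lamS_le : ∀ ω, lamS ω ≤ Real.exp (μs ω + η' ω)
  lamU_le : ∀ ω, lamU ω ≤ Real.exp (-μu ω + η' ω)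
  stable : ∀ (Z : Type u) [NormedAddCommGroup Z] [NormedSpace ℝ Z] [CompleteSpace Z]
    (𝒮 : DichotomySystem φ Z C₁ μs μu) (ω : M), ∀ t ≥ 0, ∀ r ≥ 0,
      ∀ x ∈ (𝒮.P (orb φ r ω)).range, ‖𝒮.T t (orb φ r ω) x‖ ≤ Real.exp (a ω * t) * ‖x‖
  unstable : ∀ (Z : Type u) [NormedAddCommGroup Z] [NormedSpace ℝ Z] [CompleteSpace Z]
    (𝒮 : DichotomySystem φ Z C₁ μs μu) (ω : M), ∀ t ≥ 0, ∀ r ≥ 0,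
      ∀ y ∈ (𝒮.P (orb φ r ω)).ker, ‖y‖ ≤ Real.exp (-u ω * t) * ‖𝒮.T t (orb φ r ω) y‖
  exp_le_lamS : ∀ ω, Real.exp (a ω + η' ω) ≤ lamS ω ∨
    ∀ (Z : Type u) [NormedAddCommGroup Z] [NormedSpace ℝ Z] [CompleteSpace Z]
      (𝒮 : DichotomySystem φ Z C₁ μs μu), ∀ r ≥ 0, ∀ x ∈ (𝒮.P (orb φ r ω)).range, x = 0
  exp_le_lamU : ∀ ω, Real.exp (-u ω + η' ω) ≤ lamU ω ∨
    ∀ (Z : Type u) [NormedAddCommGroup Z] [NormedSpace ℝ Z] [CompleteSpace Z]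
      (𝒮 : DichotomySystem φ Z C₁ μs μu), ∀ r ≥ 0, ∀ y ∈ (𝒮.P (orb φ r ω)).ker, y = 0

/-- A constant margin that is compatible with the uniform bounds of the rates. -/
structure IsMargin (μs μu : M → ℝ) (κ : ℝ) : Prop where
  pos : 0 < κ
  gap : (∃ γ > 0, ∀ ω, γ ≤ μu ω - μs ω) → ∀ ω, 2 * κ ≤ μu ω - μs ω
  stable : (∃ γ > 0, ∀ ω, μs ω ≤ -γ) → ∀ ω, μs ω ≤ -κ
  unstable : (∃ γ > 0, ∀ ω, γ ≤ μu ω) → ∀ ω, κ ≤ μu ω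

theorem exists_margin_aux {g : M → ℝ} :
    ∃ κ > 0, (∃ γ > 0, ∀ ω, γ ≤ g ω) → ∀ ω, κ ≤ g ω := by
  by_cases h : ∃ γ > 0, ∀ ω, γ ≤ g ω
  · obtain ⟨γ, hγ, h⟩ := h
    exact ⟨γ, hγ, fun _ => h⟩
  · exact ⟨1, one_pos, fun h' => absurd h' h⟩

/-- One constant, fixed in advance, serves all implications of (e). Where a uniform bound fails, the
implication is void and imposes nothing. -/
theorem exists_isMargin (μs μu : M → ℝ) : ∃ κ, IsMargin μs μu κ := by
  obtain ⟨κ₁, h1, h1'⟩ := exists_margin_aux (g := fun ω => μu ω - μs ω)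
  obtain ⟨κ₂, h2, h2'⟩ := exists_margin_aux (g := fun ω => -μs ω)
  obtain ⟨κ₃, h3, h3'⟩ := exists_margin_aux (g := μu)
  have e1 := min_le_left (κ₁ / 2) (min κ₂ κ₃)
  have e2 := (min_le_right (κ₁ / 2) (min κ₂ κ₃)).trans (min_le_left _ _)
  have e3 := (min_le_right (κ₁ / 2) (min κ₂ κ₃)).trans (min_le_right _ _)
  refine ⟨min (κ₁ / 2) (min κ₂ κ₃), by positivity, fun h ω => ?_, fun h ω => ?_, fun h ω => ?_⟩
  · linarith [h1' h ω]
  · obtain ⟨γ, hγ, h⟩ := h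
    linarith [h2' ⟨γ, hγ, fun ω => by linarith [h ω]⟩ ω]
  · linarith [h3' h ω]

/-- The cone functions with apertures `ρ`, `ρ e^{-G/2}`. -/
noncomputable def coneFunctions (ρ : ℝ) (G ϑ lamS lamU : M → ℝ) : ConeFunctions M :=
  ⟨ϑ, fun ω => ρ * Real.exp (-G ω / 2), fun _ => ρ, fun ω => ρ * Real.exp (-G ω / 2), fun _ => ρ,
    fun _ => 2, lamS, lamU⟩

theorem subsingleton_submodule {E : Type*} [AddCommGroup E] [Module ℝ E] {p : Submodule ℝ E}
    (h : ∀ x ∈ p, x = 0) : Subsingleton p :=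
  ⟨fun x y => Subtype.ext ((h x x.2).trans (h y y.2).symm)⟩

variable {η η' ε₁ G a u lamS lamU ϑ : M → ℝ} {δ₁ : ℝ → M → ℝ≥0∞} {ρ : ℝ}

theorem conesHold_coneFunctions
    (hr : IsRateChoice.{u, v} φ C₁ μs μu η' a u lamS lamU) (hη'0 : ∀ ω, 0 < η' ω)
    (hgap : ∀ ω, 2 * η' ω ≤ μu ω - μs ω) (hε₁ : ∀ ω, 0 < ε₁ ω) (hG0 : ∀ ω, 0 < G ω)
    (hG1 : ∀ ω, G ω ≤ 1) (hG : ∀ ω, G ω ≤ (μu ω - μs ω - η' ω) * ε₁ ω) (hρ0 : 0 < ρ)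
    (hρ1 : ρ ≤ 1 / 2) (hϑ : ∀ ω, ϑ ω ≤ ρ * lipThreshold C₁ (|a ω| + |u ω|)
      (min (η' ω * stepLen δ₁ ω) (G ω / 8)) (G ω)) :
    ConeFunctions.ConesHold.{u, v} (coneFunctions ρ G ϑ lamS lamU) φ C₁ μs μu ε₁ δ₁ := by
  intro Z _ _ _ 𝒮 hδ f hf ω hεω s hs
  have hle := hr.le_μs ω
  have hle' := hr.μu_le ω
  have hη := hη'0 ω
  -- The first bound controls the linear equation, and the second makes the loss η'h per step at
  -- most G/8.
  set h := min (stepLen δ₁ ω) (G ω / (8 * η' ω)) with hh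
  have hh0 : 0 < h := lt_min stepLen_pos (div_pos (hG0 ω) (by linarith))
  have hh1 : h ≤ 1 := (min_le_left _ _).trans stepLen_le_one
  have hx : η' ω * h = min (η' ω * stepLen δ₁ ω) (G ω / 8) := by
    rw [hh, mul_min_of_nonneg _ _ hη.le]
    congr 1
    field_simp
  have hB : 𝒮.OrbitBounds f ω (a ω) (u ω) (𝒮.tau ω) (𝒮.eps f ω) :=
    ⟨hr.stable Z 𝒮 ω, hr.unstable Z 𝒮 ω, fun r _ => 𝒮.norm_L_le ω r, 𝒮.eps_nonneg f ω,
      fun r _ => 𝒮.norm_f_sub_le hf ω r⟩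
  have key : ∀ t ≥ 0, ∀ R : Set ((𝒮.X (orb φ s ω) × 𝒮.Y (orb φ s ω)) ×
      (𝒮.X (orb φ t (orb φ s ω)) × 𝒮.Y (orb φ t (orb φ s ω)))),
      (∀ p ∈ R, ∃ z : ℝ → 𝒮.E,
        𝒮.IsVar t (orb φ s ω) z (fun r => f (orb φ r (orb φ s ω)) (z r)) ∧
        z 0 = (p.1.1 : 𝒮.E) + (p.1.2 : 𝒮.E) ∧ z t = (p.2.1 : 𝒮.E) + (p.2.2 : 𝒮.E)) →
      SatisfiesAB R (ρ * Real.exp (-G ω / 2)) ρ (2 * lamU ω ^ t)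
        (ρ * Real.exp (-G ω / 2)) ρ (2 * lamS ω ^ t) ∧
      (ε₁ ω ≤ t → SatisfiesAB R ρ (ρ * Real.exp (-G ω / 2)) (2 * lamU ω ^ t)
        ρ (ρ * Real.exp (-G ω / 2)) (2 * lamS ω ^ t)) := by
    intro t ht R hR
    have h1 := DichotomySystem.satisfiesAB_of_small (hB.shift hs) (ρ := ρ)
      (ε₁ := ε₁ ω) hh0 hh1 (fun t ht hth => DichotomySystem.max_δ_le_of_le_stepLen hδ ht
        (hth.trans (min_le_left _ _))) hη (by linarith [hgap ω]) (hG0 ω) (hG1 ω)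
      (by rw [hx]; linarith [min_le_right (η' ω * stepLen δ₁ ω) (G ω / 8)])
      ((hG ω).trans (mul_le_mul_of_nonneg_right (by linarith) (hε₁ ω).le)) hρ0.le hρ1
      (by rw [hx]; exact hεω.le.trans (hϑ ω)) ht hR
    have hU : 2 * Real.exp ((-u ω + η' ω) * t) ≤ 2 * lamU ω ^ t ∨
        (0 ≤ 2 * lamU ω ^ t ∧ Subsingleton (𝒮.Y (orb φ s ω))) := by
      rcases hr.exp_le_lamU ω with h2 | h2
      · left
        rw [Real.exp_mul]
        exact mul_le_mul_of_nonneg_left (Real.rpow_le_rpow (Real.exp_pos _).le h2 ht) zero_le_two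
      · exact Or.inr ⟨mul_nonneg zero_le_two (Real.rpow_nonneg (hr.lamU_nonneg ω) t),
          subsingleton_submodule (h2 Z 𝒮 s hs)⟩
    have hS : 2 * Real.exp ((a ω + η' ω) * t) ≤ 2 * lamS ω ^ t ∨
        (0 ≤ 2 * lamS ω ^ t ∧ Subsingleton (𝒮.X (orb φ t (orb φ s ω)))) := by
      rcases hr.exp_le_lamS ω with h2 | h2
      · left
        rw [Real.exp_mul]
        exact mul_le_mul_of_nonneg_left (Real.rpow_le_rpow (Real.exp_pos _).le h2 ht) zero_le_two
      · refine Or.inr ⟨mul_nonneg zero_le_two (Real.rpow_nonneg (hr.lamS_nonneg ω) t),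
          subsingleton_submodule ?_⟩
        rw [orb_orb φ hs ht]
        exact h2 Z 𝒮 (s + t) (add_nonneg hs ht)
    exact ⟨h1.1.improve hU hS, fun h => (h1.2 h).improve hU hS⟩
  refine ⟨fun t ht => ?_, fun t ht => ?_⟩
  · exact ⟨(key t ht _ (DichotomySystem.exists_isVar_of_mem_H hf ht)).1,
      (key t ht _ (DichotomySystem.exists_isVar_of_mem_U hf)).1⟩
  · have ht0 : 0 ≤ t := (hε₁ ω).le.trans ht
    exact ⟨(key t ht0 _ (DichotomySystem.exists_isVar_of_mem_H hf ht0)).2 ht,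
      (key t ht0 _ (DichotomySystem.exists_isVar_of_mem_U hf)).2 ht⟩

/-- Admissibility, apart from the cone conditions. -/
theorem admissible_of_conesHold (hr : IsRateChoice.{u, v} φ C₁ μs μu η' a u lamS lamU)
    {κ : ℝ} (hκ : IsMargin μs μu κ) (hη'0 : ∀ ω, 0 < η' ω) (hη' : ∀ ω, η' ω ≤ η ω / 2)
    (hη'κ : ∀ ω, η' ω ≤ κ / 2) (hgap : ∀ ω, 0 < μu ω - μs ω - 2 * η ω)
    (hG0 : ∀ ω, 0 < G ω) (hρ0 : 0 < ρ) (hρ1 : ρ ≤ 1 / 2) (hϑ0 : ∀ ω, 0 < ϑ ω)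
    (hc : ConeFunctions.ConesHold.{u, v} (coneFunctions ρ G ϑ lamS lamU) φ C₁ μs μu ε₁ δ₁) :
    ConeFunctions.Admissible.{u, v} (coneFunctions ρ G ϑ lamS lamU) φ C₁ μs μu η ε₁ δ₁ := by
  have hα : ∀ ω, ρ * Real.exp (-G ω / 2) < ρ := fun ω =>
    mul_lt_of_lt_one_right hρ0 (Real.exp_lt_one_iff.2 (by linarith [hG0 ω]))
  have hmul : ∀ ω, lamS ω * lamU ω ≤ Real.exp (2 * η' ω - (μu ω - μs ω)) := fun ω => by
    refine (mul_le_mul (hr.lamS_le ω) (hr.lamU_le ω) (hr.lamU_nonneg ω)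
      (Real.exp_pos _).le).trans_eq ?_
    rw [← Real.exp_add]; ring_nf
  have hκ0 := hκ.pos
  exact {
    ϑ_pos := hϑ0
    α_pos := fun ω => mul_pos hρ0 (Real.exp_pos _)
    α_lt := hα
    β_pos := fun ω => mul_pos hρ0 (Real.exp_pos _)
    β_lt := hα
    sup_lt_one := ⟨1 / 2, by norm_num, fun ω => ⟨hρ1, hρ1⟩⟩
    k_pos := fun ω => zero_lt_two
    lamS_nonneg := hr.lamS_nonneg
    lamU_nonneg := hr.lamU_nonneg
    lamS_le := fun ω => (hr.lamS_le ω).trans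
      (Real.exp_le_exp.2 (by linarith [hη' ω, hη'0 ω]))
    lamU_le := fun ω => (hr.lamU_le ω).trans
      (Real.exp_le_exp.2 (by linarith [hη' ω, hη'0 ω]))
    mul_lt_one := fun ω => (hmul ω).trans_lt
      (Real.exp_lt_one_iff.2 (by linarith [hη' ω, hη'0 ω, hgap ω]))
    sup_mul_lt_one := fun h => ⟨Real.exp (-κ), Real.exp_lt_one_iff.2 (by linarith), fun ω =>
      (hmul ω).trans (Real.exp_le_exp.2 (by linarith [hη'κ ω, hκ.gap h ω]))⟩
    sup_lamS_lt_one := fun h => ⟨Real.exp (-κ / 2), Real.exp_lt_one_iff.2 (by linarith), fun ω =>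
      (hr.lamS_le ω).trans (Real.exp_le_exp.2 (by linarith [hη'κ ω, hκ.stable h ω]))⟩
    sup_lamU_lt_one := fun h => ⟨Real.exp (-κ / 2), Real.exp_lt_one_iff.2 (by linarith), fun ω =>
      (hr.lamU_le ω).trans (Real.exp_le_exp.2 (by linarith [hη'κ ω, hκ.unstable h ω]))⟩
    cones := hc }

/-- The rates given by the dichotomy itself. -/
theorem isRateChoice_self (φ : Flow ℝ≥0 M) (C₁ : ℝ) (μs μu η' : M → ℝ) :
    IsRateChoice.{u, v} φ C₁ μs μu η' μs μu (fun ω => Real.exp (μs ω + η' ω))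
      fun ω => Real.exp (-μu ω + η' ω) where
  le_μs _ := le_rfl
  μu_le _ := le_rfl
  lamS_nonneg _ := (Real.exp_pos _).le
  lamU_nonneg _ := (Real.exp_pos _).le
  lamS_le _ := le_rfl
  lamU_le _ := le_rfl
  stable _ _ _ _ 𝒮 ω := 𝒮.dichotomy.stable ω
  unstable _ _ _ _ 𝒮 ω := 𝒮.dichotomy.unstable ω
  exp_le_lamS _ := Or.inl le_rfl
  exp_le_lamU _ := Or.inl le_rfl

end Admissible

/-! ### Rates over the past of a point -/

section Past

variable {M : Type v} [TopologicalSpace M] (φ : Flow ℝ≥0 M)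

/-- The values of `g` along the past of `ω`. -/
def pastValues (g : M → ℝ) (ω : M) : Set ℝ := {x | ∃ (s : ℝ≥0) (ω₀ : M), φ s ω₀ = ω ∧ g ω₀ = x}

/-- The infimum of `g` along the past of `ω`. -/
noncomputable def pastInf (g : M → ℝ) (ω : M) : ℝ := sInf (pastValues φ g ω)

open Classical in
/-- The infimum of `g` along the past of `ω`, replaced by `g ω` if it is not finite. -/
noncomputable def pastRate (g : M → ℝ) (ω : M) : ℝ :=
  if BddBelow (pastValues φ g ω) then pastInf φ g ω else g ω

variable {φ} {g : M → ℝ} {ω : M}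

theorem self_mem_pastValues : g ω ∈ pastValues φ g ω := ⟨0, ω, φ.map_zero_apply ω, rfl⟩

theorem pastValues_subset (s : ℝ≥0) : pastValues φ g ω ⊆ pastValues φ g (φ s ω) := by
  rintro x ⟨r, ω₀, rfl, rfl⟩
  exact ⟨s + r, ω₀, φ.map_add s r ω₀, rfl⟩

theorem bddBelow_pastValues (h0 : ∀ ω, 0 ≤ g ω) : BddBelow (pastValues φ g ω) :=
  ⟨0, by rintro x ⟨s, ω₀, -, rfl⟩; exact h0 ω₀⟩

theorem pastInf_le (h0 : ∀ ω, 0 ≤ g ω) : pastInf φ g ω ≤ g ω :=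
  csInf_le (bddBelow_pastValues h0) self_mem_pastValues

theorem le_pastInf {c : ℝ} (h : ∀ (s : ℝ≥0) (ω₀ : M), φ s ω₀ = ω → c ≤ g ω₀) :
    c ≤ pastInf φ g ω :=
  le_csInf ⟨_, self_mem_pastValues⟩ (by rintro x ⟨s, ω₀, h1, rfl⟩; exact h s ω₀ h1)

theorem decreasingAlong_pastInf (h0 : ∀ ω, 0 ≤ g ω) : DecreasingAlong φ (pastInf φ g) :=
  fun s _ => csInf_le_csInf (bddBelow_pastValues h0) ⟨_, self_mem_pastValues⟩ (pastValues_subset s)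

theorem pastRate_le : pastRate φ g ω ≤ g ω := by
  rw [pastRate]
  split_ifs with h
  · exact csInf_le h self_mem_pastValues
  · exact le_rfl

theorem abs_pastRate_le {C : ℝ} (h : ∀ (s : ℝ≥0) (ω₀ : M), φ s ω₀ = ω → |g ω₀| ≤ C) :
    |pastRate φ g ω| ≤ C := by
  have hω := h 0 ω (φ.map_zero_apply ω)
  rw [pastRate]
  split_ifs
  · refine abs_le.2 ⟨le_pastInf fun s ω₀ hs => (abs_le.1 (h s ω₀ hs)).1, ?_⟩
    refine (csInf_le ⟨-C, ?_⟩ self_mem_pastValues).trans (abs_le.1 hω).2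
    rintro x ⟨s, ω₀, hs, rfl⟩
    exact (abs_le.1 (h s ω₀ hs)).1
  · exact hω

theorem exp_pastRate_le (hb : BddBelow (pastValues φ g ω)) :
    Real.exp (pastRate φ g ω) ≤ pastInf φ (fun ω => Real.exp (g ω)) ω := by
  rw [pastRate, if_pos hb]
  exact le_pastInf fun s ω₀ hs => Real.exp_le_exp.2 (csInf_le hb ⟨s, ω₀, hs, rfl⟩)

/-- An estimate valid with every rate of the past holds with their infimum, by continuity in the
rate. -/
theorem le_exp_pastRate {N t c : ℝ} (ht : 0 ≤ t) (hc : 0 ≤ c)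
    (h : ∀ (s : ℝ≥0) (ω₀ : M), φ s ω₀ = ω → N ≤ Real.exp (g ω₀ * t) * c) :
    N ≤ Real.exp (pastRate φ g ω * t) * c := by
  rw [pastRate]
  split_ifs with hb
  · have h1 : ∀ x > pastInf φ g ω, N ≤ Real.exp (x * t) * c := by
      intro x hx
      obtain ⟨-, ⟨s, ω₀, hs, rfl⟩, hlt⟩ := exists_lt_of_csInf_lt ⟨_, self_mem_pastValues⟩ hx
      exact (h s ω₀ hs).trans (mul_le_mul_of_nonneg_right
        (Real.exp_le_exp.2 (mul_le_mul_of_nonneg_right hlt.le ht)) hc)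
    have h2 : Continuous fun x => Real.exp (x * t) * c := by fun_prop
    have h3 : Tendsto (fun x => Real.exp (x * t) * c) (𝓝[>] (pastInf φ g ω)) _ :=
      (h2.tendsto (pastInf φ g ω)).mono_left nhdsWithin_le_nhds
    exact ge_of_tendsto h3 (eventually_mem_nhdsWithin.mono h1)
  · exact h 0 ω (φ.map_zero_apply ω)

/-- With rates tending to -∞ the exponential bound tends to 0. Applied to norms, this makes the
corresponding spectral space trivial. -/
theorem nonpos_of_not_bddBelow {N t c : ℝ} (ht : 0 < t) (hc : 0 ≤ c)
    (hb : ¬BddBelow (pastValues φ g ω))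
    (h : ∀ (s : ℝ≥0) (ω₀ : M), φ s ω₀ = ω → N ≤ Real.exp (g ω₀ * t) * c) : N ≤ 0 := by
  have h1 : ∀ x : ℝ, N ≤ Real.exp (x * t) * c := by
    intro x
    obtain ⟨-, ⟨s, ω₀, hs, rfl⟩, hlt⟩ := not_bddBelow_iff.1 hb x
    exact (h s ω₀ hs).trans (mul_le_mul_of_nonneg_right
      (Real.exp_le_exp.2 (mul_le_mul_of_nonneg_right hlt.le ht.le)) hc)
  have h2 : Tendsto (fun x => Real.exp (x * t) * c) atBot (𝓝 0) := by
    simpa using (Real.tendsto_exp_atBot.comp (tendsto_id.atBot_mul_const ht)).mul_const c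
  exact ge_of_tendsto h2 (Eventually.of_forall h1)

theorem orb_past {s : ℝ≥0} {ω₀ : M} (hs : φ s ω₀ = ω) {r : ℝ} (hr : 0 ≤ r) :
    orb φ r ω = orb φ (s + r) ω₀ := by
  rw [← orb_orb φ s.coe_nonneg hr, ← hs]
  simp [orb]

variable {C₁ : ℝ} {μs μu η' : M → ℝ}

/-- The best rates over the past. -/
theorem isRateChoice_past (φ : Flow ℝ≥0 M) (C₁ : ℝ) (μs μu η' : M → ℝ) :
    IsRateChoice.{u, v} φ C₁ μs μu η' (pastRate φ μs) (fun ω => -pastRate φ (fun ω => -μu ω) ω)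
      (fun ω => Real.exp (η' ω) * pastInf φ (fun ω => Real.exp (μs ω)) ω)
      fun ω => Real.exp (η' ω) * pastInf φ (fun ω => Real.exp (-μu ω)) ω := by
  have h0 : ∀ (g : M → ℝ) (ω : M), 0 ≤ Real.exp (g ω) := fun g ω => (Real.exp_pos _).le
  have hS : ∀ (Z : Type u) [NormedAddCommGroup Z] [NormedSpace ℝ Z] [CompleteSpace Z]
      (𝒮 : DichotomySystem φ Z C₁ μs μu) (ω : M), ∀ t ≥ 0, ∀ r ≥ 0,
      ∀ x ∈ (𝒮.P (orb φ r ω)).range, ∀ (s : ℝ≥0) (ω₀ : M), φ s ω₀ = ω →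
      ‖𝒮.T t (orb φ r ω) x‖ ≤ Real.exp (μs ω₀ * t) * ‖x‖ := by
    intro Z _ _ _ 𝒮 ω t ht r hr x hx s ω₀ hs
    rw [orb_past hs hr] at hx ⊢
    exact 𝒮.dichotomy.stable ω₀ t ht _ (add_nonneg s.2 hr) x hx
  have hU : ∀ (Z : Type u) [NormedAddCommGroup Z] [NormedSpace ℝ Z] [CompleteSpace Z]
      (𝒮 : DichotomySystem φ Z C₁ μs μu) (ω : M), ∀ t ≥ 0, ∀ r ≥ 0,
      ∀ y ∈ (𝒮.P (orb φ r ω)).ker, ∀ (s : ℝ≥0) (ω₀ : M), φ s ω₀ = ω →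
      ‖y‖ ≤ Real.exp (-μu ω₀ * t) * ‖𝒮.T t (orb φ r ω) y‖ := by
    intro Z _ _ _ 𝒮 ω t ht r hr x hx s ω₀ hs
    rw [orb_past hs hr] at hx ⊢
    exact 𝒮.dichotomy.unstable ω₀ t ht _ (add_nonneg s.2 hr) x hx
  refine ⟨fun ω => pastRate_le, fun ω => ?_, fun ω => ?_, fun ω => ?_, fun ω => ?_, fun ω => ?_,
    fun Z _ _ _ 𝒮 ω t ht r hr x hx => ?_, fun Z _ _ _ 𝒮 ω t ht r hr y hy => ?_, fun ω => ?_,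
    fun ω => ?_⟩
  · exact le_neg_of_le_neg (pastRate_le (g := fun ω => -μu ω))
  · exact mul_nonneg (Real.exp_pos _).le (le_pastInf fun _ _ _ => (Real.exp_pos _).le)
  · exact mul_nonneg (Real.exp_pos _).le (le_pastInf fun _ _ _ => (Real.exp_pos _).le)
  · rw [Real.exp_add, mul_comm]
    exact mul_le_mul_of_nonneg_right (pastInf_le (h0 _)) (Real.exp_pos _).le
  · rw [Real.exp_add, mul_comm]
    exact mul_le_mul_of_nonneg_right (pastInf_le (h0 _)) (Real.exp_pos _).le
  · exact le_exp_pastRate ht (norm_nonneg _) (hS Z 𝒮 ω t ht r hr x hx)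
  · rw [neg_neg]
    exact le_exp_pastRate (g := fun ω => -μu ω) ht (norm_nonneg _) (hU Z 𝒮 ω t ht r hr y hy)
  · by_cases hb : BddBelow (pastValues φ μs ω)
    · left
      rw [Real.exp_add, mul_comm]
      exact mul_le_mul_of_nonneg_left (exp_pastRate_le hb) (Real.exp_pos _).le
    · right
      intro Z _ _ _ 𝒮 r hr x hx
      obtain ⟨hT, hT0⟩ := 𝒮.isVar_cocycle (b := 1) (orb φ r ω) x
      -- In the stable case the estimate only kills the solution at positive times, and continuity
      -- at t = 0 then gives x = 0.
      have h1 : ∀ t > 0, 𝒮.T t (orb φ r ω) x = 0 := fun t ht => norm_le_zero_iff.1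
        (nonpos_of_not_bddBelow ht (norm_nonneg x) hb (hS Z 𝒮 ω t ht.le r hr x hx))
      have h2 := (hT.cont 0 ⟨le_rfl, zero_le_one⟩).mono_left
        (nhdsWithin_mono 0 (Ioc_subset_Icc_self (a := (0 : ℝ)) (b := 1)))
      simp only [hT0] at h2
      rw [nhdsWithin_Ioc_eq_nhdsGT one_pos] at h2
      refine tendsto_nhds_unique h2 (tendsto_const_nhds.congr' ?_)
      filter_upwards [self_mem_nhdsWithin] with t ht
      exact (h1 t ht).symm
  · by_cases hb : BddBelow (pastValues φ (fun ω => -μu ω) ω)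
    · left
      rw [neg_neg, Real.exp_add, mul_comm]
      exact mul_le_mul_of_nonneg_left (exp_pastRate_le hb) (Real.exp_pos _).le
    · right
      intro Z _ _ _ 𝒮 r hr y hy
      exact norm_le_zero_iff.1 (nonpos_of_not_bddBelow one_pos (norm_nonneg _) hb
        (hU Z 𝒮 ω 1 zero_le_one r hr y hy))

theorem decreasingAlong_exp_mul_pastInf {η' g : M → ℝ} (hη' : DecreasingAlong φ η') :
    DecreasingAlong φ fun ω => Real.exp (η' ω) * pastInf φ (fun ω => Real.exp (g ω)) ω :=
  fun s ω => mul_le_mul (Real.exp_le_exp.2 (hη' s ω))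
    (decreasingAlong_pastInf (fun _ => (Real.exp_pos _).le) s ω)
    (le_pastInf fun _ _ _ => (Real.exp_pos _).le) (Real.exp_pos _).le

end Past

/-! ### Almost uniform continuity -/

/-- At small scales both amplitudes are below any c > ξ, so that of g is at most 2Cc, and c → ξ. -/
theorem LocallyMetrizable.AlmostUniformlyContinuous.of_abs_sub_le {M : Type v} [TopologicalSpace M]
    {loc : LocallyMetrizable M} {M₁ : Set M} {ξ C : ℝ} {g g₁ g₂ : M → ℝ} (hξ : 0 ≤ ξ) (hC : 0 ≤ C)
    (hg : ∀ m m₀, |g m - g m₀| ≤ C * (|g₁ m - g₁ m₀| + |g₂ m - g₂ m₀|))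
    (h₁ : loc.AlmostUniformlyContinuous M₁ ξ g₁) (h₂ : loc.AlmostUniformlyContinuous M₁ ξ g₂) :
    loc.AlmostUniformlyContinuous M₁ (2 * C * ξ) g := by
  have key : ∀ c > ξ, limsup (loc.amplitude M₁ g) (𝓝[>] (0 : ℝ)) ≤ ENNReal.ofReal (2 * C * c) := by
    intro c hc
    have hlt : ENNReal.ofReal ξ < ENNReal.ofReal c :=
      (ENNReal.ofReal_lt_ofReal_iff (hξ.trans_lt hc)).2 hc
    refine limsup_le_of_le (by isBoundedDefault) ?_
    filter_upwards [eventually_lt_of_limsup_lt (lt_of_le_of_lt h₁ hlt),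
      eventually_lt_of_limsup_lt (lt_of_le_of_lt h₂ hlt)] with σ e₁ e₂
    have hamp : ∀ {g' : M → ℝ}, loc.amplitude M₁ g' σ < ENNReal.ofReal c → ∀ m₀ ∈ M₁,
        ∀ m ∈ loc.smallBall m₀ σ, |g' m - g' m₀| ≤ c := by
      intro g' hg' m₀ hm₀ m hm
      have h3 : ENNReal.ofReal |g' m - g' m₀| ≤ loc.amplitude M₁ g' σ :=
        le_iSup₂_of_le m₀ hm₀ (le_iSup₂_of_le m hm le_rfl)
      exact (ENNReal.ofReal_le_ofReal_iff (hξ.trans hc.le)).1 (h3.trans hg'.le)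
    refine iSup₂_le fun m₀ hm₀ => iSup₂_le fun m hm => ENNReal.ofReal_le_ofReal ?_
    refine (hg m m₀).trans ?_
    have := mul_le_mul_of_nonneg_left (add_le_add (hamp e₁ m₀ hm₀ m hm) (hamp e₂ m₀ hm₀ m hm)) hC
    linarith
  have h3 : Continuous fun c : ℝ => ENNReal.ofReal (2 * C * c) :=
    ENNReal.continuous_ofReal.comp (by fun_prop)
  have h4 : Tendsto (fun c : ℝ => ENNReal.ofReal (2 * C * c)) (𝓝[>] ξ) _ :=
    (h3.tendsto ξ).mono_left nhdsWithin_le_nhds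
  exact ge_of_tendsto h4 (eventually_mem_nhdsWithin.mono key)

theorem abs_exp_sub_exp_le {x y K : ℝ} (hx : x ≤ K) (hy : y ≤ K) :
    |Real.exp x - Real.exp y| ≤ Real.exp K * |x - y| := by
  have key : ∀ {x y : ℝ}, x ≤ K → y ≤ x → Real.exp x - Real.exp y ≤ Real.exp K * (x - y) := by
    intro x y hx hyx
    have h1 := Real.add_one_le_exp (y - x)
    have h2 : Real.exp y = Real.exp x * Real.exp (y - x) := by rw [← Real.exp_add]; ring_nf
    have h3 := mul_le_mul_of_nonneg_right (Real.exp_le_exp.2 hx) (sub_nonneg.2 hyx)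
    have h4 := mul_le_mul_of_nonneg_left h1 (Real.exp_pos x).le
    linarith
  rcases le_total y x with h | h
  · rw [abs_of_nonneg (sub_nonneg.2 (Real.exp_le_exp.2 h)), abs_of_nonneg (sub_nonneg.2 h)]
    exact key hx h
  · rw [abs_sub_comm, abs_sub_comm x, abs_of_nonneg (sub_nonneg.2 (Real.exp_le_exp.2 h)),
      abs_of_nonneg (sub_nonneg.2 h)]
    exact key hy h

/-! ### The general case -/

section General

set_option linter.unusedSectionVars false

variable {M : Type v} [TopologicalSpace M] {φ : Flow ℝ≥0 M} {C₁ κ : ℝ} {μs μu η ε₁ : M → ℝ}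
  {δ₁ : ℝ → M → ℝ≥0∞}

/-- The margin of the rates. -/
noncomputable def rateMargin (η : M → ℝ) (κ : ℝ) (ω : M) : ℝ := min (η ω) κ / 2

/-- The gain of the cones. -/
noncomputable def pointwiseGain (η ε₁ : M → ℝ) (κ : ℝ) (ω : M) : ℝ :=
  min 1 (2 * rateMargin η κ ω * ε₁ ω)

/-- The threshold for the Lipschitz constant, for cones of aperture `1`. -/
noncomputable def thresholdFn (C₁ : ℝ) (δ₁ : ℝ → M → ℝ≥0∞) (a u η' G : M → ℝ) (ω : M) : ℝ :=
  lipThreshold C₁ (|a ω| + |u ω|) (min (η' ω * stepLen δ₁ ω) (G ω / 8)) (G ω)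

theorem rateMargin_pos (hη : ∀ ω, 0 < η ω) (hκ : 0 < κ) (ω : M) : 0 < rateMargin η κ ω :=
  half_pos (lt_min (hη ω) hκ)

theorem decreasingAlong_rateMargin (hη : DecreasingAlong φ η) (κ : ℝ) :
    DecreasingAlong φ (rateMargin η κ) := fun s ω => by
  have := min_le_min_right κ (hη s ω)
  rw [rateMargin, rateMargin]
  linarith

theorem pointwiseGain_pos (hη : ∀ ω, 0 < η ω) (hκ : 0 < κ) (hε₁ : ∀ ω, 0 < ε₁ ω) (ω : M) :
    0 < pointwiseGain η ε₁ κ ω :=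
  lt_min one_pos (mul_pos (mul_pos two_pos (rateMargin_pos hη hκ ω)) (hε₁ ω))

theorem thresholdFn_pos {a u η' G : M → ℝ} (hη' : ∀ ω, 0 < η' ω) (hG : ∀ ω, 0 < G ω) (ω : M) :
    0 < thresholdFn C₁ δ₁ a u η' G ω :=
  lipThreshold_pos (lt_min (mul_pos (hη' ω) stepLen_pos) (by linarith [hG ω])) (hG ω)

theorem admissible_coneFunctions (hκ : IsMargin μs μu κ) (hη : ∀ ω, 0 < η ω)
    (hgap : ∀ ω, 0 < μu ω - μs ω - 2 * η ω) (hε₁ : ∀ ω, 0 < ε₁ ω) {a u lamS lamU G ϑ : M → ℝ}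
    {ρ : ℝ} (hr : IsRateChoice.{u, v} φ C₁ μs μu (rateMargin η κ) a u lamS lamU)
    (hG0 : ∀ ω, 0 < G ω) (hG1 : ∀ ω, G ω ≤ 1)
    (hG : ∀ ω, G ω ≤ (μu ω - μs ω - rateMargin η κ ω) * ε₁ ω) (hρ0 : 0 < ρ) (hρ1 : ρ ≤ 1 / 2)
    (hϑ0 : ∀ ω, 0 < ϑ ω) (hϑ : ∀ ω, ϑ ω ≤ ρ * thresholdFn C₁ δ₁ a u (rateMargin η κ) G ω) :
    ConeFunctions.Admissible.{u, v} (coneFunctions ρ G ϑ lamS lamU) φ C₁ μs μu η ε₁ δ₁ := by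
  have h1 : ∀ ω, rateMargin η κ ω ≤ η ω / 2 := fun ω => by
    rw [rateMargin]; linarith [min_le_left (η ω) κ]
  have h2 : ∀ ω, rateMargin η κ ω ≤ κ / 2 := fun ω => by
    rw [rateMargin]; linarith [min_le_right (η ω) κ]
  have h3 := rateMargin_pos hη hκ.pos
  refine admissible_of_conesHold hr hκ h3 h1 h2 hgap hG0 hρ0 hρ1 hϑ0 ?_
  exact conesHold_coneFunctions hr h3 (fun ω => by linarith [h1 ω, hgap ω, h3 ω]) hε₁ hG0 hG1 hG
    hρ0 hρ1 hϑ

theorem pointwiseGain_le (hη : ∀ ω, 0 < η ω) (hgap : ∀ ω, 0 < μu ω - μs ω - 2 * η ω)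
    (hκ : 0 < κ) (hε₁ : ∀ ω, 0 < ε₁ ω) (ω : M) :
    pointwiseGain η ε₁ κ ω ≤ (μu ω - μs ω - rateMargin η κ ω) * ε₁ ω := by
  refine (min_le_right _ _).trans (mul_le_mul_of_nonneg_right ?_ (hε₁ ω).le)
  have h1 : rateMargin η κ ω ≤ η ω / 2 := by
    rw [rateMargin]; linarith [min_le_left (η ω) κ]
  linarith [hgap ω, rateMargin_pos hη hκ ω]

/-- Boundedness along the past bounds the threshold from below. -/
theorem exists_lowerBound_thresholdFn {Z : Type u} [NormedAddCommGroup Z] [NormedSpace ℝ Z]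
    [CompleteSpace Z] {𝒮 : DichotomySystem φ Z C₁ μs μu}
    (hδ : ∀ t > 0, ∀ ω, 𝒮.delta₁ t ω = δ₁ t ω) (hη : ∀ ω, 0 < η ω) (hηd : DecreasingAlong φ η)
    (hκ : 0 < κ) (hb : BoundedAlongPast φ μs μu ε₁ δ₁) (ω : M) :
    ∃ m > 0, ∀ (s : ℝ≥0) (ω₀ : M), φ s ω₀ = ω →
      m ≤ thresholdFn C₁ δ₁ (pastRate φ μs) (fun ω => -pastRate φ (fun ω => -μu ω) ω)
        (rateMargin η κ) (pointwiseGain η ε₁ κ) ω₀ := by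
  obtain ⟨c, hc, t₀, ht₀, C, hC⟩ := hb ω
  obtain ⟨h, hh, hstep⟩ := 𝒮.exists_uniform_step hδ ht₀
  have hη' := rateMargin_pos hη hκ ω
  have hg : 0 < min 1 (2 * rateMargin η κ ω * c) := by positivity
  have hx : 0 < min (rateMargin η κ ω * h) (min 1 (2 * rateMargin η κ ω * c) / 8) := by
    positivity
  refine ⟨lipThreshold C₁ (C + C) (min (rateMargin η κ ω * h)
    (min 1 (2 * rateMargin η κ ω * c) / 8)) (min 1 (2 * rateMargin η κ ω * c)),
    lipThreshold_pos hx hg, fun s ω₀ hs => ?_⟩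
  -- The past of a past point belongs to the past of ω, so one set of bounds also controls the rates
  -- `pastRate` at ω₀.
  have hpast : ∀ (r : ℝ≥0) (ω₁ : M), φ r ω₁ = ω₀ → φ (s + r) ω₁ = ω := fun r ω₁ hr => by
    rw [φ.map_add, hr, hs]
  obtain ⟨h1, -, -, h4⟩ := hC s ω₀ hs
  have hle : rateMargin η κ ω ≤ rateMargin η κ ω₀ := by
    rw [← hs]; exact decreasingAlong_rateMargin hηd κ s ω₀
  have hgle : min 1 (2 * rateMargin η κ ω * c) ≤ pointwiseGain η ε₁ κ ω₀ :=
    min_le_min le_rfl (mul_le_mul (by linarith) h1 hc.le (by linarith))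
  refine lipThreshold_mono (add_le_add (abs_pastRate_le fun r ω₁ hr =>
    (hC _ ω₁ (hpast r ω₁ hr)).2.1) ?_) (min_le_min ?_ (by linarith)) hgle hx hg
  · rw [abs_neg]
    refine abs_pastRate_le fun r ω₁ hr => ?_
    rw [abs_neg]
    exact (hC _ ω₁ (hpast r ω₁ hr)).2.2.1
  · exact mul_le_mul hle (hstep ω₀ (h4.trans_lt ENNReal.coe_lt_top)) hh.le (hη'.le.trans hle)

theorem exists_admissible (hη : ∀ ω, 0 < η ω) (hηd : DecreasingAlong φ η)
    (hgap : ∀ ω, 0 < μu ω - μs ω - 2 * η ω) (hε₁ : ∀ ω, 0 < ε₁ ω) :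
    ∃ c : ConeFunctions M,
      ConeFunctions.Admissible.{u, v} c φ C₁ μs μu η ε₁ δ₁ ∧
      DecreasingAlong φ c.lamS ∧ DecreasingAlong φ c.lamU ∧
      (BoundedAlongPast φ μs μu ε₁ δ₁ → DecreasingAlong φ c.ϑ) := by
  obtain ⟨κ, hκ⟩ := exists_isMargin μs μu
  have hr := isRateChoice_past.{u, v} φ C₁ μs μu (rateMargin η κ)
  have hd := decreasingAlong_rateMargin hηd κ
  have hG0 := pointwiseGain_pos hη hκ.pos hε₁
  have hη' := rateMargin_pos hη hκ.pos
  set lamS : M → ℝ :=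
    fun ω => Real.exp (rateMargin η κ ω) * pastInf φ (fun ω => Real.exp (μs ω)) ω
  set lamU : M → ℝ :=
    fun ω => Real.exp (rateMargin η κ ω) * pastInf φ (fun ω => Real.exp (-μu ω)) ω
  set ϑ : M → ℝ := fun ω => 1 / 2 * thresholdFn C₁ δ₁ (pastRate φ μs)
    (fun ω => -pastRate φ (fun ω => -μu ω) ω) (rateMargin η κ) (pointwiseGain η ε₁ κ) ω with hϑ
  have hϑ0 : ∀ ω, 0 < ϑ ω := fun ω => mul_pos (by norm_num) (thresholdFn_pos hη' hG0 ω)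
  have hS : DecreasingAlong φ lamS := decreasingAlong_exp_mul_pastInf hd
  have hU : DecreasingAlong φ lamU := decreasingAlong_exp_mul_pastInf (g := fun ω => -μu ω) hd
  have key : ∀ ϑ' : M → ℝ, (∀ ω, 0 < ϑ' ω) → (∀ ω, ϑ' ω ≤ ϑ ω) →
      ConeFunctions.Admissible.{u, v}
        (coneFunctions (1 / 2) (pointwiseGain η ε₁ κ) ϑ' lamS lamU) φ C₁ μs μu η ε₁ δ₁ :=
    fun ϑ' h0 hle => admissible_coneFunctions hκ hη hgap hε₁ hr hG0 (fun ω => min_le_left _ _)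
      (pointwiseGain_le hη hgap hκ.pos hε₁) (by norm_num) le_rfl h0 hle
  -- δ₁ is an arbitrary function here. If no system realises it, the cone conditions are void and ϑ
  -- = 1 works. Otherwise a system gives the lower bound that keeps the infimum of the threshold
  -- over the past positive.
  by_cases hsys : ∃ (Z : Type u) (_ : NormedAddCommGroup Z) (_ : NormedSpace ℝ Z)
      (_ : CompleteSpace Z) (𝒮 : DichotomySystem φ Z C₁ μs μu),
      ∀ t > 0, ∀ ω, 𝒮.delta₁ t ω = δ₁ t ω
  · by_cases hb : BoundedAlongPast φ μs μu ε₁ δ₁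
    · obtain ⟨Z, _, _, _, 𝒮, hδ⟩ := hsys
      have h0 : ∀ ω, 0 ≤ ϑ ω := fun ω => (hϑ0 ω).le
      refine ⟨_, key (pastInf φ ϑ) (fun ω => ?_) (fun ω => pastInf_le h0), hS, hU,
        fun _ => decreasingAlong_pastInf h0⟩
      obtain ⟨m, hm, hm'⟩ := exists_lowerBound_thresholdFn hδ hη hηd hκ.pos hb ω
      refine (half_pos hm).trans_le (le_pastInf fun s ω₀ hs => ?_)
      have := hm' s ω₀ hs
      simp only [hϑ]
      linarith
    · exact ⟨_, key ϑ hϑ0 fun ω => le_rfl, hS, hU, fun h => absurd h hb⟩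
  · refine ⟨coneFunctions (1 / 2) (pointwiseGain η ε₁ κ) (fun _ => 1) lamS lamU, ?_, hS, hU,
      fun _ _ _ => le_rfl⟩
    refine admissible_of_conesHold hr hκ hη' (fun ω => ?_) (fun ω => ?_) hgap hG0 (by norm_num)
      le_rfl (fun _ => one_pos) fun Z i₁ i₂ i₃ 𝒮 hδ => absurd ⟨Z, i₁, i₂, i₃, 𝒮, hδ⟩ hsys
    · rw [rateMargin]; linarith [min_le_left (η ω) κ]
    · rw [rateMargin]; linarith [min_le_right (η ω) κ]

theorem exists_admissible_const (hη : ∀ ω, 0 < η ω) (hηd : DecreasingAlong φ η)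
    (hgap : ∀ ω, 0 < μu ω - μs ω - 2 * η ω) (hε₁ : ∀ ω, 0 < ε₁ ω)
    (hγ : ∃ γ > 0, ∀ ω, γ ≤ ε₁ ω * (μu ω - μs ω)) :
    ∃ (ϑ lamS lamU : M → ℝ) (k : ℝ),
      DecreasingAlong φ lamS ∧ DecreasingAlong φ lamU ∧ (∀ ω, 0 < ϑ ω) ∧
      ∀ ρ > 0, ∃ ε₀ > 0, ∃ α α₁ β β₁ : ℝ, α₁ ≤ ρ ∧ β₁ ≤ ρ ∧
        ConeFunctions.Admissible.{u, v}
          ⟨fun ω => min (ϑ ω) ε₀, fun _ => α, fun _ => α₁, fun _ => β, fun _ => β₁,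
            fun _ => k, lamS, lamU⟩ φ C₁ μs μu η ε₁ δ₁ := by
  obtain ⟨κ, hκ⟩ := exists_isMargin μs μu
  obtain ⟨γ, hγ, hγ'⟩ := hγ
  have hr := isRateChoice_past.{u, v} φ C₁ μs μu (rateMargin η κ)
  have hd := decreasingAlong_rateMargin hηd κ
  have hη' := rateMargin_pos hη hκ.pos
  have hG0 : 0 < min 1 (γ / 2) := by positivity
  set θ : M → ℝ := thresholdFn C₁ δ₁ (pastRate φ μs)
    (fun ω => -pastRate φ (fun ω => -μu ω) ω) (rateMargin η κ) fun _ => min 1 (γ / 2)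
  have hθ : ∀ ω, 0 < θ ω := thresholdFn_pos hη' fun _ => hG0
  -- ϑ must not depend on ρ, while the required bound is ρθ. It follows from min(θ², ρ²) ≤ ρθ, which
  -- explains the squares in ϑ and ε₀, with ρ cut off at 1/2.
  refine ⟨fun ω => θ ω ^ 2, _, _, 2, decreasingAlong_exp_mul_pastInf (g := μs) hd,
    decreasingAlong_exp_mul_pastInf (g := fun ω => -μu ω) hd, fun ω => pow_pos (hθ ω) 2,
    fun ρ hρ => ?_⟩
  have hρ' : 0 < min ρ (1 / 2) := by positivity
  refine ⟨min ρ (1 / 2) ^ 2, pow_pos hρ' 2, min ρ (1 / 2) * Real.exp (-min 1 (γ / 2) / 2),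
    min ρ (1 / 2), min ρ (1 / 2) * Real.exp (-min 1 (γ / 2) / 2), min ρ (1 / 2),
    min_le_left _ _, min_le_left _ _, ?_⟩
  refine admissible_coneFunctions (G := fun _ => min 1 (γ / 2)) hκ hη hgap hε₁ hr (fun _ => hG0)
    (fun _ => min_le_left _ _) (fun ω => ?_) hρ' (min_le_right _ _)
    (fun ω => lt_min (pow_pos (hθ ω) 2) (pow_pos hρ' 2)) fun ω => ?_
  · have h1 : rateMargin η κ ω ≤ (μu ω - μs ω) / 2 := by
      rw [rateMargin]; linarith [min_le_left (η ω) κ, hgap ω, hη ω]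
    have h2 := mul_le_mul_of_nonneg_left h1 (hε₁ ω).le
    linarith [hγ' ω, min_le_right 1 (γ / 2)]
  · change min (θ ω ^ 2) (min ρ (1 / 2) ^ 2) ≤ min ρ (1 / 2) * θ ω
    rcases le_total (θ ω) (min ρ (1 / 2)) with h | h
    · refine (min_le_left _ _).trans ?_
      rw [sq]
      exact mul_le_mul_of_nonneg_right h (hθ ω).le
    · refine (min_le_right _ _).trans ?_
      rw [sq]
      exact mul_le_mul_of_nonneg_left h hρ'.le

/-- Admissible functions with the rates of the dichotomy. -/
theorem admissible_self (hκ : IsMargin μs μu κ) (hη : ∀ ω, 0 < η ω)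
    (hgap : ∀ ω, 0 < μu ω - μs ω - 2 * η ω) (hε₁ : ∀ ω, 0 < ε₁ ω) :
    ConeFunctions.Admissible.{u, v} (coneFunctions (1 / 2) (pointwiseGain η ε₁ κ)
      (fun ω => 1 / 2 * thresholdFn C₁ δ₁ μs μu (rateMargin η κ) (pointwiseGain η ε₁ κ) ω)
      (fun ω => Real.exp (μs ω + rateMargin η κ ω)) fun ω => Real.exp (-μu ω + rateMargin η κ ω))
      φ C₁ μs μu η ε₁ δ₁ := by
  have hG0 := pointwiseGain_pos hη hκ.pos hε₁
  exact admissible_coneFunctions hκ hη hgap hε₁ (isRateChoice_self φ C₁ μs μu _) hG0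
    (fun ω => min_le_left _ _) (pointwiseGain_le hη hgap hκ.pos hε₁) (by norm_num) le_rfl
    (fun ω => mul_pos (by norm_num) (thresholdFn_pos (rateMargin_pos hη hκ.pos) hG0 ω))
    fun ω => le_rfl

theorem abs_exp_rate_sub_le {g : M → ℝ} {K : ℝ} (hg : ∀ ω, g ω ≤ K) (hη : ∀ ω, η ω ≤ K)
    (hη0 : ∀ ω, 0 < η ω) (κ : ℝ) (m m₀ : M) :
    |Real.exp (g m + rateMargin η κ m) - Real.exp (g m₀ + rateMargin η κ m₀)| ≤
      Real.exp (2 * K) * (|g m - g m₀| + |η m - η m₀|) := by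
  have h1 : ∀ ω, g ω + rateMargin η κ ω ≤ 2 * K := fun ω => by
    rw [rateMargin]; linarith [min_le_left (η ω) κ, hg ω, hη ω, hη0 ω]
  refine (abs_exp_sub_exp_le (h1 m) (h1 m₀)).trans
    (mul_le_mul_of_nonneg_left ?_ (Real.exp_pos _).le)
  rw [add_sub_add_comm]
  refine (abs_add_le _ _).trans (add_le_add le_rfl ?_)
  have h2 : |rateMargin η κ m - rateMargin η κ m₀| = |min (η m) κ - min (η m₀) κ| / 2 := by
    rw [rateMargin, rateMargin, ← sub_div, abs_div, abs_two]
  have h3 := abs_min_sub_min_le_max (η m) κ (η m₀) κ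
  rw [sub_self, abs_zero, max_eq_left (abs_nonneg _)] at h3
  rw [h2]
  linarith [abs_nonneg (min (η m) κ - min (η m₀) κ)]

/-- The rates of the dichotomy are kept, because an infimum over the past need not inherit
continuity. The exponential is Lipschitz on bounded sets with constant e^{2K}, and the two functions
involved double it to C = 2e^{2K}. -/
theorem exists_admissible_bounded (hη : ∀ ω, 0 < η ω) (hηd : DecreasingAlong φ η)
    (hgap : ∀ ω, 0 < μu ω - μs ω - 2 * η ω) (hε₁ : ∀ ω, 0 < ε₁ ω)
    (hK : ∃ K : ℝ, ∀ ω, |μs ω| ≤ K ∧ |μu ω| ≤ K ∧ η ω ≤ K) :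
    ∃ C > 0, ∃ c : ConeFunctions M,
      ConeFunctions.Admissible.{u, v} c φ C₁ μs μu η ε₁ δ₁ ∧
      (∃ K : ℝ, ∀ ω, c.lamS ω ≤ K ∧ c.lamU ω ≤ K) ∧
      (DecreasingAlong φ μs → DecreasingAlong φ c.lamS) ∧
      (DecreasingAlong φ (fun ω => -μu ω) → DecreasingAlong φ c.lamU) ∧
      ∀ (loc : LocallyMetrizable M) (M₁ : Set M), ∀ ξ ≥ 0,
        loc.AlmostUniformlyContinuous M₁ ξ μs → loc.AlmostUniformlyContinuous M₁ ξ μu →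
        loc.AlmostUniformlyContinuous M₁ ξ η →
        loc.AlmostUniformlyContinuous M₁ (C * ξ) c.lamS ∧
        loc.AlmostUniformlyContinuous M₁ (C * ξ) c.lamU := by
  obtain ⟨κ, hκ⟩ := exists_isMargin μs μu
  obtain ⟨K, hK⟩ := hK
  have hs : ∀ ω, μs ω ≤ K := fun ω => (le_abs_self _).trans (hK ω).1
  have hu : ∀ ω, -μu ω ≤ K := fun ω => (neg_le_abs _).trans (hK ω).2.1
  have hηK : ∀ ω, η ω ≤ K := fun ω => (hK ω).2.2
  have hd := decreasingAlong_rateMargin hηd κ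
  have hm : ∀ ω, rateMargin η κ ω ≤ K := fun ω => by
    rw [rateMargin]; linarith [min_le_left (η ω) κ, hηK ω, hη ω]
  refine ⟨2 * Real.exp (2 * K), mul_pos two_pos (Real.exp_pos _), _,
    admissible_self hκ hη hgap hε₁, ⟨Real.exp (2 * K), fun ω => ⟨?_, ?_⟩⟩, fun h s ω => ?_,
    fun h s ω => ?_, fun loc M₁ ξ hξ h1 h2 h3 => ⟨?_, ?_⟩⟩
  · exact Real.exp_le_exp.2 (by linarith [hs ω, hm ω])
  · exact Real.exp_le_exp.2 (by linarith [hu ω, hm ω])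
  · exact Real.exp_le_exp.2 (add_le_add (h s ω) (hd s ω))
  · exact Real.exp_le_exp.2 (add_le_add (h s ω) (hd s ω))
  · exact .of_abs_sub_le hξ (Real.exp_pos _).le (abs_exp_rate_sub_le hs hηK hη κ) h1 h3
  · refine .of_abs_sub_le hξ (Real.exp_pos _).le
      (abs_exp_rate_sub_le (g := fun ω => -μu ω) hu hηK hη κ) ?_ h3
    have e : loc.amplitude M₁ (fun ω => -μu ω) = loc.amplitude M₁ μu := by
      funext σ
      simp only [LocallyMetrizable.amplitude, neg_sub_neg, abs_sub_comm]
    rw [LocallyMetrizable.AlmostUniformlyContinuous, e]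
    exact h2

theorem invariantAlong_iff {g : M → ℝ} :
    InvariantAlong φ g ↔ ∀ (s : ℝ≥0) (ω : M), g (φ s ω) = g ω :=
  ⟨fun h s ω => le_antisymm (h.1 s ω) (neg_le_neg_iff.1 (h.2 s ω)),
    fun h => ⟨fun s ω => (h s ω).le, fun s ω => neg_le_neg (h s ω).ge⟩⟩

/-- All functions of `admissible_self` are pointwise expressions in δ₁, μ_s, μ_u, η and ε₁. The step
length only uses δ₁ at positive times. -/
theorem exists_admissible_invariant (hη : ∀ ω, 0 < η ω)
    (hgap : ∀ ω, 0 < μu ω - μs ω - 2 * η ω) (hε₁ : ∀ ω, 0 < ε₁ ω)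
    (hδ : ∀ t > 0, ∀ (s : ℝ≥0) (ω : M), δ₁ t (φ s ω) = δ₁ t ω) (hs : InvariantAlong φ μs)
    (hu : InvariantAlong φ μu) (hηi : InvariantAlong φ η) (hεi : InvariantAlong φ ε₁) :
    ∃ c : ConeFunctions M,
      ConeFunctions.Admissible.{u, v} c φ C₁ μs μu η ε₁ δ₁ ∧
      InvariantAlong φ c.ϑ ∧ InvariantAlong φ c.α ∧ InvariantAlong φ c.α₁ ∧
      InvariantAlong φ c.β ∧ InvariantAlong φ c.β₁ ∧ InvariantAlong φ c.k ∧
      InvariantAlong φ c.lamS ∧ InvariantAlong φ c.lamU := by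
  obtain ⟨κ, hκ⟩ := exists_isMargin μs μu
  rw [invariantAlong_iff] at hs hu hηi hεi
  have h1 : ∀ (s : ℝ≥0) (ω : M), rateMargin η κ (φ s ω) = rateMargin η κ ω := fun s ω => by
    simp only [rateMargin, hηi]
  have h2 : ∀ (s : ℝ≥0) (ω : M), pointwiseGain η ε₁ κ (φ s ω) = pointwiseGain η ε₁ κ ω :=
    fun s ω => by simp only [pointwiseGain, h1, hεi]
  have h3 : ∀ (s : ℝ≥0) (ω : M), stepLen δ₁ (φ s ω) = stepLen δ₁ ω := fun s ω => by
    have : stepSet δ₁ (φ s ω) = stepSet δ₁ ω := by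
      ext h
      exact and_congr_right fun hh => by rw [hδ h hh]
    rw [stepLen, stepLen, this]
  refine ⟨_, admissible_self hκ hη hgap hε₁, ?_⟩
  simp only [invariantAlong_iff, coneFunctions, thresholdFn, h1, h2, h3, hs, hu, implies_true,
    and_self]

end General

theorem mainTheorem2 {M : Type v} [TopologicalSpace M] [T2Space M] (φ : Flow ℝ≥0 M)
    (C₁ : ℝ) (μs μu : M → ℝ) :
    -- (1) the case `δ(t)/t → 1`
    (∀ (Z : Type u) [NormedAddCommGroup Z] [NormedSpace ℝ Z] [CompleteSpace Z]
      (𝒮 : DichotomySystem φ Z C₁ μs μu),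
      Tendsto (fun t => 𝒮.δ t / t) (𝓝[>] 0) (𝓝 1) →
      (∀ f : M → 𝒮.E → Z, 𝒮.IsNonlinearity f →
        (∀ ω, 0 < μu ω - μs ω - 2 * 𝒮.eps' f ω) →
        (∀ α β : M → ℝ,
          (∀ ω, 𝒮.coneBound f ω ≤ α ω ∧ α ω < 1 ∧ 𝒮.coneBound f ω ≤ β ω ∧ β ω < 1) →
          ∀ ω, ∀ t ≥ 0, ∀ s ≥ 0, SatisfiesAB (𝒮.H f t (orb φ s ω))
            (α ω) (α ω) (𝒮.lamU f ω ^ t) (β ω) (β ω) (𝒮.lamS f ω ^ t)) ∧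
        (∀ α β : M → ℝ,
          (∀ ω, 𝒮.coneBound f ω < α ω ∧ α ω < 1 ∧ 𝒮.coneBound f ω < β ω ∧ β ω < 1) →
          ∃ kα kβ : M → ℝ → ℝ, ∀ ω, ∀ ε₁ > 0,
            (0 < kα ω ε₁ ∧ kα ω ε₁ < 1 ∧ 0 < kβ ω ε₁ ∧ kβ ω ε₁ < 1) ∧
            ∀ t ≥ ε₁, ∀ s ≥ 0, SatisfiesAB (𝒮.H f t (orb φ s ω))
              (α ω) (kα ω ε₁ * α ω) (𝒮.lamU f ω ^ t)
              (β ω) (kβ ω ε₁ * β ω) (𝒮.lamS f ω ^ t)) ∧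
        (∀ c > 1, (∃ γ > 0, ∀ ω, γ ≤ μu ω - μs ω - (1 + c) * 𝒮.eps' f ω) →
          𝒮.HasUniformCones f 1 ∧ ∃ q < 1, ∀ ω, 𝒮.lamS f ω * 𝒮.lamU f ω ≤ q)) ∧
      (∀ c > 1, ∀ ρ > 0, ∃ ε₀ > 0, ∀ f : M → 𝒮.E → Z, 𝒮.IsNonlinearity f →
        (∃ γ > 0, ∀ ω, γ ≤ μu ω - μs ω - (1 + c) * 𝒮.eps' f ω) →
        (∀ ω, 𝒮.eps' f ω ≤ ε₀) → 𝒮.HasUniformCones f ρ)) ∧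
    -- (2) the general case
    (∀ (η ε₁ : M → ℝ) (δ₁ : ℝ → M → ℝ≥0∞), (∀ ω, 0 < η ω) → DecreasingAlong φ η →
      (∀ ω, 0 < μu ω - μs ω - 2 * η ω) → (∀ ω, 0 < ε₁ ω) →
      -- the functions, with (a), (b), (e)
      (∃ c : ConeFunctions M,
        ConeFunctions.Admissible.{u, v} c φ C₁ μs μu η ε₁ δ₁ ∧
        DecreasingAlong φ c.lamS ∧ DecreasingAlong φ c.lamU ∧
        (BoundedAlongPast φ μs μu ε₁ δ₁ → DecreasingAlong φ c.ϑ)) ∧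
      -- (c)
      ((∃ γ > 0, ∀ ω, γ ≤ ε₁ ω * (μu ω - μs ω)) →
        ∃ (ϑ lamS lamU : M → ℝ) (k : ℝ),
          DecreasingAlong φ lamS ∧ DecreasingAlong φ lamU ∧ (∀ ω, 0 < ϑ ω) ∧
          ∀ ρ > 0, ∃ ε₀ > 0, ∃ α α₁ β β₁ : ℝ, α₁ ≤ ρ ∧ β₁ ≤ ρ ∧
            ConeFunctions.Admissible.{u, v}
              ⟨fun ω => min (ϑ ω) ε₀, fun _ => α, fun _ => α₁, fun _ => β, fun _ => β₁,
                fun _ => k, lamS, lamU⟩ φ C₁ μs μu η ε₁ δ₁) ∧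
      -- (d)
      ((∃ K : ℝ, ∀ ω, |μs ω| ≤ K ∧ |μu ω| ≤ K ∧ η ω ≤ K) →
        ∃ C > 0, ∃ c : ConeFunctions M,
          ConeFunctions.Admissible.{u, v} c φ C₁ μs μu η ε₁ δ₁ ∧
          (∃ K : ℝ, ∀ ω, c.lamS ω ≤ K ∧ c.lamU ω ≤ K) ∧
          (DecreasingAlong φ μs → DecreasingAlong φ c.lamS) ∧
          (DecreasingAlong φ (fun ω => -μu ω) → DecreasingAlong φ c.lamU) ∧
          ∀ (loc : LocallyMetrizable M) (M₁ : Set M), ∀ ξ ≥ 0,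
            loc.AlmostUniformlyContinuous M₁ ξ μs → loc.AlmostUniformlyContinuous M₁ ξ μu →
            loc.AlmostUniformlyContinuous M₁ ξ η →
            loc.AlmostUniformlyContinuous M₁ (C * ξ) c.lamS ∧
            loc.AlmostUniformlyContinuous M₁ (C * ξ) c.lamU) ∧
      -- (f)
      ((∀ t > 0, ∀ (s : ℝ≥0) (ω : M), δ₁ t (φ s ω) = δ₁ t ω) →
        InvariantAlong φ μs → InvariantAlong φ μu → InvariantAlong φ η → InvariantAlong φ ε₁ →
        ∃ c : ConeFunctions M,
          ConeFunctions.Admissible.{u, v} c φ C₁ μs μu η ε₁ δ₁ ∧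
          InvariantAlong φ c.ϑ ∧ InvariantAlong φ c.α ∧ InvariantAlong φ c.α₁ ∧
          InvariantAlong φ c.β ∧ InvariantAlong φ c.β₁ ∧ InvariantAlong φ c.k ∧
          InvariantAlong φ c.lamS ∧ InvariantAlong φ c.lamU)) := by
  refine ⟨fun Z _ _ _ 𝒮 hδ => ⟨fun f hf hgap => ⟨fun α β h ω t ht s hs => ?_,
    fun α β h => DichotomySystem.exists_coneGain hδ hf hgap h, fun c hc ⟨γ, hγ, hγ'⟩ =>
      DichotomySystem.uniform_of_gap hδ hf hc hγ hγ'⟩,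
    fun c hc ρ hρ => 𝒮.uniform_small hδ hc hρ⟩, fun η ε₁ δ₁ hη hηd hgap hε₁ =>
      ⟨exists_admissible hη hηd hgap hε₁, exists_admissible_const hη hηd hgap hε₁,
        exists_admissible_bounded hη hηd hgap hε₁, exists_admissible_invariant hη hgap hε₁⟩⟩
  obtain ⟨h1, h2, h3, h4⟩ := h ω
  exact DichotomySystem.satisfiesAB_pointwise hδ hf (hgap ω) h1 h2 h3 h4 ht hs
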